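/- Let $d\ge 1$ be an integer and $\gamma>0$. Let $$\mathfrak V_2^d=\{X=(X^1,\dots,X^d)\in M_2(\mathbb C)^d:\ X^rX^s=X^sX^r\ \text{for all } 1\le r,s\le d\}$$ be the set of commuting $d$-tuples of complex $2\times 2$ matrices, viewed as a subset of $\mathbb C^{4d}$ with its Euclidean metric, let $\|X\|_F^2=\sum_{r}\sum_{i,j}|X^r_{ij}|^2$, and let $dX$ be the Hausdorff measure on $\mathfrak V_2^d$ of dimension $\dim_{\mathbb R}\mathfrak V_2^d$. For $X\in\mathfrak V_2^d$ there is a unitary $U$ such that all $U^*X^rU$ are upper triangular; the (joint) eigenvalues of $X$ are the two points $\lambda_1,\lambda_2\in\mathbb C^d$ whose $r$-th coordinates are the diagonal entries of $U^*X^rU$ (as an unordered pair with multiplicity they do not depend on $U$). Then there is a constant $C>0$ such that $w(X)\,dX$, with $w(X)=Ce^{-\gamma\|X\|_F^2}$, is a probability measure on $\mathfrak V_2^d$. Moreover there is a constant $C'_d>0$, depending only on $d$ and $\gamma$, such that the eigenvalues $\lambda=(\lambda_1,\lambda_2)$ of every random $X\in\mathfrak V_2^d$ with distribution $w(X)\,dX$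 have density $$\rho^d(\lambda)=C'_d\,e^{-\gamma(|\lambda_1|^2+|\lambda_2|^2)}\,|\lambda_2-\lambda_1|^2\sum_{j=0}^{d-1}\frac{1}{(d-1-j)!}\,\frac{2^j}{\gamma^{j+1}}\,\frac{1}{|\lambda_2-\lambda_1|^{2j}}$$ with respect to Lebesgue measure on $(\mathbb C^d)^2$. That is: $\mathbb E f(\lambda)=\int f\rho^d\,d\lambda$ for every measurable $f:(\mathbb C^d)^2\to[0,\infty]$ invariant under exchanging $\lambda_1$ and $\lambda_2$; and if the eigenvalues are listed in random order, so that the law of $(\lambda_1,\lambda_2)$ is invariant under exchanging the two, then this law is $\rho^d(\lambda)\,d\lambda$. For $d=1,2,3$ one gets respectively, for $\lambda_1\ne\lambda_2$, $$\rho^1(\lambda)=C'_1e^{-\gamma(|\lambda_1|^2+|\lambda_2|^2)}\Big[\tfrac1\gamma|\lambda_2-\lambda_1|^2\Big],$$ $$\rho^2(\lambda)=C'_2e^{-\gamma(|\lambda_1|^2+|\lambda_2|^2)}\Big[\tfrac1\gamma|\lambda_2-\lambda_1|^2+\tfrac{2}{\gamma^2}\Big],$$ $$\rho^3(\lambda)=C'_3e^{-\gamma(|\lambda_1|^2+|\lambda_2|^2)}\Big[\tfrac1{2\gamma}|\lambda_2-\lambda_1|^2+\tfrac{2}{\gamma^2}+\tfrac{4}{\gamma^3}|\lambda_2-\lambda_1|^{-2}\Big].$$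 For $d\ge 3$ the eigenvalues attract each other rather than repel: for every $a\in\mathbb C^d$, $\rho^d(\lambda_1,\lambda_2)\to\infty$ as $(\lambda_1,\lambda_2)\to(a,a)$ with $\lambda_1\neq\lambda_2$. -/

import Mathlib

open MeasureTheory Filter Topology
open scoped ENNReal Matrix Nat

noncomputable section

/-- `d`-tuples of complex `n × n` matrices, with the Euclidean metric on `ℂ^(d n²)`. The norm is the
Frobenius norm `(∑_r ∑_{i,j} |X^r_{ij}|²)^{1/2}`. The entry `X^r_{ij}` is `X (r, i, j)`. -/
abbrev MatTuple (d n : ℕ) : Type := EuclideanSpace ℂ (Fin d × Fin n × Fin n)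

/-- The `r`-th matrix of a tuple. -/
def MatTuple.comp {d n : ℕ} (X : MatTuple d n) (r : Fin d) : Matrix (Fin n) (Fin n) ℂ :=
  Matrix.of fun i j => X (r, i, j)

/-- The algebraic set of commuting `d`-tuples of `n × n` matrices. -/
def commutingTuples (d n : ℕ) : Set (MatTuple d n) :=
  {X | ∀ r s : Fin d, X.comp r * X.comp s = X.comp s * X.comp r}

/-- The measure `C e^{-γ ‖X‖_F²} dX` on the commuting tuples, `dX` being the Hausdorff measure whose
dimension is the (real, Hausdorff) dimension of the set of commuting tuples. -/
def gaussianCommuting (d n : ℕ) (γ C : ℝ) : Measure (MatTuple d n) :=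
  ((Measure.hausdorffMeasure (dimH (commutingTuples d n)).toReal :
      Measure (MatTuple d n)).restrict (commutingTuples d n)).withDensity
    fun X => ENNReal.ofReal (C * Real.exp (-γ * ‖X‖ ^ 2))

/-- Ordered `n`-tuples of points of `ℂ^d`; each `ℂ^d` carries its Euclidean norm, and the measure
`volume` is Lebesgue measure. -/
abbrev Points (d n : ℕ) : Type := Fin n → EuclideanSpace ℂ (Fin d)

/-- `l = (l_1, …, l_n)` is a listing of the joint eigenvalues of `X` with multiplicity: some unitary
`U` makes all `U* X^r U` upper triangular, with `j`-th diagonal entry `l_j^r`. -/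
def IsEigenvalueListing {d n : ℕ} (X : MatTuple d n) (l : Points d n) : Prop :=
  ∃ U ∈ Matrix.unitaryGroup (Fin n) ℂ, ∀ r : Fin d,
    (∀ i j : Fin n, j < i → (Uᴴ * X.comp r * U) i j = 0) ∧
    ∀ j : Fin n, (Uᴴ * X.comp r * U) j j = l j r

/-- The eigenvalues of the random tuple `X` have density `ρ`.
The first clause is about the unordered eigenvalues: it tests against all symmetric functions of the
eigenvalues, so that the listing `L` used to evaluate them is immaterial. The second clause is about
the eigenvalues listed in random order, that is, with an exchangeable law. -/
def HasEigenvalueDensity {d n : ℕ} {Ω : Type*} [MeasurableSpace Ω] (P : Measure Ω)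
    (X : Ω → MatTuple d n) (ρ : Points d n → ℝ) : Prop :=
  (∀ f : Points d n → ℝ≥0∞, Measurable f → (∀ (σ : Equiv.Perm (Fin n)) l, f (l ∘ σ) = f l) →
    ∀ L : Ω → Points d n, (∀ᵐ ω ∂P, IsEigenvalueListing (X ω) (L ω)) →
      ∫⁻ ω, f (L ω) ∂P = ∫⁻ l, f l * ENNReal.ofReal (ρ l)) ∧
  (∀ L : Ω → Points d n, AEMeasurable L P → (∀ᵐ ω ∂P, IsEigenvalueListing (X ω) (L ω)) →
    (∀ σ : Equiv.Perm (Fin n), P.map (fun ω => L ω ∘ σ) = P.map L) →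
      P.map L = (volume : Measure (Points d n)).withDensity fun l => ENNReal.ofReal (ρ l))

/-- The function
`c e^{-γ(|λ₁|²+|λ₂|²)} |λ₂-λ₁|² ∑_{j<d} 2^j / ((d-1-j)! γ^{j+1} |λ₂-λ₁|^{2j})` on `(ℂ^d)²`. -/
def eigDensity (d : ℕ) (γ c : ℝ) (l : Points d 2) : ℝ :=
  c * Real.exp (-γ * (‖l 0‖ ^ 2 + ‖l 1‖ ^ 2)) * ‖l 1 - l 0‖ ^ 2 *
    ∑ j ∈ Finset.range d,
      1 / ((d - 1 - j)! : ℝ) * (2 ^ j / γ ^ (j + 1)) * (1 / ‖l 1 - l 0‖ ^ (2 * j))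

end

/-! Commuting matrices in `𝔰𝔩₂` are proportional, so a commuting tuple has the form `a ⊗ 1 + v ⊗ w`
with `a, v ∈ ℂ^d` and `w ∈ 𝔰𝔩₂ ≅ ℂ³` (`exists_eq_rankOne`). The variety is thus `ℂ^d` times the cone
of `d × 3` matrices of rank at most one, of real dimension `4d + 4`. No Jacobian on the variety is
computed. The Frobenius metric is respected by translations of `a`, by `U(d)`, by dilations up to
their factor, and by all of `U(3)` acting on `𝔰𝔩₂`, which is much more than conjugation. Together
these act transitively off the scalar tuples. Christensen's theorem on uniformly distributed
measures then shows that two measures with these symmetries are proportional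
(`IsHomogeneousMeasure.exists_eq_smul`), so the Hausdorff measure may be replaced by `modelMeasure`,
the image of an explicit product measure in `(a, v, w)`. The eigenvalues of `a ⊗ 1 + v ⊗ w` are `a ±
τ v` with `τ² = -det w`. After the substitution `u = τ v` the integrand depends on `w` only through
`e^{-‖w‖²}` and `q = ‖w‖² / |τ|²`. A Schur form with diagonal `±τ` and off-diagonal entry `β τ` has
`q = 2 + |β|²`, and under `e^{-‖w‖²} dw` this ratio is distributed as `2 + |β|²` under a multiple of
`(2 + |β|²)⁻³ dβ` (`exists_lintegral_eigenvalueRatio`). Hence `u` has a density proportional to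
`|u|⁴ ∫ (2 + |β|²)^{d-1} e^{-γ|u|²(2 + |β|²)} dβ`, and the binomial theorem turns this integral into
the stated sum. To return to arbitrary listings of eigenvalues, a symmetric function of `a ± u` is a
function of `a` and of the products `u_r u_s`, both polynomial in the tuple through traces
(`exists_measurable_eq_of_isEigenvalueListing`). The exchangeable law follows by symmetrizing
indicators. -/

/-! ### Uniformly distributed measures. -/

/-- One half of Christensen's comparison of two uniformly distributed measures. -/
theorem measure_le_liminf_mul_of_uniform {X : Type*} [TopologicalSpace X] [MeasurableSpace X]
    [OpensMeasurableSpace X] {μ ν : Measure X} [SFinite μ] [SFinite ν] {S : Set X}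
    (hμS : ∀ᵐ x ∂μ, x ∈ S) (hνS : ∀ᵐ x ∂ν, x ∈ S) {R : ℕ → Set (X × X)}
    (hR : ∀ n, MeasurableSet (R n)) (hsymm : ∀ n x y, (x, y) ∈ R n → (y, x) ∈ R n)
    {a b : ℕ → ℝ≥0∞} (ha0 : ∀ n, a n ≠ 0) (hat : ∀ n, a n ≠ ∞)
    (hμ : ∀ n, ∀ x ∈ S, μ {y | (x, y) ∈ R n} = a n)
    (hν : ∀ n, ∀ x ∈ S, ν {y | (x, y) ∈ R n} = b n)
    (hsmall : ∀ U, IsOpen U → ∀ x ∈ U ∩ S, ∀ᶠ n in atTop, {y | (x, y) ∈ R n} ⊆ U)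
    {U : Set X} (hU : IsOpen U) (hμU : μ U ≠ ∞) :
    ν U ≤ liminf (fun n => b n / a n) atTop * μ U := by
  have hT : ∀ n, MeasurableSet (R n ∩ U ×ˢ U) := fun n =>
    (hR n).inter (hU.measurableSet.prod hU.measurableSet)
  have hmeas : ∀ n, Measurable fun x => μ (Prod.mk x ⁻¹' (R n ∩ U ×ˢ U)) / a n := fun n =>
    (measurable_measure_prodMk_left (hT n)).div_const _
  -- For `x` in the open set the neighbourhoods eventually lie inside `U`, so the ratio tends to
  -- `1`; Fatou's lemma then moves the `liminf` outside.
  have h1 : ν U ≤ ∫⁻ x, liminf (fun n => μ (Prod.mk x ⁻¹' (R n ∩ U ×ˢ U)) / a n) atTop ∂ν := by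
    rw [← lintegral_indicator_one hU.measurableSet]
    refine lintegral_mono_ae ?_
    filter_upwards [hνS] with x hxS
    by_cases hxU : x ∈ U
    · rw [Set.indicator_of_mem hxU]
      refine le_liminf_of_le (by isBoundedDefault) ?_
      filter_upwards [hsmall U hU x ⟨hxU, hxS⟩] with n hn
      have : Prod.mk x ⁻¹' (R n ∩ U ×ˢ U) = {y | (x, y) ∈ R n} := by
        ext y
        simp only [Set.mem_preimage, Set.mem_inter_iff, Set.mem_prod, Set.mem_ofPred_eq]
        exact ⟨fun h => h.1, fun h => ⟨h, hxU, hn h⟩⟩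
      rw [this, hμ n x hxS, ENNReal.div_self (ha0 n) (hat n)]
      exact le_rfl
    · rw [Set.indicator_of_notMem hxU]; exact zero_le
  refine h1.trans ((lintegral_liminf_le hmeas).trans ?_)
  -- Tonelli: the double integral over pairs of related points of `U` is now computed with `ν`
  -- inside, where symmetry of the relation bounds each fibre by `b n`.
  have h2 : ∀ n, ∫⁻ x, μ (Prod.mk x ⁻¹' (R n ∩ U ×ˢ U)) / a n ∂ν ≤ μ U * (b n / a n) := by
    intro n
    simp only [div_eq_mul_inv]
    rw [lintegral_mul_const _ (measurable_measure_prodMk_left (hT n)),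
      ← Measure.prod_apply (hT n), Measure.prod_apply_symm (hT n), ← mul_assoc]
    gcongr
    calc ∫⁻ y, ν ((fun x => (x, y)) ⁻¹' (R n ∩ U ×ˢ U)) ∂μ
        ≤ ∫⁻ y, U.indicator (fun _ => b n) y ∂μ := by
          refine lintegral_mono_ae ?_
          filter_upwards [hμS] with y hyS
          by_cases hyU : y ∈ U
          · rw [Set.indicator_of_mem hyU, ← hν n y hyS]
            exact measure_mono fun x hx => hsymm n _ _ hx.1
          · have : (fun x => (x, y)) ⁻¹' (R n ∩ U ×ˢ U) = ∅ := by
              ext x; simp [hyU]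
            rw [this, measure_empty]; exact zero_le
      _ = μ U * b n := by
          rw [lintegral_indicator_const hU.measurableSet, mul_comm]
  refine (liminf_le_liminf (Eventually.of_forall h2)).trans ?_
  rw [mul_comm, ENNReal.liminf_const_mul_of_ne_top hμU]

/-- Christensen's theorem: two uniformly distributed measures are proportional. -/
theorem exists_eq_smul_of_uniform {X : Type*} [TopologicalSpace X] [SecondCountableTopology X]
    [MeasurableSpace X] [BorelSpace X] {μ ν : Measure X} [SFinite μ] [SFinite ν] {S : Set X}
    (hSne : S.Nonempty)
    (hμS : ∀ᵐ x ∂μ, x ∈ S) (hνS : ∀ᵐ x ∂ν, x ∈ S) {R : ℕ → Set (X × X)}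
    (hR : ∀ n, IsOpen (R n)) (hsymm : ∀ n x y, (x, y) ∈ R n → (y, x) ∈ R n)
    {a b : ℕ → ℝ≥0∞} (ha0 : ∀ n, a n ≠ 0) (hat : ∀ n, a n ≠ ∞) (hb0 : ∀ n, b n ≠ 0)
    (hbt : ∀ n, b n ≠ ∞)
    (hμ : ∀ n, ∀ x ∈ S, μ {y | (x, y) ∈ R n} = a n)
    (hν : ∀ n, ∀ x ∈ S, ν {y | (x, y) ∈ R n} = b n)
    (hsmall : ∀ U, IsOpen U → ∀ x ∈ U ∩ S, ∀ᶠ n in atTop, {y | (x, y) ∈ R n} ⊆ U)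
    {O : ℕ → Set X} (hO : ∀ n, IsOpen (O n)) (hOS : S ⊆ ⋃ n, O n)
    (hμO : ∀ n, μ (O n) ≠ ∞) (hνO : ∀ n, ν (O n) ≠ ∞) :
    ∃ c : ℝ≥0∞, c ≠ 0 ∧ c ≠ ∞ ∧ ν = c • μ := by
  have hRm : ∀ n, MeasurableSet (R n) := fun n => (hR n).measurableSet
  set c := liminf (fun n => b n / a n) atTop with hc
  have H1 : ∀ U, IsOpen U → μ U ≠ ∞ → ν U ≤ c * μ U := fun U hU hμU =>
    measure_le_liminf_mul_of_uniform hμS hνS hRm hsymm ha0 hat hμ hν hsmall hU hμU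
  have H2 : ∀ U, IsOpen U → ν U ≠ ∞ → μ U ≤ c⁻¹ * ν U := by
    intro U hU hνU
    refine (measure_le_liminf_mul_of_uniform hνS hμS hRm hsymm hb0 hbt hν hμ hsmall hU hνU).trans ?_
    gcongr
    -- The `liminf` of the reciprocals is the reciprocal of the `limsup`, hence at most `c⁻¹`. This
    -- is what makes the two one-sided estimates match.
    have : (fun n => a n / b n) = fun n => (b n / a n)⁻¹ := by
      funext n
      rw [ENNReal.inv_div (Or.inl (hat n)) (Or.inl (ha0 n))]
    rw [this, hc, ENNReal.inv_liminf]
    exact liminf_le_limsup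
  obtain ⟨x, hx⟩ := hSne
  -- One neighbourhood has positive finite mass for both measures, which excludes `c = 0` and `c =
  -- ∞`.
  have hopen : IsOpen {y | (x, y) ∈ R 0} := (hR 0).preimage (by fun_prop : Continuous fun y => (x, y))
  have hc0 : c ≠ 0 := by
    intro h
    have := H1 _ hopen (by rw [hμ 0 x hx]; exact hat 0)
    rw [h, zero_mul, hν 0 x hx] at this
    exact hb0 0 (le_antisymm this zero_le)
  have hct : c ≠ ∞ := by
    intro h
    have := H2 _ hopen (by rw [hν 0 x hx]; exact hbt 0)
    rw [h, ENNReal.inv_top, zero_mul, hμ 0 x hx] at this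
    exact ha0 0 (le_antisymm this zero_le)
  have H3 : ∀ U, IsOpen U → μ U ≠ ∞ → ν U ≠ ∞ → ν U = c * μ U := by
    intro U hU h1 h2
    refine le_antisymm (H1 U hU h1) ?_
    calc c * μ U ≤ c * (c⁻¹ * ν U) := by gcongr; exact H2 U hU h2
      _ = ν U := by rw [← mul_assoc, ENNReal.mul_inv_cancel hc0 hct, one_mul]
  refine ⟨c, hc0, hct, ?_⟩
  have hres : ∀ n, ν.restrict (O n) = (c • μ).restrict (O n) := by
    intro n
    have : IsFiniteMeasure (ν.restrict (O n)) := ⟨by simpa using (hνO n).lt_top⟩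
    refine ext_of_generate_finite {U : Set X | IsOpen U} ?_ isPiSystem_isOpen ?_ ?_
    · rw [BorelSpace.measurable_eq (α := X)]; rfl
    · intro U hU
      rw [Measure.restrict_apply hU.measurableSet, Measure.restrict_apply hU.measurableSet,
        Measure.smul_apply, smul_eq_mul]
      exact H3 _ (hU.inter (hO n)) (measure_ne_top_of_subset Set.inter_subset_right (hμO n))
        (measure_ne_top_of_subset Set.inter_subset_right (hνO n))
    · simpa using H3 _ (hO n) (hμO n) (hνO n)
  have hun := Measure.restrict_iUnion_congr.2 hres
  have e1 : ν.restrict (⋃ n, O n) = ν :=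
    Measure.restrict_eq_self_of_ae_mem (hνS.mono fun x hx => hOS hx)
  have e2 : (c • μ).restrict (⋃ n, O n) = c • μ := by
    refine Measure.restrict_eq_self_of_ae_mem ?_
    exact Measure.ae_smul_measure (hμS.mono fun x hx => hOS hx) c
  rw [e1, e2] at hun
  exact hun

/-! ### Commuting tuples as a scalar part plus a rank-one tensor. -/

noncomputable section

/-- The complex Euclidean space of dimension `n`. -/
abbrev CSpace (n : ℕ) : Type := EuclideanSpace ℂ (Fin n)

namespace MatTuple

variable {d : ℕ}

/-- Half the traces of the components of a tuple. -/
def center : MatTuple d 2 →ₗ[ℂ] CSpace d where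
  toFun X := WithLp.toLp 2 fun r => (X (r, 0, 0) + X (r, 1, 1)) / 2
  map_add' X Y := by ext r; simp; ring
  map_smul' c X := by ext r; simp; ring

/-- The coordinates of the traceless part of the `r`-th component in an orthonormal basis of `𝔰𝔩₂`. -/
def coords (r : Fin d) : MatTuple d 2 →ₗ[ℂ] CSpace 3 where
  toFun X := !₂[(X (r, 0, 0) - X (r, 1, 1)) / (√2 : ℝ), X (r, 0, 1), X (r, 1, 0)]
  map_add' X Y := by ext k; fin_cases k <;> simp; ring
  map_smul' c X := by ext k; fin_cases k <;> simp; ring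

/-- The traceless matrix with given coordinates. -/
def tracelessMatrix (w : CSpace 3) : Matrix (Fin 2) (Fin 2) ℂ :=
  !![w 0 / (√2 : ℝ), w 1; w 2, -(w 0 / (√2 : ℝ))]

/-- The tuple with given center and coordinates. -/
def assemble (a : CSpace d) (y : Fin d → CSpace 3) : MatTuple d 2 :=
  WithLp.toLp 2 fun p => (if p.2.1 = p.2.2 then a p.1 else 0) + tracelessMatrix (y p.1) p.2.1 p.2.2

theorem sqrt_two_mul_self : ((√2 : ℝ) : ℂ) * (√2 : ℝ) = 2 := by
  norm_cast
  norm_num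

theorem sqrt_two_ne_zero : ((√2 : ℝ) : ℂ) ≠ 0 := by
  norm_cast
  positivity

@[simp] theorem center_apply (X : MatTuple d 2) (r : Fin d) :
    center X r = (X (r, 0, 0) + X (r, 1, 1)) / 2 := rfl

@[simp] theorem coords_zero (X : MatTuple d 2) (r : Fin d) :
    coords r X 0 = (X (r, 0, 0) - X (r, 1, 1)) / (√2 : ℝ) := rfl

@[simp] theorem coords_one (X : MatTuple d 2) (r : Fin d) : coords r X 1 = X (r, 0, 1) := rfl

@[simp] theorem coords_two (X : MatTuple d 2) (r : Fin d) : coords r X 2 = X (r, 1, 0) := rfl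

@[simp] theorem assemble_zero_zero (a : CSpace d) (y : Fin d → CSpace 3) (r : Fin d) :
    assemble a y (r, 0, 0) = a r + y r 0 / (√2 : ℝ) := rfl

@[simp] theorem assemble_zero_one (a : CSpace d) (y : Fin d → CSpace 3) (r : Fin d) :
    assemble a y (r, 0, 1) = y r 1 := by simp [assemble, tracelessMatrix]

@[simp] theorem assemble_one_zero (a : CSpace d) (y : Fin d → CSpace 3) (r : Fin d) :
    assemble a y (r, 1, 0) = y r 2 := by simp [assemble, tracelessMatrix]

@[simp] theorem assemble_one_one (a : CSpace d) (y : Fin d → CSpace 3) (r : Fin d) :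
    assemble a y (r, 1, 1) = a r - y r 0 / (√2 : ℝ) := by
  simp [assemble, tracelessMatrix, sub_eq_add_neg]

theorem ext_entries {X Y : MatTuple d 2} (h00 : ∀ r, X (r, 0, 0) = Y (r, 0, 0))
    (h01 : ∀ r, X (r, 0, 1) = Y (r, 0, 1)) (h10 : ∀ r, X (r, 1, 0) = Y (r, 1, 0))
    (h11 : ∀ r, X (r, 1, 1) = Y (r, 1, 1)) : X = Y := by
  ext ⟨r, i, j⟩
  fin_cases i <;> fin_cases j
  exacts [h00 r, h01 r, h10 r, h11 r]

@[simp] theorem center_assemble (a : CSpace d) (y : Fin d → CSpace 3) :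
    center (assemble a y) = a := by
  ext r; simp

@[simp] theorem coords_assemble (a : CSpace d) (y : Fin d → CSpace 3) (r : Fin d) :
    coords r (assemble a y) = y r := by
  have h2 := sqrt_two_ne_zero
  ext k
  fin_cases k
  · simp only [Fin.zero_eta, coords_zero, assemble_zero_zero, assemble_one_one]
    field_simp
    linear_combination (-(y r 0)) * sqrt_two_mul_self
  · simp
  · simp

@[simp] theorem assemble_center_coords (X : MatTuple d 2) :
    assemble (center X) (fun r => coords r X) = X := by
  have h2 := sqrt_two_ne_zero
  have h2' := sqrt_two_mul_self
  refine ext_entries (fun r => ?_) (fun r => by simp) (fun r => by simp) (fun r => ?_)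
  · simp only [assemble_zero_zero, center_apply, coords_zero]
    rw [div_div, h2']; ring
  · simp only [assemble_one_one, center_apply, coords_zero]
    rw [div_div, h2']; ring

theorem assemble_add (a b : CSpace d) (y z : Fin d → CSpace 3) :
    assemble (a + b) (y + z) = assemble a y + assemble b z :=
  ext_entries (fun r => by simp; ring) (fun r => by simp) (fun r => by simp)
    (fun r => by simp; ring)

theorem assemble_smul (c : ℂ) (a : CSpace d) (y : Fin d → CSpace 3) :
    assemble (c • a) (c • y) = c • assemble a y :=
  ext_entries (fun r => by simp; ring) (fun r => by simp) (fun r => by simp)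
    (fun r => by simp; ring)

theorem norm_sq_eq_sum_entries (X : MatTuple d 2) : ‖X‖ ^ 2 =
    ∑ r, (‖X (r, 0, 0)‖ ^ 2 + ‖X (r, 0, 1)‖ ^ 2 + (‖X (r, 1, 0)‖ ^ 2 + ‖X (r, 1, 1)‖ ^ 2)) := by
  rw [EuclideanSpace.norm_sq_eq, Fintype.sum_prod_type]
  refine Finset.sum_congr rfl fun r _ => ?_
  rw [Fintype.sum_prod_type]
  simp

/-- The parallelogram law for `a r ± y r 0 / √2`. The factor `√2` makes the traceless coordinates
orthonormal, so that `U(3)` will act by isometries. -/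
theorem norm_sq_assemble (a : CSpace d) (y : Fin d → CSpace 3) :
    ‖assemble a y‖ ^ 2 = 2 * ‖a‖ ^ 2 + ∑ r, ‖y r‖ ^ 2 := by
  rw [norm_sq_eq_sum_entries, EuclideanSpace.norm_sq_eq, Finset.mul_sum, ← Finset.sum_add_distrib]
  refine Finset.sum_congr rfl fun r _ => ?_
  rw [EuclideanSpace.norm_sq_eq (y r), Fin.sum_univ_three]
  simp only [assemble_zero_zero, assemble_zero_one, assemble_one_zero, assemble_one_one]
  have h1 := parallelogram_law_with_norm ℝ (a r) (y r 0 / (√2 : ℝ))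
  have h2 : ‖y r 0 / ((√2 : ℝ) : ℂ)‖ ^ 2 = ‖y r 0‖ ^ 2 / 2 := by
    rw [norm_div, div_pow, Complex.norm_real, Real.norm_of_nonneg (by positivity),
      Real.sq_sqrt (by norm_num)]
  linear_combination h1 + 2 * h2

/-- The traceless part of a tuple. -/
def traceless : MatTuple d 2 →ₗ[ℂ] MatTuple d 2 where
  toFun X := assemble 0 fun r => coords r X
  map_add' X Y := by
    rw [← assemble_add, add_zero]
    congr 1
    funext r
    simp
  map_smul' c X := by
    rw [RingHom.id_apply, ← assemble_smul, smul_zero]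
    congr 1
    funext r
    simp

theorem traceless_apply (X : MatTuple d 2) : traceless X = assemble 0 fun r => coords r X := rfl

@[simp] theorem traceless_assemble (a : CSpace d) (y : Fin d → CSpace 3) :
    traceless (assemble a y) = assemble 0 y := by
  simp [traceless_apply]

theorem norm_sq_eq (X : MatTuple d 2) : ‖X‖ ^ 2 = 2 * ‖center X‖ ^ 2 + ∑ r, ‖coords r X‖ ^ 2 := by
  conv_lhs => rw [← assemble_center_coords X]
  exact norm_sq_assemble _ _

theorem norm_traceless_sq (X : MatTuple d 2) : ‖traceless X‖ ^ 2 = ∑ r, ‖coords r X‖ ^ 2 := by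
  rw [traceless_apply, norm_sq_assemble]; simp

theorem norm_traceless_le (X : MatTuple d 2) : ‖traceless X‖ ≤ ‖X‖ := by
  refine (sq_le_sq₀ (norm_nonneg _) (norm_nonneg _)).1 ?_
  rw [norm_traceless_sq, norm_sq_eq]
  have : 0 ≤ ‖center X‖ ^ 2 := by positivity
  linarith

theorem norm_coords_le (X : MatTuple d 2) (r : Fin d) : ‖coords r X‖ ≤ ‖X‖ := by
  refine (sq_le_sq₀ (norm_nonneg _) (norm_nonneg _)).1 ?_
  rw [norm_sq_eq]
  have h1 := Finset.single_le_sum (f := fun r => ‖coords r X‖ ^ 2) (fun _ _ => by positivity)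
    (Finset.mem_univ r)
  have : 0 ≤ ‖center X‖ ^ 2 := by positivity
  linarith

theorem norm_center_le (X : MatTuple d 2) : ‖center X‖ ≤ ‖X‖ := by
  refine (sq_le_sq₀ (norm_nonneg _) (norm_nonneg _)).1 ?_
  rw [norm_sq_eq]
  have : 0 ≤ ∑ r, ‖coords r X‖ ^ 2 := by positivity
  have : 0 ≤ ‖center X‖ ^ 2 := by positivity
  linarith

/-- The tuple `a ⊗ 1 + v ⊗ w`, where `w` is regarded as a traceless matrix. -/
def rankOne (a v : CSpace d) (w : CSpace 3) : MatTuple d 2 := assemble a fun r => v r • w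

@[simp] theorem center_rankOne (a v : CSpace d) (w : CSpace 3) : center (rankOne a v w) = a :=
  center_assemble _ _

@[simp] theorem coords_rankOne (a v : CSpace d) (w : CSpace 3) (r : Fin d) :
    coords r (rankOne a v w) = v r • w :=
  coords_assemble _ _ _

@[simp] theorem traceless_rankOne (a v : CSpace d) (w : CSpace 3) :
    traceless (rankOne a v w) = rankOne 0 v w :=
  traceless_assemble _ _

theorem norm_sq_rankOne (a v : CSpace d) (w : CSpace 3) :
    ‖rankOne a v w‖ ^ 2 = 2 * ‖a‖ ^ 2 + ‖v‖ ^ 2 * ‖w‖ ^ 2 := by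
  rw [rankOne, norm_sq_assemble, EuclideanSpace.norm_sq_eq v, Finset.sum_mul]
  simp [norm_smul, mul_pow]

theorem norm_rankOne_zero (v : CSpace d) (w : CSpace 3) : ‖rankOne 0 v w‖ = ‖v‖ * ‖w‖ := by
  rw [← sq_eq_sq₀ (by positivity) (by positivity), norm_sq_rankOne]
  simp [mul_pow]

theorem rankOne_smul_right (c : ℂ) (a v : CSpace d) (w : CSpace 3) :
    rankOne a v (c • w) = rankOne a (c • v) w := by
  unfold rankOne
  congr 1
  funext r
  simp [smul_smul, mul_comm]

theorem rankOne_smul (c : ℂ) (a v : CSpace d) (w : CSpace 3) :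
    rankOne (c • a) (c • v) w = c • rankOne a v w := by
  unfold rankOne
  rw [← assemble_smul]
  congr 1
  funext r
  simp [smul_smul]

theorem continuous_rankOne :
    Continuous fun p : CSpace d × CSpace d × CSpace 3 => rankOne p.1 p.2.1 p.2.2 := by
  refine (PiLp.continuous_toLp 2 _).comp (continuous_pi fun ⟨r, i, j⟩ => ?_)
  fin_cases i <;> fin_cases j <;> simp [tracelessMatrix] <;> fun_prop

/-- All components are polynomials in the single matrix `w`. -/
theorem rankOne_mem (a v : CSpace d) (w : CSpace 3) : rankOne a v w ∈ commutingTuples d 2 := by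
  intro r s
  ext i j
  fin_cases i <;> fin_cases j <;>
    simp [MatTuple.comp, Matrix.mul_apply, rankOne] <;> ring

/-- A commuting tuple is of the form `a ⊗ 1 + v ⊗ w`, with `w` normalized by its largest coordinate. -/
theorem exists_eq_rankOne {X : MatTuple d 2} (hX : X ∈ commutingTuples d 2) :
    ∃ (k : Fin 3) (v : CSpace d) (w : CSpace 3), w k = 1 ∧ (∀ j, ‖w j‖ ≤ 1) ∧
      (∀ r, v r = coords r X k) ∧ X = rankOne (center X) v w := by
  -- Up to nonzero constants, the entries of the commutators are the 2 × 2 minors of the `d × 3`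
  -- matrix of coordinates; their vanishing means rank at most one.
  have h01 : ∀ r s, coords r X 0 * coords s X 1 = coords r X 1 * coords s X 0 := by
    intro r s
    have h := congrFun (congrFun (hX r s) 0) 1
    simp only [MatTuple.comp, Matrix.mul_apply, Fin.sum_univ_two, Matrix.of_apply] at h
    simp only [coords_zero, coords_one]
    linear_combination (1 / ((√2 : ℝ) : ℂ)) * h
  have h02 : ∀ r s, coords r X 0 * coords s X 2 = coords r X 2 * coords s X 0 := by
    intro r s
    have h := congrFun (congrFun (hX r s) 1) 0
    simp only [MatTuple.comp, Matrix.mul_apply, Fin.sum_univ_two, Matrix.of_apply] at h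
    simp only [coords_zero, coords_two]
    linear_combination (-1 / ((√2 : ℝ) : ℂ)) * h
  have h12 : ∀ r s, coords r X 1 * coords s X 2 = coords r X 2 * coords s X 1 := by
    intro r s
    have h := congrFun (congrFun (hX r s) 0) 0
    simp only [MatTuple.comp, Matrix.mul_apply, Fin.sum_univ_two, Matrix.of_apply] at h
    simp only [coords_one, coords_two]
    linear_combination h
  have hcomm : ∀ r s i j, coords r X i * coords s X j = coords r X j * coords s X i := by
    intro r s i j
    fin_cases i <;> fin_cases j
    exacts [rfl, h01 r s, h02 r s, (h01 r s).symm, rfl, h12 r s, (h02 r s).symm, (h12 r s).symm, rfl]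
  by_cases h0 : ∀ r, coords r X = 0
  -- A scalar tuple: `v = 0`, and `w` is an arbitrary normalized vector.
  · refine ⟨0, 0, EuclideanSpace.single 0 1, by simp, fun j => ?_, fun r => by rw [h0 r]; rfl, ?_⟩
    · fin_cases j <;> simp
    · conv_lhs => rw [← assemble_center_coords X]
      unfold rankOne
      congr 1
      funext r
      simp [h0 r]
  · push Not at h0
    obtain ⟨r, hr⟩ := h0
    obtain ⟨k, hk⟩ := Finite.exists_max fun k => ‖coords r X k‖
    have hk0 : coords r X k ≠ 0 := by
      intro h
      apply hr
      ext j
      have := hk j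
      rw [h, norm_zero] at this
      simpa using this
    refine ⟨k, WithLp.toLp 2 fun s => coords s X k, (coords r X k)⁻¹ • coords r X, ?_, fun j => ?_,
      fun s => rfl, ?_⟩
    · simp [hk0]
    · rw [PiLp.smul_apply, smul_eq_mul, norm_mul, norm_inv, inv_mul_le_iff₀ (norm_pos_iff.2 hk0),
        mul_one]
      exact hk j
    · conv_lhs => rw [← assemble_center_coords X]
      unfold rankOne
      congr 1
      funext s
      ext j
      simp only [PiLp.smul_apply, smul_eq_mul]
      field_simp
      linear_combination hcomm r s k j

theorem isClosed_commutingTuples : IsClosed (commutingTuples d 2) := by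
  have : commutingTuples d 2 =
      ⋂ r, ⋂ s, {X : MatTuple d 2 | X.comp r * X.comp s = X.comp s * X.comp r} := by
    ext X; simp [commutingTuples]
  rw [this]
  refine isClosed_iInter fun r => isClosed_iInter fun s => ?_
  have hc : ∀ r : Fin d, Continuous fun X : MatTuple d 2 => X.comp r := by
    intro r
    refine continuous_pi fun i => continuous_pi fun j => ?_
    simp only [MatTuple.comp, Matrix.of_apply]
    fun_prop
  exact isClosed_eq ((hc r).matrix_mul (hc s)) ((hc s).matrix_mul (hc r))

end MatTuple

/-! ### Charts, dimension and local finiteness. -/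

namespace MatTuple

variable {d : ℕ}

/-- The domain of the charts of the set of commuting tuples. -/
abbrev ChartDomain (d : ℕ) : Type := CSpace d × CSpace d × (Fin 2 → ℂ)

theorem finrank_chartDomain : Module.finrank ℝ (ChartDomain d) = 4 * d + 4 := by
  have h : ∀ n, Module.finrank ℝ (CSpace n) = 2 * n := fun n => by
    rw [finrank_real_of_complex, finrank_euclideanSpace_fin]
  rw [Module.finrank_prod, Module.finrank_prod, h, finrank_real_of_complex ]
  simp
  ring

/-- The chart of the set of commuting tuples in which the `k`-th coordinate of the matrix is `1`. -/
def chart (k : Fin 3) (p : ChartDomain d) : MatTuple d 2 :=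
  rankOne p.1 p.2.1 (WithLp.toLp 2 (k.insertNth 1 p.2.2))

theorem contDiff_chart (k : Fin 3) : ContDiff ℝ 1 (chart (d := d) k) := by
  have hi : ∀ i, ContDiff ℝ 1 fun p : ChartDomain d =>
      (k.insertNth (α := fun _ => ℂ) (1 : ℂ) p.2.2 : Fin 3 → ℂ) i := by
    intro i
    rcases Fin.eq_self_or_eq_succAbove k i with rfl | ⟨j, rfl⟩
    · simp only [Fin.insertNth_apply_same]; exact contDiff_const
    · simp only [Fin.insertNth_apply_succAbove]
      fun_prop
  have h1 : ∀ r, ContDiff ℝ 1 fun p : ChartDomain d => p.1 r := fun r => by fun_prop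
  have h2 : ∀ r, ContDiff ℝ 1 fun p : ChartDomain d => p.2.1 r := fun r => by fun_prop
  rw [contDiff_piLp]
  rintro ⟨r, i, j⟩
  fin_cases i <;> fin_cases j <;> simp [chart, rankOne, -Nat.reduceAdd]
  · exact (h1 r).add (((h2 r).mul (hi 0)).div_const _)
  · exact (h2 r).mul (hi 1)
  · exact (h2 r).mul (hi 2)
  · exact (h1 r).sub (((h2 r).mul (hi 0)).div_const _)

/-- Normalizing by the largest coordinate keeps the chart parameters bounded in terms of `‖X‖`.
Bounded parts of the variety are therefore covered by three images of a compact ball, which gives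
local finiteness. -/
theorem mem_chart_image {X : MatTuple d 2} (hX : X ∈ commutingTuples d 2) :
    ∃ k, X ∈ chart k '' Metric.closedBall (0 : ChartDomain d) (max 1 (√d * ‖X‖ + ‖X‖)) := by
  obtain ⟨k, v, w, hk, hw, hv, hXe⟩ := exists_eq_rankOne hX
  refine ⟨k, (center X, v, fun j => w (k.succAbove j)), ?_, ?_⟩
  · rw [mem_closedBall_zero_iff, Prod.norm_def, Prod.norm_def]
    refine max_le ?_ (max_le ?_ ?_)
    · refine le_max_of_le_right ((norm_center_le X).trans ?_)
      have : 0 ≤ √d * ‖X‖ := by positivity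
      linarith
    · refine le_max_of_le_right ?_
      have h1 : ∀ r, ‖v r‖ ≤ ‖X‖ := fun r => by
        rw [hv]; exact (PiLp.norm_apply_le _ _).trans (norm_coords_le X r)
      have : ‖v‖ ≤ √d * ‖X‖ := by
        rw [EuclideanSpace.norm_eq]
        refine Real.sqrt_le_iff.2 ⟨by positivity, ?_⟩
        calc ∑ r, ‖v r‖ ^ 2 ≤ ∑ _r : Fin d, ‖X‖ ^ 2 := by gcongr with r; exact h1 r
          _ = (√d * ‖X‖) ^ 2 := by
            rw [mul_pow, Real.sq_sqrt (by positivity)]; simp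
      have := norm_nonneg X
      linarith
    · refine le_max_of_le_left ?_
      exact (pi_norm_le_iff_of_nonneg zero_le_one).2 fun j => hw _
  · conv_rhs => rw [hXe]
    unfold chart
    congr 1
    ext i
    rcases Fin.eq_self_or_eq_succAbove k i with rfl | ⟨j, rfl⟩
    · simp [hk]
    · simp

theorem dimH_commutingTuples_le : dimH (commutingTuples d 2) ≤ (4 * d + 4 : ℕ) := by
  have h : commutingTuples d 2 ⊆ ⋃ k, Set.range (chart (d := d) k) := by
    intro X hX
    obtain ⟨k, p, -, hp⟩ := mem_chart_image hX
    exact Set.mem_iUnion.2 ⟨k, p, hp⟩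
  refine (dimH_mono h).trans ?_
  rw [dimH_iUnion]
  refine iSup_le fun k => ?_
  have := (contDiff_chart (d := d) k).dimH_range_le
  rwa [finrank_chartDomain] at this

theorem hausdorffMeasure_inter_closedBall_lt_top (R : ℝ) :
    (Measure.hausdorffMeasure ((4 * d + 4 : ℕ) : ℝ) : Measure (MatTuple d 2))
      (commutingTuples d 2 ∩ Metric.closedBall 0 R) < ∞ := by
  set B := Metric.closedBall (0 : ChartDomain d) (max 1 (√d * R + R)) with hB
  have h : commutingTuples d 2 ∩ Metric.closedBall 0 R ⊆ ⋃ k, chart k '' B := by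
    rintro X ⟨hX, hXR⟩
    obtain ⟨k, hk⟩ := mem_chart_image hX
    refine Set.mem_iUnion.2 ⟨k, Set.image_mono (Metric.closedBall_subset_closedBall ?_) hk⟩
    rw [mem_closedBall_zero_iff] at hXR
    gcongr
  refine (measure_mono h).trans_lt ((measure_iUnion_le _).trans_lt ?_)
  rw [tsum_fintype, ENNReal.sum_lt_top]
  intro k _
  obtain ⟨K, hK⟩ := (contDiff_chart (d := d) k).contDiffOn.exists_lipschitzOnWith one_ne_zero
    (convex_closedBall (0 : ChartDomain d) (max 1 (√d * R + R))) (isCompact_closedBall _ _)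
  refine (hK.hausdorffMeasure_image_le (by positivity)).trans_lt ?_
  refine ENNReal.mul_lt_top (ENNReal.rpow_lt_top_of_nonneg (by positivity) (by simp)) ?_
  rw [← finrank_chartDomain]
  exact (isCompact_closedBall _ _).measure_lt_top

/-- A linear projection whose restriction to the commuting tuples inverts a chart. -/
def chartProjection (r : Fin d) : MatTuple d 2 →ₗ[ℂ] ChartDomain d where
  toFun X := (center X, WithLp.toLp 2 fun s => coords s X 0, ![coords r X 1, coords r X 2])
  map_add' X Y := by
    refine Prod.ext (map_add _ _ _) (Prod.ext ?_ ?_)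
    · ext s; simp [coords]; ring
    · ext j; fin_cases j <;> simp
  map_smul' c X := by
    refine Prod.ext (map_smul _ _ _) (Prod.ext ?_ ?_)
    · ext s; simp [coords]
    · ext j; fin_cases j <;> simp

/-- The projection reads off `a`, `v` and `v r • (w 1, w 2)` when `w 0 = 1`, so it reaches every
point with `v r ≠ 0`. A Lipschitz image containing a nonempty open set bounds the dimension from
below and makes the Hausdorff measure nonzero. -/
theorem subset_chartProjection_image (r : Fin d) :
    {p : ChartDomain d | p.2.1 r ≠ 0} ⊆ chartProjection r '' commutingTuples d 2 := by
  rintro ⟨a, v, t⟩ h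
  replace h : v r ≠ 0 := h
  refine ⟨rankOne a v (!₂[1, t 0 / v r, t 1 / v r]), rankOne_mem _ _ _, ?_⟩
  refine Prod.ext (center_rankOne _ _ _) (Prod.ext ?_ ?_)
  · ext s
    change coords s (rankOne a v _) 0 = v s
    simp only [coords_rankOne]
    simp
  · change ![coords r (rankOne a v _) 1, coords r (rankOne a v _) 2] = t
    simp only [coords_rankOne]
    ext j; fin_cases j <;> simp <;> field_simp

theorem isOpen_setOf_chartDomain (r : Fin d) : IsOpen {p : ChartDomain d | p.2.1 r ≠ 0} :=
  isOpen_ne_fun (by fun_prop) continuous_const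

theorem nonempty_setOf_chartDomain (r : Fin d) : {p : ChartDomain d | p.2.1 r ≠ 0}.Nonempty :=
  ⟨(0, EuclideanSpace.single r 1, 0), by simp⟩

theorem exists_lipschitzWith_chartProjection (r : Fin d) :
    ∃ K, LipschitzWith K (chartProjection r) :=
  ⟨_, (LinearMap.toContinuousLinearMap (chartProjection r)).lipschitz⟩

theorem dimH_commutingTuples (hd : 1 ≤ d) : dimH (commutingTuples d 2) = (4 * d + 4 : ℕ) := by
  refine le_antisymm dimH_commutingTuples_le ?_
  set r : Fin d := ⟨0, hd⟩
  obtain ⟨K, hK⟩ := exists_lipschitzWith_chartProjection r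
  have h1 := Real.dimH_of_nonempty_interior (s := {p : ChartDomain d | p.2.1 r ≠ 0})
    (by rw [(isOpen_setOf_chartDomain r).interior_eq]; exact nonempty_setOf_chartDomain r)
  rw [finrank_chartDomain] at h1
  rw [← h1]
  exact (dimH_mono (subset_chartProjection_image r)).trans (hK.dimH_image_le _)

theorem hausdorffMeasure_commutingTuples_ne_zero (hd : 1 ≤ d) :
    (Measure.hausdorffMeasure ((4 * d + 4 : ℕ) : ℝ) : Measure (MatTuple d 2))
      (commutingTuples d 2) ≠ 0 := by
  set r : Fin d := ⟨0, hd⟩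
  obtain ⟨K, hK⟩ := exists_lipschitzWith_chartProjection r
  intro h0
  have h1 := hK.hausdorffMeasure_image_le (d := ((4 * d + 4 : ℕ) : ℝ)) (by positivity)
    (commutingTuples d 2)
  rw [h0, mul_zero] at h1
  have h2 := (measure_mono (subset_chartProjection_image r)).trans h1
  rw [← finrank_chartDomain (d := d)] at h2
  exact ((isOpen_setOf_chartDomain r).measure_pos _ (nonempty_setOf_chartDomain r)).ne'
    (le_antisymm h2 zero_le)

/-- The scalar tuples have real dimension at most `2 * d`, less than `4 * d + 4`. They can thus be
discarded, which matters because the symmetries are transitive only off them. -/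
theorem hausdorffMeasure_traceless_eq_zero :
    (Measure.hausdorffMeasure ((4 * d + 4 : ℕ) : ℝ) : Measure (MatTuple d 2))
      {X | traceless X = 0} = 0 := by
  have hsub : {X : MatTuple d 2 | traceless X = 0} ⊆
      Set.range fun p : CSpace d => rankOne p 0 0 := by
    intro X hX
    refine ⟨center X, ?_⟩
    have h : ∀ r, coords r X = 0 := by
      intro r
      have := congrArg (coords r) (show traceless X = 0 from hX)
      rwa [traceless_apply, coords_assemble, map_zero] at this
    conv_rhs => rw [← assemble_center_coords X]
    simp [rankOne, h]
  have hcd : ContDiff ℝ 1 fun p : CSpace d => rankOne p 0 (0 : CSpace 3) := by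
    rw [contDiff_piLp]
    rintro ⟨r, i, j⟩
    fin_cases i <;> fin_cases j <;> simp [rankOne] <;> fun_prop
  have hdim : dimH {X : MatTuple d 2 | traceless X = 0} < ((4 * d + 4 : ℕ) : NNReal) := by
    refine ((dimH_mono hsub).trans hcd.dimH_range_le).trans_lt ?_
    rw [finrank_real_of_complex, finrank_euclideanSpace_fin]
    norm_cast
    omega
  have := hausdorffMeasure_of_dimH_lt hdim
  simpa using this

end MatTuple

/-! ### Symmetries of the variety. -/

/-- The unitary group acts transitively on the unit sphere. -/
theorem exists_linearIsometryEquiv_apply_eq {n : ℕ} {x y : CSpace n} (hx : ‖x‖ = 1)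
    (hy : ‖y‖ = 1) : ∃ A : CSpace n ≃ₗᵢ[ℂ] CSpace n, A x = y := by
  -- The isometry between the two lines, extended to the whole space; in equal finite dimension the
  -- extension is bijective.
  let L : (ℂ ∙ x) →ₗᵢ[ℂ] CSpace n :=
    ((ℂ ∙ y).subtypeₗᵢ.comp (LinearIsometryEquiv.toSpanUnitSingleton y hy).toLinearIsometry).comp
      (LinearIsometryEquiv.toSpanUnitSingleton x hx).symm.toLinearIsometry
  refine ⟨L.extend.toLinearIsometryEquiv rfl, ?_⟩
  have h1 : (LinearIsometryEquiv.toSpanUnitSingleton x hx).symm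
      (⟨x, Submodule.mem_span_singleton_self x⟩ : ℂ ∙ x) = 1 := by
    rw [LinearIsometryEquiv.symm_apply_eq]
    ext1; simp
  rw [LinearIsometry.toLinearIsometryEquiv_apply]
  refine (L.extend_apply ⟨x, Submodule.mem_span_singleton_self x⟩).trans ?_
  change ((LinearIsometryEquiv.toSpanUnitSingleton (𝕜 := ℂ) y hy
    ((LinearIsometryEquiv.toSpanUnitSingleton x hx).symm ⟨x, _⟩) : ℂ ∙ y) : CSpace n) = y
  rw [h1]
  simp

namespace MatTuple

variable {d : ℕ}

/-- The action of linear maps of `ℂ^d` on `d`-tuples of matrices. -/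
def leftMap (A : CSpace d →ₗ[ℂ] CSpace d) : MatTuple d 2 →ₗ[ℂ] MatTuple d 2 where
  toFun X := WithLp.toLp 2 fun p => A (WithLp.toLp 2 fun s => X (s, p.2)) p.1
  map_add' X Y := by
    ext p
    exact congrArg (fun z : CSpace d => z p.1) 
      (map_add A (WithLp.toLp 2 fun s => X (s, p.2)) (WithLp.toLp 2 fun s => Y (s, p.2)))
  map_smul' c X := by
    ext p
    exact congrArg (fun z : CSpace d => z p.1) (map_smul A c (WithLp.toLp 2 fun s => X (s, p.2)))

theorem norm_leftMap (A : CSpace d ≃ₗᵢ[ℂ] CSpace d) (X : MatTuple d 2) :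
    ‖leftMap A.toLinearEquiv.toLinearMap X‖ = ‖X‖ := by
  rw [← sq_eq_sq₀ (norm_nonneg _) (norm_nonneg _), EuclideanSpace.norm_sq_eq,
    EuclideanSpace.norm_sq_eq]
  -- Summed over the matrix position first: for each position the `d` entries form a vector on which
  -- `A` acts isometrically.
  refine (Fintype.sum_prod_type_right _).trans
    (Eq.trans (Finset.sum_congr rfl fun q _ => ?_) (Fintype.sum_prod_type_right _).symm)
  have h : ‖A.toLinearEquiv.toLinearMap (WithLp.toLp 2 fun s => X (s, q))‖ = _ :=
    A.norm_map (WithLp.toLp 2 fun s => X (s, q))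
  rw [← sq_eq_sq₀ (norm_nonneg _) (norm_nonneg _), EuclideanSpace.norm_sq_eq,
    EuclideanSpace.norm_sq_eq] at h
  exact h

/-- The action of the unitary group of `ℂ^d` on `d`-tuples of matrices. -/
def leftAction (A : CSpace d ≃ₗᵢ[ℂ] CSpace d) : MatTuple d 2 ≃ₗᵢ[ℂ] MatTuple d 2 :=
  (⟨leftMap A.toLinearEquiv.toLinearMap, norm_leftMap A⟩ :
    MatTuple d 2 →ₗᵢ[ℂ] MatTuple d 2).toLinearIsometryEquiv rfl

theorem leftAction_apply (A : CSpace d ≃ₗᵢ[ℂ] CSpace d) (X : MatTuple d 2)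
    (p : Fin d × Fin 2 × Fin 2) :
    leftAction A X p = A (WithLp.toLp 2 fun s => X (s, p.2)) p.1 := rfl

theorem leftAction_rankOne (A : CSpace d ≃ₗᵢ[ℂ] CSpace d) (a v : CSpace d) (w : CSpace 3) :
    leftAction A (rankOne a v w) = rankOne (A a) (A v) w := by
  have key : ∀ (α β : ℂ) (q : Fin 2 × Fin 2), (∀ s, rankOne a v w (s, q) = α * a s + β * v s) →
      ∀ r, leftAction A (rankOne a v w) (r, q) = α * A a r + β * A v r := by
    intro α β q h r
    have : (WithLp.toLp 2 fun s => rankOne a v w (s, q) : CSpace d) = α • a + β • v := by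
      ext s; simp [h]
    rw [leftAction_apply, this]
    simp
  refine ext_entries (fun r => ?_) (fun r => ?_) (fun r => ?_) (fun r => ?_)
  · rw [key 1 (w 0 / (√2 : ℝ)) _ fun s => by simp [rankOne]; ring]; simp [rankOne]; ring
  · rw [key 0 (w 1) _ fun s => by simp [rankOne]; ring]; simp [rankOne]; ring
  · rw [key 0 (w 2) _ fun s => by simp [rankOne]; ring]; simp [rankOne]; ring
  · rw [key 1 (-(w 0 / (√2 : ℝ))) _ fun s => by simp [rankOne]; ring]; simp [rankOne]; ring

/-- The action of linear maps of `𝔰𝔩₂` on tuples of matrices. -/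
def rightMap (B : CSpace 3 →ₗ[ℂ] CSpace 3) : MatTuple d 2 →ₗ[ℂ] MatTuple d 2 where
  toFun X := assemble (center X) fun r => B (coords r X)
  map_add' X Y := by
    rw [← assemble_add, map_add]
    congr 1
    funext r
    rw [Pi.add_apply, map_add, map_add]
  map_smul' c X := by
    rw [RingHom.id_apply, ← assemble_smul, map_smul]
    congr 1
    funext r
    rw [Pi.smul_apply, map_smul, map_smul]

theorem rightMap_apply (B : CSpace 3 →ₗ[ℂ] CSpace 3) (X : MatTuple d 2) :
    rightMap B X = assemble (center X) fun r => B (coords r X) := rfl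

theorem norm_rightMap (B : CSpace 3 ≃ₗᵢ[ℂ] CSpace 3) (X : MatTuple d 2) :
    ‖rightMap B.toLinearEquiv.toLinearMap X‖ = ‖X‖ := by
  rw [← sq_eq_sq₀ (norm_nonneg _) (norm_nonneg _), norm_sq_eq X, rightMap_apply,
    norm_sq_assemble]
  have h : ∀ z, ‖B.toLinearEquiv.toLinearMap z‖ = ‖z‖ := B.norm_map
  simp only [h]

/-- The action of the unitary group of `𝔰𝔩₂` on tuples of matrices. -/
def rightAction (B : CSpace 3 ≃ₗᵢ[ℂ] CSpace 3) : MatTuple d 2 ≃ₗᵢ[ℂ] MatTuple d 2 :=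
  (⟨rightMap B.toLinearEquiv.toLinearMap, norm_rightMap B⟩ :
    MatTuple d 2 →ₗᵢ[ℂ] MatTuple d 2).toLinearIsometryEquiv rfl

theorem rightAction_apply (B : CSpace 3 ≃ₗᵢ[ℂ] CSpace 3) (X : MatTuple d 2) :
    rightAction B X = assemble (center X) fun r => B (coords r X) := rfl

theorem rightAction_rankOne (B : CSpace 3 ≃ₗᵢ[ℂ] CSpace 3) (a v : CSpace d) (w : CSpace 3) :
    rightAction B (rankOne a v w) = rankOne a v (B w) := by
  rw [rightAction_apply]
  simp only [center_rankOne, coords_rankOne, map_smul]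
  rfl

theorem traceless_eq_sub (X : MatTuple d 2) : traceless X = X - rankOne (center X) 0 0 := by
  rw [eq_sub_iff_add_eq, traceless_apply, rankOne, ← assemble_add]
  conv_rhs => rw [← assemble_center_coords X]
  congr 1
  · simp
  · funext r; simp

/-- The action commutes with taking the center and preserves scalar tuples, hence it commutes with
removing the scalar part. -/
theorem norm_traceless_leftAction (A : CSpace d ≃ₗᵢ[ℂ] CSpace d) (X : MatTuple d 2) :
    ‖traceless (leftAction A X)‖ = ‖traceless X‖ := by
  have hc : center (leftAction A X) = A (center X) := by
    have h : center X = (2⁻¹ : ℂ) • ((WithLp.toLp 2 fun s => X (s, 0, 0) : CSpace d) +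
        WithLp.toLp 2 fun s => X (s, 1, 1)) := by
      ext r; simp; ring
    rw [h, map_smul, map_add]
    ext r
    simp [leftAction_apply]; ring
  have h0 : leftAction A (rankOne (center X) 0 0) = rankOne (A (center X)) 0 0 := by
    rw [leftAction_rankOne, map_zero]
  rw [traceless_eq_sub, hc, ← h0, ← map_sub, LinearIsometryEquiv.norm_map, ← traceless_eq_sub]

theorem norm_traceless_rightAction (B : CSpace 3 ≃ₗᵢ[ℂ] CSpace 3) (X : MatTuple d 2) :
    ‖traceless (rightAction B X)‖ = ‖traceless X‖ := by
  rw [← sq_eq_sq₀ (norm_nonneg _) (norm_nonneg _), norm_traceless_sq, norm_traceless_sq,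
    rightAction_apply]
  simp

theorem leftAction_mem (A : CSpace d ≃ₗᵢ[ℂ] CSpace d) {X : MatTuple d 2}
    (hX : X ∈ commutingTuples d 2) : leftAction A X ∈ commutingTuples d 2 := by
  obtain ⟨-, v, w, -, -, -, h⟩ := exists_eq_rankOne hX
  rw [h, leftAction_rankOne]
  exact rankOne_mem _ _ _

/-- A general element of `U(3)` does not preserve products in `𝔰𝔩₂`, but it preserves rank-one
tensors, and these are what commutation amounts to. -/
theorem rightAction_mem (B : CSpace 3 ≃ₗᵢ[ℂ] CSpace 3) {X : MatTuple d 2}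
    (hX : X ∈ commutingTuples d 2) : rightAction B X ∈ commutingTuples d 2 := by
  obtain ⟨-, v, w, -, -, -, h⟩ := exists_eq_rankOne hX
  rw [h, rightAction_rankOne]
  exact rankOne_mem _ _ _

theorem rankOne_add_translate (a b v : CSpace d) (w : CSpace 3) :
    rankOne a v w + rankOne b 0 0 = rankOne (a + b) v w := by
  unfold rankOne
  rw [← assemble_add]
  congr 1
  funext r
  simp

theorem translate_mem (b : CSpace d) {X : MatTuple d 2}
    (hX : X ∈ commutingTuples d 2) : X + rankOne b 0 0 ∈ commutingTuples d 2 := by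
  obtain ⟨-, v, w, -, -, -, h⟩ := exists_eq_rankOne hX
  rw [h, rankOne_add_translate]
  exact rankOne_mem _ _ _

theorem smul_mem (c : ℂ) {X : MatTuple d 2}
    (hX : X ∈ commutingTuples d 2) : c • X ∈ commutingTuples d 2 := by
  obtain ⟨-, v, w, -, -, -, h⟩ := exists_eq_rankOne hX
  rw [h, ← rankOne_smul]
  exact rankOne_mem _ _ _

theorem continuous_traceless : Continuous (traceless : MatTuple d 2 → MatTuple d 2) :=
  (LinearMap.toContinuousLinearMap traceless).continuous

/-! ### Uniqueness of homogeneous measures. -/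

/-- A measure on the commuting tuples with the symmetries of the Hausdorff measure. -/
structure IsHomogeneousMeasure (m : Measure (MatTuple d 2)) : Prop where
  map_translate : ∀ b : CSpace d, m.map (fun X => X + rankOne b 0 0) = m
  map_leftAction : ∀ A : CSpace d ≃ₗᵢ[ℂ] CSpace d, m.map (leftAction A) = m
  map_rightAction : ∀ B : CSpace 3 ≃ₗᵢ[ℂ] CSpace 3, m.map (rightAction B) = m
  map_smul : ∀ ρ : ℝ, 0 < ρ →
    m.map (fun X => (ρ : ℂ) • X) = ENNReal.ofReal ((ρ ^ (4 * d + 4))⁻¹) • m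
  ae_mem : ∀ᵐ X ∂m, X ∈ commutingTuples d 2
  ae_traceless_ne_zero : ∀ᵐ X ∂m, traceless X ≠ 0
  closedBall_lt_top : ∀ R, m (Metric.closedBall 0 R) < ∞
  ne_zero : m ≠ 0

/-- The density that turns a homogeneous measure into a scale-invariant one. -/
def scaleWeight (X : MatTuple d 2) : ℝ≥0∞ := ENNReal.ofReal ((‖traceless X‖ ^ (4 * d + 4))⁻¹)

theorem measurable_scaleWeight : Measurable (scaleWeight : MatTuple d 2 → ℝ≥0∞) := by
  unfold scaleWeight
  have := (continuous_traceless (d := d)).measurable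
  fun_prop

theorem scaleWeight_ne_top (X : MatTuple d 2) : scaleWeight X ≠ ∞ := ENNReal.ofReal_ne_top

theorem scaleWeight_ne_zero {X : MatTuple d 2} (h : traceless X ≠ 0) : scaleWeight X ≠ 0 := by
  have : 0 < ‖traceless X‖ := norm_pos_iff.2 h
  rw [scaleWeight, Ne, ENNReal.ofReal_eq_zero, not_le]
  positivity

/-- Scale-invariant neighbourhoods of the diagonal. -/
def nearRel (d : ℕ) (ε : ℝ) : Set (MatTuple d 2 × MatTuple d 2) :=
  {p | dist p.1 p.2 ^ 2 < ε * ‖traceless p.1‖ * ‖traceless p.2‖}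

theorem isOpen_nearRel (ε : ℝ) : IsOpen (nearRel d ε) := by
  have := continuous_traceless (d := d)
  exact isOpen_lt (by fun_prop) (by fun_prop)

theorem nearRel_symm {ε : ℝ} {X Y : MatTuple d 2} (h : (X, Y) ∈ nearRel d ε) :
    (Y, X) ∈ nearRel d ε := by
  simp only [nearRel, Set.mem_ofPred_eq] at h ⊢
  rw [dist_comm]
  linarith

theorem norm_traceless_le_add_dist (X Y : MatTuple d 2) :
    ‖traceless X‖ ≤ ‖traceless Y‖ + dist X Y := by
  have h1 := norm_traceless_le (X - Y)
  rw [map_sub] at h1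
  have h2 := norm_sub_norm_le (traceless X) (traceless Y)
  rw [dist_eq_norm]
  linarith

/-- Since `‖traceless Y‖ ≤ ‖traceless X‖ + dist X Y`, the relation bounds the distance in terms of
`X` alone. The bound `1 / 8` suffices: a distance of at least half of `‖traceless X‖` would give `D²
< (1/8) (2D) (3D)`. -/
theorem dist_lt_of_nearRel {ε : ℝ} (h0 : 0 < ε) (hε : ε ≤ 1 / 8) {X Y : MatTuple d 2}
    (h : (X, Y) ∈ nearRel d ε) :
    dist X Y < ‖traceless X‖ / 2 ∧ dist X Y ^ 2 < 2 * ε * ‖traceless X‖ ^ 2 := by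
  simp only [nearRel, Set.mem_ofPred_eq] at h
  have h1 := norm_traceless_le_add_dist Y X
  rw [dist_comm] at h1
  set D := dist X Y
  set x := ‖traceless X‖ with hx
  set y := ‖traceless Y‖ with hy
  have hD : 0 ≤ D := dist_nonneg
  have hx0 : 0 ≤ x := norm_nonneg _
  have hy0 : 0 ≤ y := norm_nonneg _
  have h2 : D ^ 2 < ε * x * (x + D) := h.trans_le (by gcongr)
  have hD1 : D < x / 2 := by
    by_contra hc
    push Not at hc
    have h3 : ε * x * (x + D) ≤ 1 / 8 * x * (x + D) := by gcongr
    nlinarith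
  refine ⟨hD1, h2.trans_le ?_⟩
  have : ε * x * (x + D) ≤ ε * x * (x + x) := by gcongr; linarith
  linarith

namespace IsHomogeneousMeasure

variable {m : Measure (MatTuple d 2)}

theorem sFinite (hm : IsHomogeneousMeasure m) : SFinite m := by
  have : IsFiniteMeasureOnCompacts m := ⟨fun K hK => by
    obtain ⟨R, hR⟩ := hK.isBounded.subset_closedBall 0
    exact (measure_mono hR).trans_lt (hm.closedBall_lt_top R)⟩
  infer_instance

theorem withDensity_lt_top (hm : IsHomogeneousMeasure m) {δ : ℝ} (hδ : 0 < δ) (R : ℝ)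
    {O : Set (MatTuple d 2)} (hO : ∀ X ∈ O, δ ≤ ‖traceless X‖ ∧ ‖X‖ ≤ R) :
    m.withDensity scaleWeight O < ∞ := by
  have hcl : IsClosed {X : MatTuple d 2 | δ ≤ ‖traceless X‖} :=
    isClosed_le continuous_const continuous_traceless.norm
  have hsub : O ⊆ {X | δ ≤ ‖traceless X‖} ∩ Metric.closedBall 0 R := fun X hX =>
    ⟨(hO X hX).1, mem_closedBall_zero_iff.2 (hO X hX).2⟩
  have hmeas := hcl.measurableSet.inter
    (Metric.isClosed_closedBall (x := (0 : MatTuple d 2)) (ε := R)).measurableSet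
  refine (measure_mono hsub).trans_lt ?_
  rw [withDensity_apply _ hmeas]
  refine (setLIntegral_mono (g := fun _ => ENNReal.ofReal ((δ ^ (4 * d + 4))⁻¹)) measurable_const
    fun X hX => ?_).trans_lt ?_
  · have : δ ≤ ‖traceless X‖ := hX.1
    exact ENNReal.ofReal_le_ofReal (by gcongr)
  · rw [setLIntegral_const]
    exact ENNReal.mul_lt_top ENNReal.ofReal_lt_top
      ((measure_mono Set.inter_subset_right).trans_lt (hm.closedBall_lt_top R))

/-- Both sides of the relation scale by `ρ ^ 2`, and the weight `‖traceless X‖ ^ (-(4 * d + 4))`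
compensates the scaling of `m`. A similarity therefore acts as a measure-preserving symmetry of the
relation. -/
theorem withDensity_nearRel_eq {ρ ε : ℝ} (hρ : 0 < ρ)
    {g : MatTuple d 2 → MatTuple d 2} (hg : Measurable g)
    (hmap : m.map g = ENNReal.ofReal ((ρ ^ (4 * d + 4))⁻¹) • m)
    (hdist : ∀ X Y, dist (g X) (g Y) = ρ * dist X Y)
    (hsize : ∀ X, ‖traceless (g X)‖ = ρ * ‖traceless X‖) (X : MatTuple d 2) :
    m.withDensity scaleWeight {Y | (g X, Y) ∈ nearRel d ε} =
      m.withDensity scaleWeight {Y | (X, Y) ∈ nearRel d ε} := by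
  have hmeas : ∀ X : MatTuple d 2, MeasurableSet {Y | (X, Y) ∈ nearRel d ε} := fun X =>
    ((isOpen_nearRel ε).preimage (by fun_prop : Continuous fun Y => (X, Y))).measurableSet
  have hpre : g ⁻¹' {Y | (g X, Y) ∈ nearRel d ε} = {Y | (X, Y) ∈ nearRel d ε} := by
    ext Y
    simp only [nearRel, Set.mem_preimage, Set.mem_ofPred_eq, hdist, hsize]
    have h1 : (ρ * dist X Y) ^ 2 = ρ ^ 2 * dist X Y ^ 2 := by ring
    have h2 : ε * (ρ * ‖traceless X‖) * (ρ * ‖traceless Y‖) =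
      ρ ^ 2 * (ε * ‖traceless X‖ * ‖traceless Y‖) := by ring
    rw [h1, h2]
    exact mul_lt_mul_iff_right₀ (by positivity)
  rw [withDensity_apply _ (hmeas _), withDensity_apply _ (hmeas _)]
  set c := ENNReal.ofReal ((ρ ^ (4 * d + 4))⁻¹) with hc
  have hc0 : c ≠ 0 := by
    rw [hc, Ne, ENNReal.ofReal_eq_zero, not_le]; positivity
  have h1 : c * ∫⁻ Y in {Y | (g X, Y) ∈ nearRel d ε}, scaleWeight Y ∂m =
      c * ∫⁻ Y in {Y | (X, Y) ∈ nearRel d ε}, scaleWeight Y ∂m := by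
    rw [← smul_eq_mul, ← lintegral_smul_measure, ← Measure.restrict_smul, ← hmap,
      setLIntegral_map (hmeas _) measurable_scaleWeight hg, hpre,
      ← lintegral_const_mul _ measurable_scaleWeight]
    refine lintegral_congr fun Y => ?_
    rw [scaleWeight, scaleWeight, hsize, mul_pow, mul_inv, ENNReal.ofReal_mul (by positivity)]
  exact (ENNReal.mul_right_inj hc0 ENNReal.ofReal_ne_top).1 h1

/-- Transitivity: a nonscalar commuting tuple arises from the unit tensor `e ⊗ f` by a unitary on
each side, a dilation by `‖v‖ * ‖w‖` and a translation. -/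
theorem withDensity_nearRel_const (hm : IsHomogeneousMeasure m) (ε : ℝ)
    {X : MatTuple d 2} (hX : X ∈ commutingTuples d 2) (hX0 : traceless X ≠ 0)
    {e : CSpace d} (he : ‖e‖ = 1) {f : CSpace 3} (hf : ‖f‖ = 1) :
    m.withDensity scaleWeight {Y | (X, Y) ∈ nearRel d ε} =
      m.withDensity scaleWeight {Y | (rankOne 0 e f, Y) ∈ nearRel d ε} := by
  obtain ⟨-, v, w, -, -, -, hXe⟩ := exists_eq_rankOne hX
  have hvw : ‖traceless X‖ = ‖v‖ * ‖w‖ := by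
    rw [hXe, traceless_rankOne, norm_rankOne_zero]
  have hpos : 0 < ‖v‖ * ‖w‖ := by rw [← hvw]; exact norm_pos_iff.2 hX0
  have hv : ‖v‖ ≠ 0 := left_ne_zero_of_mul hpos.ne'
  have hw : ‖w‖ ≠ 0 := right_ne_zero_of_mul hpos.ne'
  obtain ⟨A, hA⟩ := exists_linearIsometryEquiv_apply_eq (x := e)
    (y := ((‖v‖ : ℝ) : ℂ)⁻¹ • v) he (by simp [norm_smul, hv])
  obtain ⟨B, hB⟩ := exists_linearIsometryEquiv_apply_eq (x := f)
    (y := ((‖w‖ : ℝ) : ℂ)⁻¹ • w) hf (by simp [norm_smul, hw])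
  have hvC : ((‖v‖ : ℝ) : ℂ) ≠ 0 := by exact_mod_cast hv
  have hwC : ((‖w‖ : ℝ) : ℂ) ≠ 0 := by exact_mod_cast hw
  have e4 : X = ((‖v‖ * ‖w‖ : ℝ) : ℂ) • rightAction B (leftAction A (rankOne 0 e f)) +
      rankOne (center X) 0 0 := by
    rw [leftAction_rankOne, rightAction_rankOne, ← rankOne_smul, rankOne_add_translate, map_zero,
      smul_zero, zero_add, hA, hB, rankOne_smul_right]
    conv_lhs => rw [hXe]
    congr 1
    rw [smul_smul, smul_smul]
    push_cast
    have : ((‖w‖ : ℝ) : ℂ)⁻¹ * (((‖v‖ : ℝ) : ℂ) * (‖w‖ : ℝ)) * ((‖v‖ : ℝ) : ℂ)⁻¹ = 1 := by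
      field_simp
    rw [this, one_smul]
  have hz : rankOne (0 : CSpace d) 0 (0 : CSpace 3) = 0 := by
    rw [← norm_eq_zero, norm_rankOne_zero]; simp
  rw [e4]
  have one : ENNReal.ofReal (((1 : ℝ) ^ (4 * d + 4))⁻¹) • m = m := by simp
  rw [withDensity_nearRel_eq (ρ := 1) (g := fun Z => Z + rankOne (center X) 0 0) one_pos (by fun_prop)
      (by rw [hm.map_translate, one]) (fun X Y => by simp)
      (fun Z => by rw [map_add, traceless_rankOne, hz, add_zero, one_mul]),
    withDensity_nearRel_eq (g := fun X => ((‖v‖ * ‖w‖ : ℝ) : ℂ) • X) hpos (by fun_prop)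
      (hm.map_smul _ hpos) (fun X Y => by
        rw [dist_smul₀, Complex.norm_real, Real.norm_of_nonneg hpos.le])
      (fun X => by rw [_root_.map_smul, norm_smul, Complex.norm_real, Real.norm_of_nonneg hpos.le]),
    withDensity_nearRel_eq (ρ := 1) (g := rightAction B) one_pos
      (rightAction B).continuous.measurable
      (by rw [hm.map_rightAction, one]) (fun X Y => by simp)
      (fun X => by rw [norm_traceless_rightAction, one_mul]),
    withDensity_nearRel_eq (ρ := 1) (g := leftAction A) one_pos
      (leftAction A).continuous.measurable
      (by rw [hm.map_leftAction, one]) (fun X Y => by simp)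
      (fun X => by rw [norm_traceless_leftAction, one_mul])]

theorem ae_withDensity (hm : IsHomogeneousMeasure m) :
    ∀ᵐ X ∂m.withDensity scaleWeight, X ∈ {X | X ∈ commutingTuples d 2 ∧ traceless X ≠ 0} := by
  refine (withDensity_absolutelyContinuous m scaleWeight).ae_le ?_
  filter_upwards [hm.ae_mem, hm.ae_traceless_ne_zero] with X h1 h2
  exact ⟨h1, h2⟩

theorem withDensity_nearRel_ne_zero (hm : IsHomogeneousMeasure m) {ε : ℝ} (hε : 0 < ε)
    {e : CSpace d} (he : ‖e‖ = 1) {f : CSpace 3} (hf : ‖f‖ = 1) :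
    m.withDensity scaleWeight {Y | (rankOne 0 e f, Y) ∈ nearRel d ε} ≠ 0 := by
  intro h0
  have h1 : m.withDensity scaleWeight {X | X ∈ commutingTuples d 2 ∧ traceless X ≠ 0} = 0 := by
    -- If one neighbourhood were null then all would be, by transitivity, and the variety would be
    -- locally null.
    refine measure_null_of_locally_null _ fun X hX => ⟨{Y | (X, Y) ∈ nearRel d ε}, ?_, ?_⟩
    · refine mem_nhdsWithin_of_mem_nhds (IsOpen.mem_nhds
        ((isOpen_nearRel ε).preimage (by fun_prop : Continuous fun Y => (X, Y))) ?_)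
      have : 0 < ‖traceless X‖ := norm_pos_iff.2 hX.2
      change dist X X ^ 2 < ε * ‖traceless X‖ * ‖traceless X‖
      rw [dist_self, zero_pow two_ne_zero]
      positivity
    · rw [hm.withDensity_nearRel_const ε hX.1 hX.2 he hf, h0]
  have h2 : m.withDensity scaleWeight = 0 := by
    rw [← Measure.measure_univ_eq_zero]
    have h3 := hm.ae_withDensity
    rw [ae_iff] at h3
    refine le_antisymm ?_ zero_le
    calc _ ≤ m.withDensity scaleWeight ({X | X ∈ commutingTuples d 2 ∧ traceless X ≠ 0} ∪
          {X | X ∉ {X | X ∈ commutingTuples d 2 ∧ traceless X ≠ 0}}) :=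
            measure_mono fun X _ => em _
      _ ≤ 0 := (measure_union_le _ _).trans (by rw [h1, h3, add_zero])
  rw [withDensity_eq_zero_iff measurable_scaleWeight.aemeasurable] at h2
  apply hm.ne_zero
  rw [← ae_eq_bot]
  refine Filter.eventually_false_iff_eq_bot.1 ?_
  filter_upwards [h2, hm.ae_traceless_ne_zero] with X h3 h4
  exact scaleWeight_ne_zero h4 h3

theorem withDensity_nearRel_ne_top (hm : IsHomogeneousMeasure m) {ε : ℝ} (h0 : 0 < ε)
    (hε : ε ≤ 1 / 8) {X : MatTuple d 2} (hX : traceless X ≠ 0) :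
    m.withDensity scaleWeight {Y | (X, Y) ∈ nearRel d ε} ≠ ∞ := by
  have hpos : 0 < ‖traceless X‖ := norm_pos_iff.2 hX
  refine (hm.withDensity_lt_top (δ := ‖traceless X‖ / 2) (by positivity)
    (‖X‖ + ‖traceless X‖ / 2) fun Y hY => ?_).ne
  have h1 := (dist_lt_of_nearRel h0 hε hY).1
  have h2 := norm_traceless_le_add_dist X Y
  have h3 := norm_sub_norm_le Y X
  rw [dist_comm, dist_eq_norm] at h1 h2
  constructor <;> linarith

theorem exists_eq_smul (hd : 1 ≤ d) {m' : Measure (MatTuple d 2)} (hm : IsHomogeneousMeasure m)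
    (hm' : IsHomogeneousMeasure m') : ∃ c : ℝ≥0∞, c ≠ 0 ∧ c ≠ ∞ ∧ m' = c • m := by
  have := hm.sFinite
  have := hm'.sFinite
  set e : CSpace d := EuclideanSpace.single ⟨0, hd⟩ 1 with he
  set f : CSpace 3 := EuclideanSpace.single 0 1 with hf
  have hen : ‖e‖ = 1 := by simp [he]
  have hfn : ‖f‖ = 1 := by simp [hf]
  have hX0 : traceless (rankOne 0 e f) ≠ 0 := by
    rw [← norm_ne_zero_iff, traceless_rankOne, norm_rankOne_zero, hen, hfn]
    norm_num
  -- The bound `1 / 8` keeps the neighbourhoods away from the scalar tuples, hence of finite mass;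
  -- convergence to zero makes them shrink.
  set ε : ℕ → ℝ := fun n => 1 / 8 / ((n : ℝ) + 1) with hεdef
  have hε0 : ∀ n, 0 < ε n := fun n => by simp only [hεdef]; positivity
  have hε8 : ∀ n, ε n ≤ 1 / 8 := fun n =>
    div_le_self (by norm_num) (by linarith [(n.cast_nonneg : (0 : ℝ) ≤ n)])
  have hεt : Tendsto ε atTop (𝓝 0) := by
    have := (tendsto_one_div_add_atTop_nhds_zero_nat (𝕜 := ℝ)).const_mul (1 / 8)
    simpa [hεdef, div_eq_mul_inv] using this
  -- An exhaustion by open sets that are bounded and stay away from the scalar tuples, where the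
  -- weight blows up.
  set O : ℕ → Set (MatTuple d 2) := fun n =>
    {X | ((n : ℝ) + 1)⁻¹ < ‖traceless X‖ ∧ ‖X‖ < n} with hO
  have hOfin : ∀ n, ∀ X ∈ O n, ((n : ℝ) + 1)⁻¹ ≤ ‖traceless X‖ ∧ ‖X‖ ≤ n :=
    fun n X hX => ⟨hX.1.le, hX.2.le⟩
  obtain ⟨c, hc0, hct, hc⟩ := exists_eq_smul_of_uniform (μ := m.withDensity scaleWeight)
    (ν := m'.withDensity scaleWeight) (S := {X | X ∈ commutingTuples d 2 ∧ traceless X ≠ 0})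
    (R := fun n => nearRel d (ε n)) (O := O)
    (a := fun n => m.withDensity scaleWeight {Y | (rankOne 0 e f, Y) ∈ nearRel d (ε n)})
    (b := fun n => m'.withDensity scaleWeight {Y | (rankOne 0 e f, Y) ∈ nearRel d (ε n)})
    ⟨rankOne 0 e f, rankOne_mem _ _ _, hX0⟩ hm.ae_withDensity hm'.ae_withDensity
    (fun n => isOpen_nearRel _) (fun n X Y => nearRel_symm)
    (fun n => hm.withDensity_nearRel_ne_zero (hε0 n) hen hfn)
    (fun n => hm.withDensity_nearRel_ne_top (hε0 n) (hε8 n) hX0)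
    (fun n => hm'.withDensity_nearRel_ne_zero (hε0 n) hen hfn)
    (fun n => hm'.withDensity_nearRel_ne_top (hε0 n) (hε8 n) hX0)
    (fun n X hX => hm.withDensity_nearRel_const _ hX.1 hX.2 hen hfn)
    (fun n X hX => hm'.withDensity_nearRel_const _ hX.1 hX.2 hen hfn)
    (fun U hU X hX => by
      obtain ⟨δ, hδ, hball⟩ := Metric.isOpen_iff.1 hU X hX.1
      have h1 : Tendsto (fun n => 2 * ε n * ‖traceless X‖ ^ 2) atTop (𝓝 0) := by
        simpa using (hεt.const_mul 2).mul_const (‖traceless X‖ ^ 2)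
      filter_upwards [h1.eventually_lt_const (by positivity : 0 < δ ^ 2)] with n hn Y hY
      apply hball
      rw [Metric.mem_ball, dist_comm]
      exact lt_of_pow_lt_pow_left₀ 2 hδ.le
        ((dist_lt_of_nearRel (hε0 n) (hε8 n) hY).2.trans hn))
    (fun n => (isOpen_lt continuous_const continuous_traceless.norm).inter
      (isOpen_lt continuous_norm continuous_const))
    (fun X hX => by
      have hpos : 0 < ‖traceless X‖ := norm_pos_iff.2 hX.2
      obtain ⟨k, hk⟩ := exists_nat_gt (max ‖X‖ ‖traceless X‖⁻¹)
      refine Set.mem_iUnion.2 ⟨k, ?_, (le_max_left _ _).trans_lt hk⟩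
      have := (le_max_right _ _).trans_lt hk
      exact inv_lt_of_inv_lt₀ hpos (by linarith))
    (fun n => (hm.withDensity_lt_top (by positivity) n (hOfin n)).ne)
    (fun n => (hm'.withDensity_lt_top (by positivity) n (hOfin n)).ne)
  refine ⟨c, hc0, hct, ?_⟩
  -- The weight is finite, and almost everywhere nonzero, so proportionality of the weighted
  -- measures descends to the original ones.
  have hinv : ∀ {k : Measure (MatTuple d 2)}, IsHomogeneousMeasure k →
      (k.withDensity scaleWeight).withDensity scaleWeight⁻¹ = k := fun hk =>
    withDensity_inv_same measurable_scaleWeight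
      (hk.ae_traceless_ne_zero.mono fun X hX => scaleWeight_ne_zero hX)
      (Eventually.of_forall scaleWeight_ne_top)
  rw [← hinv hm', hc, withDensity_smul_measure, hinv hm]

end IsHomogeneousMeasure

end MatTuple

/-! ### Scaling of Haar measures, and homogeneity of the Hausdorff measure. -/

/-- Multiplication by a complex number rescales Haar measures. -/
theorem map_complex_smul_addHaar {E : Type*} [NormedAddCommGroup E] [NormedSpace ℂ E]
    [FiniteDimensional ℂ E] [FiniteDimensional ℝ E] [MeasurableSpace E] [BorelSpace E]
    (μ : Measure E) [μ.IsAddHaarMeasure] {c : ℂ} (hc : c ≠ 0) :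
    μ.map (fun x => c • x) = ENNReal.ofReal ((‖c‖ ^ (2 * Module.finrank ℂ E))⁻¹) • μ := by
  -- The real determinant of a complex linear map is the squared modulus of its complex determinant.
  have hdet : LinearMap.det ((c • LinearMap.id : E →ₗ[ℂ] E).restrictScalars ℝ) =
      ‖c‖ ^ (2 * Module.finrank ℂ E) := by
    rw [LinearMap.det_restrictScalars, LinearMap.det_smul, LinearMap.det_id, mul_one,
      Algebra.norm_complex_apply, Complex.normSq_eq_norm_sq, norm_pow, ← pow_mul, mul_comm]
  have h := Measure.map_linearMap_addHaar_eq_smul_addHaar μ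
    (f := (c • LinearMap.id : E →ₗ[ℂ] E).restrictScalars ℝ)
    (by rw [hdet]; exact pow_ne_zero _ (norm_ne_zero_iff.2 hc))
  rw [hdet, abs_of_nonneg (by positivity)] at h
  exact h

theorem lintegral_comp_complex_smul {E : Type*} [NormedAddCommGroup E] [NormedSpace ℂ E]
    [FiniteDimensional ℂ E] [FiniteDimensional ℝ E] [MeasurableSpace E] [BorelSpace E]
    (μ : Measure E) [μ.IsAddHaarMeasure] {c : ℂ} (hc : c ≠ 0) (f : E → ℝ≥0∞) :
    ∫⁻ x, f (c • x) ∂μ =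
      ENNReal.ofReal ((‖c‖ ^ (2 * Module.finrank ℂ E))⁻¹) * ∫⁻ x, f x ∂μ := by
  have h := lintegral_map_equiv (μ := μ) f (MeasurableEquiv.smul₀ c hc)
  rw [MeasurableEquiv.coe_smul₀, map_complex_smul_addHaar μ hc, lintegral_smul_measure,
    smul_eq_mul] at h
  exact h.symm

namespace MatTuple

variable {d : ℕ}

/-- The Hausdorff measure on the set of commuting tuples. -/
def hausdorffCommuting (d : ℕ) : Measure (MatTuple d 2) :=
  (Measure.hausdorffMeasure ((4 * d + 4 : ℕ) : ℝ)).restrict (commutingTuples d 2)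

theorem map_hausdorffCommuting_isometryEquiv (g : MatTuple d 2 ≃ᵢ MatTuple d 2)
    (hg : ∀ X ∈ commutingTuples d 2, g X ∈ commutingTuples d 2)
    (hg' : ∀ X ∈ commutingTuples d 2, g.symm X ∈ commutingTuples d 2) :
    (hausdorffCommuting d).map g = hausdorffCommuting d := by
  have hpre : g ⁻¹' commutingTuples d 2 = commutingTuples d 2 := by
    ext X
    refine ⟨fun h => ?_, fun h => hg X h⟩
    have := hg' _ h
    rwa [g.symm_apply_apply] at this
  unfold hausdorffCommuting
  conv_lhs => rw [← hpre]
  rw [← Measure.restrict_map g.continuous.measurable isClosed_commutingTuples.measurableSet,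
    g.map_hausdorffMeasure]

theorem leftAction_symm (A : CSpace d ≃ₗᵢ[ℂ] CSpace d) (X : MatTuple d 2) :
    (leftAction A).symm X = leftAction A.symm X := by
  rw [LinearIsometryEquiv.symm_apply_eq]
  ext p
  have h : (WithLp.toLp 2 fun s => leftAction A.symm X (s, p.2) : CSpace d) =
    A.symm (WithLp.toLp 2 fun s => X (s, p.2)) := rfl
  rw [leftAction_apply, h, LinearIsometryEquiv.apply_symm_apply]

theorem rightAction_symm (B : CSpace 3 ≃ₗᵢ[ℂ] CSpace 3) (X : MatTuple d 2) :
    (rightAction B).symm X = rightAction B.symm X := by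
  rw [LinearIsometryEquiv.symm_apply_eq, rightAction_apply, rightAction_apply]
  simp

theorem rankOne_neg_zero (b : CSpace d) :
    rankOne (-b) 0 (0 : CSpace 3) = -rankOne b 0 0 := by
  rw [eq_neg_iff_add_eq_zero, rankOne_add_translate, neg_add_cancel, ← norm_eq_zero,
    norm_rankOne_zero]
  simp

theorem hausdorffCommuting_closedBall_lt_top (R : ℝ) :
    hausdorffCommuting d (Metric.closedBall 0 R) < ∞ := by
  rw [hausdorffCommuting, Measure.restrict_apply Metric.isClosed_closedBall.measurableSet,
    Set.inter_comm]
  exact hausdorffMeasure_inter_closedBall_lt_top R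

/-- Isometries preserving the set preserve its Hausdorff measure, and a dilation scales it by the
power given by the dimension `4 * d + 4`. -/
theorem isHomogeneousMeasure_hausdorffCommuting (hd : 1 ≤ d) :
    IsHomogeneousMeasure (hausdorffCommuting d) where
  map_translate b := by
    refine map_hausdorffCommuting_isometryEquiv (IsometryEquiv.addRight (rankOne b 0 0))
      (fun X hX => translate_mem b hX) fun X hX => ?_
    have := translate_mem (-b) hX
    rwa [rankOne_neg_zero] at this
  map_leftAction A := map_hausdorffCommuting_isometryEquiv (leftAction A).toIsometryEquiv
    (fun X hX => leftAction_mem A hX) fun X hX => by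
      change (leftAction A).symm X ∈ _
      rw [leftAction_symm]; exact leftAction_mem _ hX
  map_rightAction B := map_hausdorffCommuting_isometryEquiv (rightAction B).toIsometryEquiv
    (fun X hX => rightAction_mem B hX) fun X hX => by
      change (rightAction B).symm X ∈ _
      rw [rightAction_symm]; exact rightAction_mem _ hX
  map_smul ρ hρ := by
    have hρC : (ρ : ℂ) ≠ 0 := by exact_mod_cast hρ.ne'
    have hmeas : Measurable fun X : MatTuple d 2 => (ρ : ℂ) • X := by fun_prop
    have hpre : (fun X : MatTuple d 2 => (ρ : ℂ) • X) ⁻¹' commutingTuples d 2 =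
        commutingTuples d 2 := by
      ext X
      refine ⟨fun h => ?_, fun h => smul_mem _ h⟩
      have := smul_mem (ρ : ℂ)⁻¹ h
      rwa [smul_smul, inv_mul_cancel₀ hρC, one_smul] at this
    unfold hausdorffCommuting
    conv_lhs => rw [← hpre]
    rw [← Measure.restrict_map hmeas isClosed_commutingTuples.measurableSet,
      ← Measure.restrict_smul]
    congr 1
    ext s hs
    rw [Measure.map_apply hmeas hs, Set.preimage_smul₀ hρC,
      Measure.hausdorffMeasure_smul₀ (by positivity) (inv_ne_zero hρC), Measure.smul_apply]
    rw [ENNReal.smul_def, smul_eq_mul, smul_eq_mul]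
    congr 1
    rw [NNReal.rpow_natCast, nnnorm_inv, ENNReal.ofReal, inv_pow]
    congr 1
    rw [Real.toNNReal_inv, Real.toNNReal_pow hρ.le]
    congr 2
    ext
    simp [hρ.le]
  ae_mem := ae_restrict_mem isClosed_commutingTuples.measurableSet
  ae_traceless_ne_zero := by
    refine ae_restrict_of_ae ?_
    rw [ae_iff]
    simpa using hausdorffMeasure_traceless_eq_zero (d := d)
  closedBall_lt_top := hausdorffCommuting_closedBall_lt_top
  ne_zero := by
    rw [hausdorffCommuting, Ne, Measure.restrict_eq_zero]
    exact hausdorffMeasure_commutingTuples_ne_zero hd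

end MatTuple

/-! ### The model measure. -/

theorem map_withDensity_of_comp {α : Type*} [MeasurableSpace α] {μ : Measure α} {g : α → α}
    {f : α → ℝ≥0∞} (hg : Measurable g) (hf : Measurable f) {c k : ℝ≥0∞} (hmap : μ.map g = c • μ)
    (hfg : ∀ x, f x = k * f (g x)) :
    (μ.withDensity f).map g = (k * c) • μ.withDensity f := by
  ext s hs
  rw [Measure.map_apply hg hs, withDensity_apply _ (hg hs), Measure.smul_apply,
    withDensity_apply _ hs, lintegral_congr hfg, lintegral_const_mul k (f := fun x => f (g x)) (hf.comp hg),
    ← setLIntegral_map hs hf hg, hmap, Measure.restrict_smul,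
    lintegral_smul_measure, smul_eq_mul, smul_eq_mul, mul_assoc]

theorem lintegral_prod_withDensity_prod_withDensity {α β δ : Type*} [MeasurableSpace α]
    [MeasurableSpace β] [MeasurableSpace δ] {μ : Measure α} {ν : Measure β} {κ : Measure δ}
    [SFinite ν] [SFinite κ] {f : β → ℝ≥0∞} {h : δ → ℝ≥0∞} (hf : Measurable f) (hh : Measurable h)
    {G : α × β × δ → ℝ≥0∞} (hG : Measurable G) :
    ∫⁻ p, G p ∂μ.prod ((ν.withDensity f).prod (κ.withDensity h)) =
      ∫⁻ a, ∫⁻ b, f b * ∫⁻ c, h c * G (a, b, c) ∂κ ∂ν ∂μ := by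
  rw [lintegral_prod _ hG.aemeasurable]
  refine lintegral_congr fun a => ?_
  have hGa : Measurable fun p => G (a, p) := hG.comp measurable_prodMk_left
  rw [lintegral_prod _ hGa.aemeasurable,
    lintegral_withDensity_eq_lintegral_mul _ hf hGa.lintegral_prod_right']
  refine lintegral_congr fun b => ?_
  have hGb : Measurable fun c => G (a, b, c) := hGa.comp measurable_prodMk_left
  rw [Pi.mul_apply, lintegral_withDensity_eq_lintegral_mul _ hh hGb]
  rfl

theorem map_volume_linearIsometryEquiv {n : ℕ} (A : CSpace n ≃ₗᵢ[ℂ] CSpace n) :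
    (volume : Measure (CSpace n)).map A = volume := by
  let L : CSpace n ≃ₗᵢ[ℝ] CSpace n := ⟨A.toLinearEquiv.restrictScalars ℝ, A.norm_map⟩
  exact L.measurePreserving.map_eq

theorem lintegral_ofReal_pos {α : Type*} [MeasurableSpace α] {μ : Measure α} (hμ : μ ≠ 0)
    {f : α → ℝ} (hf : Measurable f) (hpos : ∀ᵐ x ∂μ, 0 < f x) :
    ∫⁻ x, ENNReal.ofReal (f x) ∂μ ≠ 0 := by
  intro h
  rw [lintegral_eq_zero_iff (by fun_prop)] at h
  apply hμ
  rw [← ae_eq_bot]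
  refine Filter.eventually_false_iff_eq_bot.1 ?_
  filter_upwards [h, hpos] with x h1 h2
  rw [Pi.zero_apply, ENNReal.ofReal_eq_zero] at h1
  linarith

theorem lintegral_exp_neg_mul_norm_sq_lt_top {E : Type*} [NormedAddCommGroup E]
    [InnerProductSpace ℝ E] [FiniteDimensional ℝ E] [MeasurableSpace E] [BorelSpace E] {b : ℝ}
    (hb : 0 < b) : ∫⁻ x : E, ENNReal.ofReal (Real.exp (-b * ‖x‖ ^ 2)) < ∞ := by
  have h := GaussianFourier.integrable_cexp_neg_mul_sq_norm_add (V := E) (b := (b : ℂ))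
    (by simpa using hb) 0 0
  have h2 : Integrable fun x : E => Real.exp (-b * ‖x‖ ^ 2) := by
    refine h.norm.congr (Eventually.of_forall fun x => ?_)
    simp only [Complex.norm_exp]
    norm_cast
    simp
  exact h2.lintegral_lt_top

theorem lintegral_norm_pow_four_mul_exp_lt_top {E : Type*} [NormedAddCommGroup E]
    [InnerProductSpace ℝ E] [FiniteDimensional ℝ E] [MeasurableSpace E] [BorelSpace E] {b : ℝ}
    (hb : 0 < b) : ∫⁻ x : E, ENNReal.ofReal (‖x‖ ^ 4 * Real.exp (-b * ‖x‖ ^ 2)) < ∞ := by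
  have hle : ∀ x : E, ENNReal.ofReal (‖x‖ ^ 4 * Real.exp (-b * ‖x‖ ^ 2)) ≤
      ENNReal.ofReal (8 / b ^ 2) * ENNReal.ofReal (Real.exp (-(b / 2) * ‖x‖ ^ 2)) := by
    intro x
    rw [← ENNReal.ofReal_mul (by positivity)]
    refine ENNReal.ofReal_le_ofReal ?_
    -- Half of the exponent absorbs the fourth power; the constant `8 / b ^ 2` is `2! * (2 / b) ^
    -- 2`.
    have h1 := Real.pow_div_factorial_le_exp (b / 2 * ‖x‖ ^ 2) (by positivity) 2
    have h2 : Real.exp (-b * ‖x‖ ^ 2) =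
        Real.exp (-(b / 2) * ‖x‖ ^ 2) * (Real.exp (b / 2 * ‖x‖ ^ 2))⁻¹ := by
      rw [← Real.exp_neg, ← Real.exp_add]; ring_nf
    rw [h2]
    have h3 : ‖x‖ ^ 4 ≤ 8 / b ^ 2 * Real.exp (b / 2 * ‖x‖ ^ 2) := by
      calc ‖x‖ ^ 4 = 8 / b ^ 2 * ((b / 2 * ‖x‖ ^ 2) ^ 2 / (2 ! : ℕ)) := by
            simp [Nat.factorial]; field_simp; norm_num
        _ ≤ _ := by gcongr
    calc ‖x‖ ^ 4 * (Real.exp (-(b / 2) * ‖x‖ ^ 2) * (Real.exp (b / 2 * ‖x‖ ^ 2))⁻¹)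
        ≤ 8 / b ^ 2 * Real.exp (b / 2 * ‖x‖ ^ 2) *
          (Real.exp (-(b / 2) * ‖x‖ ^ 2) * (Real.exp (b / 2 * ‖x‖ ^ 2))⁻¹) := by gcongr
      _ = _ := by field_simp
  refine (lintegral_mono hle).trans_lt ?_
  rw [lintegral_const_mul _ (by fun_prop)]
  exact ENNReal.mul_lt_top ENNReal.ofReal_lt_top
    (lintegral_exp_neg_mul_norm_sq_lt_top (by positivity))

namespace MatTuple

variable {d : ℕ}

/-- The radial density on the matrix factor of the model measure. -/
def matrixWeight (d : ℕ) (w : CSpace 3) : ℝ := ‖w‖ ^ (2 * d + 4) * Real.exp (-‖w‖ ^ 2)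

/-- The measure on the parameters of `rankOne` whose image has the symmetries of the Hausdorff
measure on the commuting tuples. -/
def paramMeasure (d : ℕ) : Measure (CSpace d × CSpace d × CSpace 3) :=
  (volume : Measure (CSpace d)).prod
    (((volume : Measure (CSpace d)).withDensity fun v => ENNReal.ofReal (‖v‖ ^ 4)).prod
      ((volume : Measure (CSpace 3)).withDensity fun w => ENNReal.ofReal (matrixWeight d w)))

/-- The image of `paramMeasure` on the commuting tuples. -/
def modelMeasure (d : ℕ) : Measure (MatTuple d 2) :=
  (paramMeasure d).map fun p => rankOne p.1 p.2.1 p.2.2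

theorem measurable_matrixWeight : Measurable (matrixWeight d) := by
  unfold matrixWeight; fun_prop

theorem lintegral_modelMeasure {F : MatTuple d 2 → ℝ≥0∞} (hF : Measurable F) :
    ∫⁻ X, F X ∂modelMeasure d = ∫⁻ a : CSpace d, ∫⁻ v : CSpace d, ENNReal.ofReal (‖v‖ ^ 4) *
      ∫⁻ w : CSpace 3, ENNReal.ofReal (matrixWeight d w) * F (rankOne a v w) := by
  rw [modelMeasure, lintegral_map hF continuous_rankOne.measurable, paramMeasure]
  exact lintegral_prod_withDensity_prod_withDensity (by fun_prop)
    measurable_matrixWeight.ennreal_ofReal (hF.comp continuous_rankOne.measurable)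

theorem map_modelMeasure {g : MatTuple d 2 → MatTuple d 2} (hg : Measurable g)
    {f₁ f₂ : CSpace d → CSpace d} {f₃ : CSpace 3 → CSpace 3} (h₁ : Measurable f₁)
    (h₂ : Measurable f₂) (h₃ : Measurable f₃)
    (hfg : ∀ a v w, g (rankOne a v w) = rankOne (f₁ a) (f₂ v) (f₃ w)) {c₁ c₂ : ℝ≥0∞}
    (hm₁ : (volume : Measure (CSpace d)).map f₁ = c₁ • volume)
    (hm₂ : ((volume : Measure (CSpace d)).withDensity fun v => ENNReal.ofReal (‖v‖ ^ 4)).map f₂ =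
      c₂ • (volume : Measure (CSpace d)).withDensity fun v => ENNReal.ofReal (‖v‖ ^ 4))
    (hm₃ : ((volume : Measure (CSpace 3)).withDensity
      fun w => ENNReal.ofReal (matrixWeight d w)).map f₃ =
      (volume : Measure (CSpace 3)).withDensity fun w => ENNReal.ofReal (matrixWeight d w)) :
    (modelMeasure d).map g = (c₁ * c₂) • modelMeasure d := by
  have h : (paramMeasure d).map (Prod.map f₁ (Prod.map f₂ f₃)) = (c₁ * c₂) • paramMeasure d := by
    unfold paramMeasure
    rw [← Measure.map_prod_map _ _ h₁ (h₂.prodMap h₃), ← Measure.map_prod_map _ _ h₂ h₃, hm₁, hm₂,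
      hm₃, Measure.prod_smul_left, Measure.prod_smul_left, Measure.prod_smul_right, smul_smul]
  unfold modelMeasure
  rw [Measure.map_map hg continuous_rankOne.measurable, ← Measure.map_smul, ← h,
    Measure.map_map continuous_rankOne.measurable (h₁.prodMap (h₂.prodMap h₃))]
  congr 1
  funext p
  exact hfg _ _ _

/-- For fixed `w` the norm is `2‖a‖² + ‖v‖²‖w‖²`. Scaling `v` by `‖w‖` produces `‖w‖ ^ (-(2 * d +
4))`, which cancels the power in `matrixWeight` and leaves a product of three Gaussian integrals. -/
theorem lintegral_gaussian_modelMeasure {γ : ℝ} (hγ : 0 < γ) :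
    ∫⁻ X, ENNReal.ofReal (Real.exp (-γ * ‖X‖ ^ 2)) ∂modelMeasure d < ∞ := by
  have hW := measurable_matrixWeight (d := d)
  rw [lintegral_modelMeasure (by fun_prop)]
  set A := ∫⁻ a : CSpace d, ENNReal.ofReal (Real.exp (-(2 * γ) * ‖a‖ ^ 2)) with hA
  set B := ∫⁻ v : CSpace d, ENNReal.ofReal (‖v‖ ^ 4 * Real.exp (-γ * ‖v‖ ^ 2)) with hB
  set D := ∫⁻ w : CSpace 3, ENNReal.ofReal (Real.exp (-1 * ‖w‖ ^ 2)) with hD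
  have h1 : ∀ a : CSpace d, (∫⁻ v : CSpace d, ENNReal.ofReal (‖v‖ ^ 4) *
      ∫⁻ w : CSpace 3, ENNReal.ofReal (matrixWeight d w) *
        ENNReal.ofReal (Real.exp (-γ * ‖rankOne a v w‖ ^ 2))) =
      ENNReal.ofReal (Real.exp (-(2 * γ) * ‖a‖ ^ 2)) * (B * D) := by
    intro a
    calc _ = ∫⁻ v : CSpace d, ∫⁻ w : CSpace 3,
          ENNReal.ofReal (Real.exp (-(2 * γ) * ‖a‖ ^ 2)) * (ENNReal.ofReal (matrixWeight d w) *
          ENNReal.ofReal (‖v‖ ^ 4 * Real.exp (-γ * (‖v‖ ^ 2 * ‖w‖ ^ 2)))) := by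
          refine lintegral_congr fun v => ?_
          have hr : Measurable fun w : CSpace 3 => rankOne a v w :=
            continuous_rankOne.measurable.comp (by fun_prop : Measurable fun w => (a, v, w))
          rw [← lintegral_const_mul _ (by fun_prop)]
          refine lintegral_congr fun w => ?_
          have : 0 ≤ matrixWeight d w := by unfold matrixWeight; positivity
          rw [← ENNReal.ofReal_mul (by positivity), ← ENNReal.ofReal_mul (by positivity),
            ← ENNReal.ofReal_mul (by positivity), ← ENNReal.ofReal_mul (by positivity),
            norm_sq_rankOne, mul_add, Real.exp_add]
          ring_nf
      _ = ∫⁻ w : CSpace 3, ∫⁻ v : CSpace d,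
          ENNReal.ofReal (Real.exp (-(2 * γ) * ‖a‖ ^ 2)) * (ENNReal.ofReal (matrixWeight d w) *
          ENNReal.ofReal (‖v‖ ^ 4 * Real.exp (-γ * (‖v‖ ^ 2 * ‖w‖ ^ 2)))) :=
        lintegral_lintegral_swap (by fun_prop)
      _ = ∫⁻ w : CSpace 3, ENNReal.ofReal (Real.exp (-(2 * γ) * ‖a‖ ^ 2)) *
          (B * ENNReal.ofReal (Real.exp (-1 * ‖w‖ ^ 2))) := by
          refine lintegral_congr_ae ?_
          filter_upwards [Measure.ae_ne volume (0 : CSpace 3)] with w hw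
          have hw' : ‖w‖ ≠ 0 := norm_ne_zero_iff.2 hw
          rw [lintegral_const_mul _ (by fun_prop), lintegral_const_mul _ (by fun_prop)]
          congr 1
          have h2 := lintegral_comp_complex_smul (volume : Measure (CSpace d)) (c := ((‖w‖ : ℝ) : ℂ))
            (by exact_mod_cast hw') fun v => ENNReal.ofReal (‖v‖ ^ 4 * Real.exp (-γ * ‖v‖ ^ 2))
          rw [← hB, finrank_euclideanSpace_fin, Complex.norm_real, norm_norm] at h2
          have h3 : ∀ v : CSpace d, ENNReal.ofReal (‖v‖ ^ 4 * Real.exp (-γ * (‖v‖ ^ 2 * ‖w‖ ^ 2))) =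
              ENNReal.ofReal ((‖w‖ ^ 4)⁻¹) * ENNReal.ofReal (‖((‖w‖ : ℝ) : ℂ) • v‖ ^ 4 *
                Real.exp (-γ * ‖((‖w‖ : ℝ) : ℂ) • v‖ ^ 2)) := by
            intro v
            rw [← ENNReal.ofReal_mul (by positivity), norm_smul, Complex.norm_real, norm_norm]
            congr 1
            rw [mul_pow, mul_pow, mul_comm (‖w‖ ^ 2)]
            field_simp
          simp_rw [h3]
          rw [lintegral_const_mul _ (by fun_prop), h2, ← mul_assoc, ← mul_assoc,
            ← ENNReal.ofReal_mul (by unfold matrixWeight; positivity),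
            ← ENNReal.ofReal_mul (by unfold matrixWeight; positivity), mul_comm]
          congr 2
          unfold matrixWeight
          rw [pow_add]
          field_simp
      _ = _ := by
          rw [lintegral_const_mul _ (by fun_prop), lintegral_const_mul _ (by fun_prop)]
  simp_rw [h1]
  rw [lintegral_mul_const _ (by fun_prop)]
  exact ENNReal.mul_lt_top (lintegral_exp_neg_mul_norm_sq_lt_top (by positivity))
    (ENNReal.mul_lt_top (lintegral_norm_pow_four_mul_exp_lt_top hγ)
      (lintegral_exp_neg_mul_norm_sq_lt_top one_pos))

/-- Markov's inequality, since the Gaussian is bounded below on a ball. -/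
theorem modelMeasure_closedBall_lt_top (R : ℝ) :
    modelMeasure d (Metric.closedBall 0 R) < ∞ := by
  have h := lintegral_gaussian_modelMeasure (d := d) one_pos
  have h1 := mul_meas_ge_le_lintegral (μ := modelMeasure d)
    (f := fun X => ENNReal.ofReal (Real.exp (-1 * ‖X‖ ^ 2))) (by fun_prop)
    (ENNReal.ofReal (Real.exp (-1 * R ^ 2)))
  have h2 : modelMeasure d (Metric.closedBall 0 R) ≤ modelMeasure d {X |
      ENNReal.ofReal (Real.exp (-1 * R ^ 2)) ≤ ENNReal.ofReal (Real.exp (-1 * ‖X‖ ^ 2))} := by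
    refine measure_mono fun X hX => ENNReal.ofReal_le_ofReal (Real.exp_le_exp.2 ?_)
    rw [mem_closedBall_zero_iff] at hX
    have : ‖X‖ ^ 2 ≤ R ^ 2 := by gcongr
    linarith
  refine h2.trans_lt (lt_top_iff_ne_top.2 fun h3 => ?_)
  rw [h3, ENNReal.mul_top (by simp [Real.exp_pos])] at h1
  exact (h1.trans_lt h).ne rfl

/-- Each symmetry acts on `(a, v, w)` factor by factor, and the weights are radial. A dilation may
be put on `a` and `v` alone: the Jacobians give `ρ ^ (-2d)` twice and the weight `‖v‖ ^ 4` gives `ρ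
^ (-4)`, which explains the exponent `4`. -/
theorem isHomogeneousMeasure_modelMeasure (hd : 1 ≤ d) :
    IsHomogeneousMeasure (modelMeasure d) where
  map_translate b := by
    have h := map_modelMeasure (g := fun X => X + rankOne b 0 0) (by fun_prop)
      (f₁ := fun a => a + b) (f₂ := id) (f₃ := id) (by fun_prop) measurable_id measurable_id
      (fun a v w => rankOne_add_translate a b v w) (c₁ := 1) (c₂ := 1)
      (by rw [one_smul]; exact map_add_right_eq_self _ b) (by rw [one_smul, Measure.map_id])
      Measure.map_id
    simpa using h
  map_leftAction A := by
    have h := map_modelMeasure (g := leftAction A) (leftAction A).continuous.measurable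
      (f₁ := A) (f₂ := A) (f₃ := id) A.continuous.measurable A.continuous.measurable measurable_id
      (fun a v w => leftAction_rankOne A a v w) (c₁ := 1) (c₂ := 1)
      (by rw [one_smul]; exact map_volume_linearIsometryEquiv A)
      (by
        have := map_withDensity_of_comp A.continuous.measurable
          (f := fun v => ENNReal.ofReal (‖v‖ ^ 4)) (by fun_prop) (c := 1) (k := 1)
          (by rw [one_smul]; exact map_volume_linearIsometryEquiv A) (fun v => by simp)
        rwa [one_mul] at this) Measure.map_id
    simpa using h
  map_rightAction B := by
    have hW := measurable_matrixWeight (d := d)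
    have h := map_modelMeasure (g := rightAction B) (rightAction B).continuous.measurable
      (f₁ := id) (f₂ := id) (f₃ := B) measurable_id measurable_id B.continuous.measurable
      (fun a v w => rightAction_rankOne B a v w) (c₁ := 1) (c₂ := 1)
      (by rw [one_smul, Measure.map_id]) (by rw [one_smul, Measure.map_id])
      (by
        have := map_withDensity_of_comp B.continuous.measurable
          (f := fun w => ENNReal.ofReal (matrixWeight d w)) (by fun_prop) (c := 1) (k := 1)
          (by rw [one_smul]; exact map_volume_linearIsometryEquiv B)
          (fun v => by simp [matrixWeight])
        rwa [one_mul, one_smul] at this)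
    simpa using h
  map_smul ρ hρ := by
    have hρC : (ρ : ℂ) ≠ 0 := by exact_mod_cast hρ.ne'
    have hm := map_complex_smul_addHaar (volume : Measure (CSpace d)) hρC
    rw [finrank_euclideanSpace_fin, Complex.norm_real, Real.norm_of_nonneg hρ.le] at hm
    have h := map_modelMeasure (g := fun X => (ρ : ℂ) • X) (by fun_prop)
      (f₁ := fun a => (ρ : ℂ) • a) (f₂ := fun a => (ρ : ℂ) • a) (f₃ := id) (by fun_prop)
      (by fun_prop) measurable_id (fun a v w => (rankOne_smul _ a v w).symm)
      (c₁ := ENNReal.ofReal ((ρ ^ (2 * d))⁻¹))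
      (c₂ := ENNReal.ofReal ((ρ ^ 4)⁻¹) * ENNReal.ofReal ((ρ ^ (2 * d))⁻¹))
      hm
      (map_withDensity_of_comp (by fun_prop) (by fun_prop) hm fun v => by
        rw [← ENNReal.ofReal_mul (by positivity), norm_smul, Complex.norm_real,
          Real.norm_of_nonneg hρ.le, mul_pow, inv_mul_cancel_left₀ (by positivity)]) Measure.map_id
    rw [h, ← ENNReal.ofReal_mul (by positivity), ← ENNReal.ofReal_mul (by positivity)]
    congr 2
    rw [← mul_inv, ← mul_inv, ← pow_add, ← pow_add]
    congr 2
    ring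
  ae_mem := by
    refine (ae_map_iff (p := fun X => X ∈ commutingTuples d 2) continuous_rankOne.aemeasurable
      isClosed_commutingTuples.measurableSet).2 ?_
    exact Eventually.of_forall fun p => rankOne_mem _ _ _
  ae_traceless_ne_zero := by
    have : Nonempty (Fin d) := ⟨⟨0, hd⟩⟩
    have hc : MeasurableSet {X : MatTuple d 2 | traceless X ≠ 0} :=
      (isOpen_ne_fun continuous_traceless continuous_const).measurableSet
    rw [modelMeasure, ae_map_iff continuous_rankOne.aemeasurable hc, paramMeasure]
    have h1 : ∀ᵐ v ∂(volume : Measure (CSpace d)).withDensity fun v => ENNReal.ofReal (‖v‖ ^ 4),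
        v ≠ 0 := (withDensity_absolutelyContinuous _ _).ae_le (Measure.ae_ne volume 0)
    have h2 : ∀ᵐ w ∂(volume : Measure (CSpace 3)).withDensity
        fun w => ENNReal.ofReal (matrixWeight d w), w ≠ 0 :=
      (withDensity_absolutelyContinuous _ _).ae_le (Measure.ae_ne volume 0)
    filter_upwards [Measure.quasiMeasurePreserving_snd.ae
        (Measure.quasiMeasurePreserving_fst.ae h1),
      Measure.quasiMeasurePreserving_snd.ae (Measure.quasiMeasurePreserving_snd.ae h2)]
      with p hv hw
    rw [traceless_rankOne, ← norm_ne_zero_iff, norm_rankOne_zero]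
    exact mul_ne_zero (norm_ne_zero_iff.2 hv) (norm_ne_zero_iff.2 hw)
  closedBall_lt_top := modelMeasure_closedBall_lt_top
  ne_zero := by
    have : Nonempty (Fin d) := ⟨⟨0, hd⟩⟩
    have hW := measurable_matrixWeight (d := d)
    intro h
    have h1 : modelMeasure d Set.univ = 0 := by rw [h]; rfl
    rw [modelMeasure, Measure.map_apply continuous_rankOne.measurable MeasurableSet.univ,
      Set.preimage_univ, paramMeasure, ← Set.univ_prod_univ, Measure.prod_prod,
      ← Set.univ_prod_univ, Measure.prod_prod, withDensity_apply _ MeasurableSet.univ,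
      withDensity_apply _ MeasurableSet.univ, Measure.restrict_univ, Measure.restrict_univ] at h1
    refine mul_ne_zero (by simp) (mul_ne_zero ?_ ?_) h1
    · refine lintegral_ofReal_pos (NeZero.ne _) (by fun_prop) ?_
      filter_upwards [Measure.ae_ne volume (0 : CSpace d)] with v hv
      have := norm_pos_iff.2 hv
      positivity
    · refine lintegral_ofReal_pos (NeZero.ne _) hW ?_
      filter_upwards [Measure.ae_ne volume (0 : CSpace 3)] with v hv
      have := norm_pos_iff.2 hv
      unfold matrixWeight
      positivity

theorem exists_modelMeasure_eq_smul (hd : 1 ≤ d) :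
    ∃ c : ℝ≥0∞, c ≠ 0 ∧ c ≠ ∞ ∧ hausdorffCommuting d = c • modelMeasure d :=
  (isHomogeneousMeasure_modelMeasure hd).exists_eq_smul hd
    (isHomogeneousMeasure_hausdorffCommuting hd)

end MatTuple

/-! ### Changes of variables in the complex plane. -/

theorem lintegral_image_complex {s : Set ℂ} (hs : MeasurableSet s) {f f' : ℂ → ℂ}
    (hf : ∀ z ∈ s, HasDerivAt f (f' z) z) (hinj : Set.InjOn f s) (g : ℂ → ℝ≥0∞) :
    ∫⁻ z in f '' s, g z = ∫⁻ z in s, ENNReal.ofReal (‖f' z‖ ^ 2) * g (f z) := by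
  have hdet : ∀ c : ℂ, ((c • ContinuousLinearMap.id ℂ ℂ).restrictScalars ℝ).det = ‖c‖ ^ 2 := by
    intro c
    rw [ContinuousLinearMap.det]
    have h : (((c • ContinuousLinearMap.id ℂ ℂ).restrictScalars ℝ : ℂ →L[ℝ] ℂ) : ℂ →ₗ[ℝ] ℂ) =
        (c • LinearMap.id : ℂ →ₗ[ℂ] ℂ).restrictScalars ℝ := rfl
    rw [h, LinearMap.det_restrictScalars, LinearMap.det_smul, LinearMap.det_id, mul_one,
      Algebra.norm_complex_apply, Complex.normSq_eq_norm_sq]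
    simp
  have h := lintegral_image_eq_lintegral_abs_det_fderiv_mul volume hs (f := f)
    (f' := fun z => (f' z • ContinuousLinearMap.id ℂ ℂ).restrictScalars ℝ)
    (fun z hz => by
      have h1 := (hf z hz).hasFDerivAt.restrictScalars ℝ
      refine (h1.congr_fderiv ?_).hasFDerivWithinAt
      ext
      simp [mul_comm]) hinj g
  rw [h]
  refine lintegral_congr fun z => ?_
  rw [hdet, abs_of_nonneg (by positivity)]

theorem lintegral_complex_inv (g : ℂ → ℝ≥0∞) :
    ∫⁻ z : ℂ, ENNReal.ofReal ((‖z‖ ^ 4)⁻¹) * g z⁻¹ = ∫⁻ z, g z := by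
  have hs : MeasurableSet ({0}ᶜ : Set ℂ) := (measurableSet_singleton 0).compl
  have himg : (fun z : ℂ => z⁻¹) '' {0}ᶜ = {0}ᶜ := by
    ext z
    simp only [Set.mem_image, Set.mem_compl_iff, Set.mem_singleton_iff]
    exact ⟨fun ⟨w, hw, h⟩ => h ▸ inv_ne_zero hw, fun h => ⟨z⁻¹, inv_ne_zero h, inv_inv z⟩⟩
  have h := lintegral_image_complex hs (f := fun z => z⁻¹) (f' := fun z => -(z ^ 2)⁻¹)
    (fun z hz => hasDerivAt_inv hz) (fun x _ y _ hxy => inv_injective hxy) g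
  rw [himg, restrict_compl_singleton] at h
  rw [h]
  refine lintegral_congr fun z => ?_
  rw [norm_neg, norm_inv, norm_pow, inv_pow, ← pow_mul]

/-- A fundamental domain for `z ↦ -z`. -/
def upperHalf : Set ℂ := {z | 0 < z.im ∨ (z.im = 0 ∧ 0 < z.re)}

theorem measurableSet_upperHalf : MeasurableSet upperHalf := by
  refine (measurableSet_lt measurable_const Complex.measurable_im).union
    ((measurableSet_eq_fun Complex.measurable_im measurable_const).inter
      (measurableSet_lt measurable_const Complex.measurable_re))

theorem mem_upperHalf_or_neg_mem {z : ℂ} (hz : z ≠ 0) : z ∈ upperHalf ∨ -z ∈ upperHalf := by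
  simp only [upperHalf, Set.mem_ofPred_eq, Complex.neg_im, Complex.neg_re]
  have : z.re ≠ 0 ∨ z.im ≠ 0 := by
    by_contra! h
    exact hz (Complex.ext h.1 h.2)
  grind

theorem neg_notMem_upperHalf {z : ℂ} (hz : z ∈ upperHalf) : -z ∉ upperHalf := by
  simp only [upperHalf, Set.mem_ofPred_eq, Complex.neg_im, Complex.neg_re] at hz ⊢
  grind

/-- Squaring is two-to-one with Jacobian `4‖z‖²`, whence the factor `2 = 4 / 2`. -/
theorem lintegral_complex_sq {g : ℂ → ℝ≥0∞} (hg : Measurable g) :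
    ∫⁻ z : ℂ, g z = 2 * ∫⁻ z : ℂ, ENNReal.ofReal (‖z‖ ^ 2) * g (z ^ 2) := by
  have himg : (fun z : ℂ => z ^ 2) '' upperHalf = {0}ᶜ := by
    ext z
    simp only [Set.mem_image, Set.mem_compl_iff, Set.mem_singleton_iff]
    constructor
    · rintro ⟨w, hw, rfl⟩ h
      have h0 : w = 0 := by simpa using h
      rw [h0] at hw
      simp [upperHalf] at hw
    · intro hz
      obtain ⟨w, hw⟩ := IsAlgClosed.exists_pow_nat_eq z (n := 2) (by norm_num)
      have hw0 : w ≠ 0 := by rintro rfl; apply hz; rw [← hw]; simp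
      rcases mem_upperHalf_or_neg_mem hw0 with h | h
      · exact ⟨w, h, hw⟩
      · exact ⟨-w, h, by rw [neg_sq, hw]⟩
  have hinj : Set.InjOn (fun z : ℂ => z ^ 2) upperHalf := by
    intro x hx y hy hxy
    rcases sq_eq_sq_iff_eq_or_eq_neg.1 hxy with h | h
    · exact h
    · rw [h] at hx
      exact absurd hx (neg_notMem_upperHalf hy)
  have h := lintegral_image_complex measurableSet_upperHalf (f := fun z => z ^ 2)
    (f' := fun z => 2 * z) (fun z _ => by simpa using hasDerivAt_pow 2 z) hinj g
  rw [himg, restrict_compl_singleton] at h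
  set G : ℂ → ℝ≥0∞ := fun z => ENNReal.ofReal (‖z‖ ^ 2) * g (z ^ 2) with hG
  have hGm : Measurable G := by fun_prop
  have hneg : ∫⁻ z in upperHalfᶜ, G z = ∫⁻ z in upperHalf, G z := by
    rw [← lintegral_indicator measurableSet_upperHalf.compl,
      ← lintegral_indicator measurableSet_upperHalf,
      ← lintegral_neg_eq_self (fun z => upperHalf.indicator G z)]
    refine lintegral_congr_ae ?_
    filter_upwards [Measure.ae_ne volume (0 : ℂ)] with z hz
    have hGz : G (-z) = G z := by simp [hG]
    rcases mem_upperHalf_or_neg_mem hz with h1 | h1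
    · rw [Set.indicator_of_notMem (by simpa using h1),
        Set.indicator_of_notMem (neg_notMem_upperHalf h1)]
    · rw [Set.indicator_of_mem h1, Set.indicator_of_mem, hGz]
      intro h2
      exact neg_notMem_upperHalf h2 h1
  have hsplit := lintegral_add_compl G measurableSet_upperHalf (μ := volume)
  rw [← hsplit, hneg, h, ← two_mul, ← mul_assoc, ← lintegral_const_mul _ hGm]
  refine lintegral_congr fun z => ?_
  rw [hG, ← mul_assoc]
  congr 1
  rw [norm_mul, mul_pow, ENNReal.ofReal_mul (by positivity)]
  congr 1
  norm_num

theorem lintegral_comp_sub_right {g : ℂ → ℝ≥0∞} (c : ℂ) : ∫⁻ z, g (z - c) = ∫⁻ z, g z :=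
  lintegral_sub_right_eq_self g c

/-! ### Integrals over traceless matrices with lower left entry one. -/

/-- The squared norm of a traceless matrix with lower left entry `1`, one half of whose diagonal
difference is `x` and whose eigenvalues are the square roots of `k`. -/
def pencilNorm (x k : ℂ) : ℝ := 1 + 2 * ‖x‖ ^ 2 + ‖k - x ^ 2‖ ^ 2

theorem pencilNorm_pos (x k : ℂ) : 0 < pencilNorm x k := by unfold pencilNorm; positivity

theorem continuous_pencilNorm : Continuous fun p : ℂ × ℂ => pencilNorm p.1 p.2 := by
  unfold pencilNorm; fun_prop

/-- Here `σ⁻¹` is an eigenvalue of the matrix and `ξ` the affine coordinate of its eigenline,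
spanned by `(ξ, 1)`. The vector whose norm appears plays the role of the off-diagonal Schur entry
divided by the eigenvalue; it is affine in `σ`. -/
theorem pencilNorm_div (ξ σ : ℂ) (hσ : σ ≠ 0) :
    pencilNorm (ξ - σ⁻¹) (σ⁻¹ ^ 2) / ‖σ⁻¹‖ ^ 2 =
      2 + ‖((1 + ‖ξ‖ ^ 2 : ℝ) : ℂ) • (σ - 2 * (starRingEnd ℂ) ξ / ((1 + ‖ξ‖ ^ 2 : ℝ) : ℂ))‖ ^ 2 := by
  have hξ : (0 : ℝ) < 1 + ‖ξ‖ ^ 2 := by positivity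
  have hξC : ((1 + ‖ξ‖ ^ 2 : ℝ) : ℂ) ≠ 0 := by exact_mod_cast hξ.ne'
  have e1 : ((1 + ‖ξ‖ ^ 2 : ℝ) : ℂ) • (σ - 2 * (starRingEnd ℂ) ξ / ((1 + ‖ξ‖ ^ 2 : ℝ) : ℂ)) =
      ((1 + ‖ξ‖ ^ 2 : ℝ) : ℂ) * σ - 2 * (starRingEnd ℂ) ξ := by
    rw [smul_eq_mul]; field_simp
  have e2 : pencilNorm (ξ - σ⁻¹) (σ⁻¹ ^ 2) / ‖σ⁻¹‖ ^ 2 =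
      ‖σ‖ ^ 2 + 2 * ‖σ * ξ - 1‖ ^ 2 + ‖ξ‖ ^ 2 * ‖2 - σ * ξ‖ ^ 2 := by
    have h1 : ξ - σ⁻¹ = σ⁻¹ * (σ * ξ - 1) := by field_simp
    have h2 : σ⁻¹ ^ 2 - (ξ - σ⁻¹) ^ 2 = σ⁻¹ * (ξ * (2 - σ * ξ)) := by field_simp; ring
    have h3 : ‖σ‖ ≠ 0 := norm_ne_zero_iff.2 hσ
    rw [pencilNorm, h2, h1, norm_mul, norm_mul, norm_mul, norm_inv]
    field_simp
  rw [e1, e2]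
  simp only [← Complex.normSq_eq_norm_sq, Complex.normSq_apply, Complex.sub_re, Complex.sub_im,
    Complex.mul_re, Complex.mul_im, Complex.ofReal_re, Complex.ofReal_im, Complex.one_re,
    Complex.one_im, Complex.conj_re, Complex.conj_im, Complex.re_ofNat, Complex.im_ofNat]
  ring

/-- Inversion `σ = τ⁻¹` absorbs `‖τ‖ ^ (-4)`, and the affine change from `σ` to the Schur entry `β`
leaves the Fubini–Study density in `ξ`. Eigenline and Schur entry thereby separate. -/
theorem lintegral_pencilNorm_eq (ψ : ℝ → ℝ≥0∞) (ξ : ℂ) :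
    ∫⁻ τ : ℂ, ENNReal.ofReal ((‖τ‖ ^ 4)⁻¹) * ψ (pencilNorm (ξ - τ) (τ ^ 2) / ‖τ‖ ^ 2) =
      ENNReal.ofReal (((1 + ‖ξ‖ ^ 2) ^ 2)⁻¹) * ∫⁻ β : ℂ, ψ (2 + ‖β‖ ^ 2) := by
  have hξ : (0 : ℝ) < 1 + ‖ξ‖ ^ 2 := by positivity
  have hξC : ((1 + ‖ξ‖ ^ 2 : ℝ) : ℂ) ≠ 0 := by exact_mod_cast hξ.ne'
  have h1 := lintegral_complex_inv fun σ => ψ (pencilNorm (ξ - σ⁻¹) (σ⁻¹ ^ 2) / ‖σ⁻¹‖ ^ 2)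
  simp only [inv_inv] at h1
  rw [h1]
  have h2 : ∫⁻ σ : ℂ, ψ (pencilNorm (ξ - σ⁻¹) (σ⁻¹ ^ 2) / ‖σ⁻¹‖ ^ 2) =
      ∫⁻ σ : ℂ, ψ (2 + ‖((1 + ‖ξ‖ ^ 2 : ℝ) : ℂ) •
        (σ - 2 * (starRingEnd ℂ) ξ / ((1 + ‖ξ‖ ^ 2 : ℝ) : ℂ))‖ ^ 2) := by
    refine lintegral_congr_ae ?_
    filter_upwards [Measure.ae_ne volume (0 : ℂ)] with σ hσ
    rw [pencilNorm_div ξ σ hσ]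
  rw [h2, lintegral_comp_sub_right (g := fun σ => ψ (2 + ‖((1 + ‖ξ‖ ^ 2 : ℝ) : ℂ) • σ‖ ^ 2)),
    lintegral_comp_complex_smul volume hξC fun σ => ψ (2 + ‖σ‖ ^ 2), Complex.norm_real,
    Real.norm_of_nonneg hξ.le, Module.finrank_self]

theorem lintegral_norm_pow_four_mul_exp_scale {N : ℝ} (hN : 0 < N) :
    ∫⁻ z : ℂ, ENNReal.ofReal (‖z‖ ^ 4 * Real.exp (-(‖z‖ ^ 2 * N))) =
      ENNReal.ofReal ((N ^ 3)⁻¹) * ∫⁻ z : ℂ, ENNReal.ofReal (‖z‖ ^ 4 * Real.exp (-1 * ‖z‖ ^ 2)) := by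
  have hs : (0 : ℝ) < √N := Real.sqrt_pos.2 hN
  have h := lintegral_comp_complex_smul (volume : Measure ℂ) (c := ((√N : ℝ) : ℂ))
    (by exact_mod_cast hs.ne') fun z => ENNReal.ofReal (‖z‖ ^ 4 * Real.exp (-1 * ‖z‖ ^ 2))
  rw [Complex.norm_real, Real.norm_of_nonneg hs.le, Module.finrank_self, mul_one,
    Real.sq_sqrt hN.le] at h
  have h3 : ∀ z : ℂ, ENNReal.ofReal (‖z‖ ^ 4 * Real.exp (-(‖z‖ ^ 2 * N))) =
      ENNReal.ofReal ((N ^ 2)⁻¹) * ENNReal.ofReal (‖((√N : ℝ) : ℂ) • z‖ ^ 4 *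
        Real.exp (-1 * ‖((√N : ℝ) : ℂ) • z‖ ^ 2)) := by
    intro z
    have h4 : √N ^ 4 = N ^ 2 := by
      rw [show 4 = 2 * 2 by norm_num, pow_mul, Real.sq_sqrt hN.le]
    rw [← ENNReal.ofReal_mul (by positivity), norm_smul, Complex.norm_real,
      Real.norm_of_nonneg hs.le, mul_pow, mul_pow, h4, Real.sq_sqrt hN.le]
    congr 1
    field_simp
  simp_rw [h3]
  rw [lintegral_const_mul _ (by fun_prop), h, ← mul_assoc, ← ENNReal.ofReal_mul (by positivity)]
  congr 2
  field_simp

theorem lintegral_mul_lintegral_lintegral_swap {α β δ : Type*} [MeasurableSpace α]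
    [MeasurableSpace β] [MeasurableSpace δ] {μ : Measure α} {ν : Measure β} {κ : Measure δ}
    [SFinite μ] [SFinite ν] [SFinite κ] {A : α → ℝ≥0∞} (hA : Measurable A)
    {B : α × β × δ → ℝ≥0∞} (hB : Measurable B) :
    ∫⁻ a, A a * ∫⁻ b, ∫⁻ c, B (a, b, c) ∂κ ∂ν ∂μ =
      ∫⁻ b, ∫⁻ c, ∫⁻ a, A a * B (a, b, c) ∂μ ∂κ ∂ν := by
  have hm : Measurable fun p : α × β × δ => A p.1 * B p := by fun_prop
  calc _ = ∫⁻ a, ∫⁻ p, A a * B (a, p) ∂ν.prod κ ∂μ := by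
        refine lintegral_congr fun a => ?_
        have h1 : Measurable fun p => B (a, p) := hB.comp measurable_prodMk_left
        rw [lintegral_const_mul _ h1, lintegral_prod _ h1.aemeasurable]
    _ = ∫⁻ p, ∫⁻ a, A a * B (a, p) ∂μ ∂ν.prod κ := lintegral_lintegral_swap hm.aemeasurable
    _ = _ := lintegral_prod (fun p => ∫⁻ a, A a * B (a, p) ∂μ)
        (hm.lintegral_prod_left').aemeasurable

theorem measurable_comp_pencilNorm_div {ψ : ℝ → ℝ≥0∞} (hψ : Measurable ψ) :
    Measurable fun p : ℂ × ℂ => ψ (pencilNorm p.1 p.2 / ‖p.2‖) :=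
  hψ.comp (continuous_pencilNorm.measurable.div (by fun_prop))

theorem lintegral_lintegral_const_mul {α β : Type*} [MeasurableSpace α] [MeasurableSpace β]
    {μ : Measure α} {ν : Measure β} [SFinite ν] (c : ℝ≥0∞) {G : α → β → ℝ≥0∞}
    (hG : Measurable fun p : α × β => G p.1 p.2) :
    ∫⁻ a, ∫⁻ b, c * G a b ∂ν ∂μ = c * ∫⁻ a, ∫⁻ b, G a b ∂ν ∂μ := by
  have h : ∀ a, ∫⁻ b, c * G a b ∂ν = c * ∫⁻ b, G a b ∂ν := fun a =>
    lintegral_const_mul _ (hG.comp measurable_prodMk_left)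
  simp_rw [h]
  exact lintegral_const_mul _ hG.lintegral_prod_right'

/-- The integrand obtained by integrating out the scale of a pencil. -/
def pencilDensity (ψ : ℝ → ℝ≥0∞) (x k : ℂ) : ℝ≥0∞ :=
  ENNReal.ofReal ((pencilNorm x k ^ 3)⁻¹) * ψ (pencilNorm x k / ‖k‖)

theorem measurable_pencilDensity {ψ : ℝ → ℝ≥0∞} (hψ : Measurable ψ) :
    Measurable fun p : ℂ × ℂ => pencilDensity ψ p.1 p.2 :=
  (continuous_pencilNorm.measurable.pow_const 3).inv.ennreal_ofReal.mul
    (measurable_comp_pencilNorm_div hψ)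

theorem lintegral_pencilNorm_integrate_scale {ψ : ℝ → ℝ≥0∞} (hψ : Measurable ψ) :
    ∫⁻ z : ℂ, ENNReal.ofReal (‖z‖ ^ 4) * ∫⁻ x : ℂ, ∫⁻ k : ℂ,
      ENNReal.ofReal (Real.exp (-(‖z‖ ^ 2 * pencilNorm x k))) * ψ (pencilNorm x k / ‖k‖) =
    (∫⁻ z : ℂ, ENNReal.ofReal (‖z‖ ^ 4 * Real.exp (-1 * ‖z‖ ^ 2))) *
      ∫⁻ x : ℂ, ∫⁻ k : ℂ, pencilDensity ψ x k := by
  have hψP := measurable_comp_pencilNorm_div hψ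
  have hP3 : Measurable fun p : ℂ × ℂ × ℂ => ENNReal.ofReal (Real.exp (-(‖p.1‖ ^ 2 *
      pencilNorm p.2.1 p.2.2))) := by
    have h1 : Measurable fun p : ℂ × ℂ × ℂ => pencilNorm p.2.1 p.2.2 :=
      continuous_pencilNorm.measurable.comp measurable_snd
    fun_prop
  have hB : Measurable fun p : ℂ × ℂ × ℂ =>
      ENNReal.ofReal (Real.exp (-(‖p.1‖ ^ 2 * pencilNorm p.2.1 p.2.2))) *
        ψ (pencilNorm p.2.1 p.2.2 / ‖p.2.2‖) := hP3.mul (hψP.comp measurable_snd)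
  have hA : Measurable fun z : ℂ => ENNReal.ofReal (‖z‖ ^ 4) := by fun_prop
  have h2 : ∀ x k : ℂ, ∫⁻ z : ℂ, ENNReal.ofReal (‖z‖ ^ 4) *
      (ENNReal.ofReal (Real.exp (-(‖z‖ ^ 2 * pencilNorm x k))) * ψ (pencilNorm x k / ‖k‖)) =
      (∫⁻ z : ℂ, ENNReal.ofReal (‖z‖ ^ 4 * Real.exp (-1 * ‖z‖ ^ 2))) * pencilDensity ψ x k := by
    intro x k
    simp_rw [← mul_assoc, ← ENNReal.ofReal_mul (pow_nonneg (norm_nonneg _) 4)]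
    rw [lintegral_mul_const _ (by fun_prop),
      lintegral_norm_pow_four_mul_exp_scale (pencilNorm_pos x k), pencilDensity]
    ring
  rw [lintegral_mul_lintegral_lintegral_swap hA hB]
  simp_rw [h2]
  exact lintegral_lintegral_const_mul _ (measurable_pencilDensity hψ)

/-- Replaces `x` by the eigenline coordinate `ξ = x + τ`. -/
theorem lintegral_lintegral_shear {H : ℂ → ℂ → ℝ≥0∞} (hH : Measurable fun p : ℂ × ℂ => H p.1 p.2) :
    ∫⁻ x, ∫⁻ τ, H x τ = ∫⁻ ξ, ∫⁻ τ, H (ξ - τ) τ := by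
  have hH' : Measurable fun p : ℂ × ℂ => H (p.2 - p.1) p.1 :=
    hH.comp ((measurable_snd.sub measurable_fst).prodMk measurable_fst)
  rw [lintegral_lintegral_swap hH.aemeasurable]
  have h : ∀ τ, ∫⁻ x, H x τ = ∫⁻ ξ, H (ξ - τ) τ := fun τ =>
    (lintegral_comp_sub_right (g := fun x => H x τ) τ).symm
  simp_rw [h]
  exact lintegral_lintegral_swap hH'.aemeasurable

/-- The integrand of `pencilDensity` in terms of a square root of `k`. -/
def pencilRootDensity (θ : ℝ → ℝ≥0∞) (x τ : ℂ) : ℝ≥0∞ :=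
  ENNReal.ofReal ((‖τ‖ ^ 4)⁻¹) * θ (pencilNorm x (τ ^ 2) / ‖τ‖ ^ 2)

theorem measurable_pencilRootDensity {θ : ℝ → ℝ≥0∞} (hθ : Measurable θ) :
    Measurable fun p : ℂ × ℂ => pencilRootDensity θ p.1 p.2 := by
  have hP2 : Measurable fun p : ℂ × ℂ => pencilNorm p.1 (p.2 ^ 2) / ‖p.2‖ ^ 2 :=
    (continuous_pencilNorm.measurable.comp
      (by fun_prop : Measurable fun p : ℂ × ℂ => (p.1, p.2 ^ 2))).div (by fun_prop)
  exact Measurable.mul (by fun_prop) (hθ.comp hP2)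

/-- With `k = τ²` and `q = pencilNorm x k / ‖τ‖²`, the factor `‖τ‖² * pencilNorm ^ (-3)` equals `‖τ‖
^ (-4) * q ^ (-3)`, so only `q` remains apart from the power of `‖τ‖`. -/
theorem lintegral_pencilDensity {ψ : ℝ → ℝ≥0∞} (hψ : Measurable ψ) (x : ℂ) :
    ∫⁻ k, pencilDensity ψ x k =
      2 * ∫⁻ τ, pencilRootDensity (fun q => ENNReal.ofReal ((q ^ 3)⁻¹) * ψ q) x τ := by
  have hx := (measurable_pencilDensity hψ).comp (measurable_prodMk_left (x := x))
  simp only [Function.comp_def] at hx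
  have h : ∫⁻ τ : ℂ, ENNReal.ofReal (‖τ‖ ^ 2) * pencilDensity ψ x (τ ^ 2) =
      ∫⁻ τ, pencilRootDensity (fun q => ENNReal.ofReal ((q ^ 3)⁻¹) * ψ q) x τ := by
    have hae : ∀ᵐ τ : ℂ, ENNReal.ofReal (‖τ‖ ^ 2) * pencilDensity ψ x (τ ^ 2) =
        pencilRootDensity (fun q => ENNReal.ofReal ((q ^ 3)⁻¹) * ψ q) x τ := by
      filter_upwards [Measure.ae_ne volume (0 : ℂ)] with τ hτ
      have h1 := norm_pos_iff.2 hτ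
      have h2 := pencilNorm_pos x (τ ^ 2)
      rw [pencilDensity, pencilRootDensity, ← mul_assoc, ← mul_assoc,
        ← ENNReal.ofReal_mul (by positivity), ← ENNReal.ofReal_mul (by positivity), norm_pow]
      congr 2
      field_simp
    exact lintegral_congr_ae hae
  rw [lintegral_complex_sq hx, h]

theorem lintegral_lintegral_pencilDensity {ψ : ℝ → ℝ≥0∞} (hψ : Measurable ψ) :
    ∫⁻ x : ℂ, ∫⁻ k : ℂ, pencilDensity ψ x k =
    2 * ((∫⁻ ξ : ℂ, ENNReal.ofReal (((1 + ‖ξ‖ ^ 2) ^ 2)⁻¹)) *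
      ∫⁻ β : ℂ, ENNReal.ofReal (((2 + ‖β‖ ^ 2) ^ 3)⁻¹) * ψ (2 + ‖β‖ ^ 2)) := by
  have hm := measurable_pencilRootDensity
    (by fun_prop : Measurable fun q : ℝ => ENNReal.ofReal ((q ^ 3)⁻¹) * ψ q)
  have h2 : ∀ ξ : ℂ, ∫⁻ τ, pencilRootDensity (fun q => ENNReal.ofReal ((q ^ 3)⁻¹) * ψ q) (ξ - τ) τ =
      ENNReal.ofReal (((1 + ‖ξ‖ ^ 2) ^ 2)⁻¹) *
        ∫⁻ β : ℂ, ENNReal.ofReal (((2 + ‖β‖ ^ 2) ^ 3)⁻¹) * ψ (2 + ‖β‖ ^ 2) :=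
    fun ξ => lintegral_pencilNorm_eq (fun q => ENNReal.ofReal ((q ^ 3)⁻¹) * ψ q) ξ
  simp_rw [lintegral_pencilDensity hψ]
  rw [lintegral_const_mul _ hm.lintegral_prod_right', lintegral_lintegral_shear hm]
  simp_rw [h2]
  rw [lintegral_mul_const _ (by fun_prop)]

theorem exists_lintegral_pencilNorm : ∃ K : ℝ≥0∞, K ≠ 0 ∧ K ≠ ∞ ∧ ∀ ψ : ℝ → ℝ≥0∞, Measurable ψ →
    ∫⁻ z : ℂ, ENNReal.ofReal (‖z‖ ^ 4) * ∫⁻ x : ℂ, ∫⁻ k : ℂ,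
      ENNReal.ofReal (Real.exp (-(‖z‖ ^ 2 * pencilNorm x k))) * ψ (pencilNorm x k / ‖k‖) =
    K * ∫⁻ β : ℂ, ENNReal.ofReal (((2 + ‖β‖ ^ 2) ^ 3)⁻¹) * ψ (2 + ‖β‖ ^ 2) := by
  set Cz := ∫⁻ z : ℂ, ENNReal.ofReal (‖z‖ ^ 4 * Real.exp (-1 * ‖z‖ ^ 2)) with hCz
  set Cξ := ∫⁻ ξ : ℂ, ENNReal.ofReal (((1 + ‖ξ‖ ^ 2) ^ 2)⁻¹) with hCξ
  have hCz0 : Cz ≠ 0 := by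
    refine lintegral_ofReal_pos (NeZero.ne _) (by fun_prop) ?_
    filter_upwards [Measure.ae_ne volume (0 : ℂ)] with v hv
    have := norm_pos_iff.2 hv
    positivity
  have hCξ0 : Cξ ≠ 0 :=
    lintegral_ofReal_pos (NeZero.ne _) (by fun_prop) (Eventually.of_forall fun ξ => by positivity)
  have hCξt : Cξ ≠ ∞ := by
    -- The exponent `-r / 2 = -2` corresponds to `r = 4`, which exceeds the real dimension `2`.
    have h := integrable_rpow_neg_one_add_norm_sq (E := ℂ) (μ := volume) (r := 4)
      (by rw [Complex.finrank_real_complex]; norm_num)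
    have h2 : Integrable fun ξ : ℂ => ((1 + ‖ξ‖ ^ 2) ^ 2)⁻¹ := by
      refine h.congr (Eventually.of_forall fun ξ => ?_)
      simp only
      rw [show (-4 / 2 : ℝ) = -(2 : ℕ) by norm_num, Real.rpow_neg (by positivity),
        Real.rpow_natCast]
    exact h2.lintegral_lt_top.ne
  refine ⟨2 * (Cz * Cξ), by simp [hCz0, hCξ0], ENNReal.mul_ne_top (by simp)
    (ENNReal.mul_ne_top (lintegral_norm_pow_four_mul_exp_lt_top one_pos).ne hCξt), fun ψ hψ => ?_⟩
  rw [lintegral_pencilNorm_integrate_scale hψ, lintegral_lintegral_pencilDensity hψ]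
  ring

/-! ### The distribution of norm over eigenvalue for a Gaussian traceless matrix. -/

/-- Coordinates of a traceless matrix by its entries, the lower left one first. -/
def entriesEquiv : (ℂ × ℂ × ℂ) ≃L[ℂ] CSpace 3 :=
  LinearEquiv.toContinuousLinearEquiv
  { toFun := fun p => !₂[(√2 : ℝ) * p.2.1, p.2.2, p.1]
    invFun := fun w => (w 2, w 0 / (√2 : ℝ), w 1)
    map_add' := fun p q => by ext k; fin_cases k <;> simp; ring
    map_smul' := fun c p => by ext k; fin_cases k <;> simp; ring
    left_inv := fun p => by simp
    right_inv := fun w => by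
      ext k
      fin_cases k
      · simp only [Fin.zero_eta]
        exact mul_div_cancel₀ _ MatTuple.sqrt_two_ne_zero
      · rfl
      · rfl }

/-- `entriesEquiv` as a real linear equivalence. -/
def entriesEquivReal : (ℂ × ℂ × ℂ) ≃L[ℝ] CSpace 3 :=
  (entriesEquiv.toLinearEquiv.restrictScalars ℝ).toContinuousLinearEquiv

theorem entriesEquiv_zero (p : ℂ × ℂ × ℂ) : entriesEquiv p 0 = (√2 : ℝ) * p.2.1 := rfl
theorem entriesEquiv_one (p : ℂ × ℂ × ℂ) : entriesEquiv p 1 = p.2.2 := rfl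
theorem entriesEquiv_two (p : ℂ × ℂ × ℂ) : entriesEquiv p 2 = p.1 := rfl

theorem norm_sq_entriesEquiv (p : ℂ × ℂ × ℂ) :
    ‖entriesEquiv p‖ ^ 2 = 2 * ‖p.2.1‖ ^ 2 + ‖p.2.2‖ ^ 2 + ‖p.1‖ ^ 2 := by
  rw [EuclideanSpace.norm_sq_eq, Fin.sum_univ_three, entriesEquiv_zero, entriesEquiv_one,
    entriesEquiv_two, norm_mul, Complex.norm_real, Real.norm_of_nonneg (by positivity), mul_pow,
    Real.sq_sqrt (by norm_num)]

/-- A Haar measure is a multiple of the image of another one under a linear equivalence. -/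
theorem exists_eq_smul_map_addHaar {E F : Type*} [NormedAddCommGroup E] [NormedSpace ℝ E]
    [FiniteDimensional ℝ E] [MeasurableSpace E] [BorelSpace E] [NormedAddCommGroup F]
    [NormedSpace ℝ F] [FiniteDimensional ℝ F] [MeasurableSpace F] [BorelSpace F] (μ : Measure E)
    [μ.IsAddHaarMeasure] (ν : Measure F) [ν.IsAddHaarMeasure] (L : E ≃L[ℝ] F) :
    ∃ c : ℝ≥0∞, c ≠ 0 ∧ c ≠ ∞ ∧ ν = c • μ.map L := by
  have hL : (μ.map L).IsAddHaarMeasure := L.isAddHaarMeasure_map μ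
  have := Measure.isAddLeftInvariant_eq_smul ν (μ.map L)
  refine ⟨(ν.addHaarScalarFactor (μ.map L) : ℝ≥0∞), ?_, ENNReal.coe_ne_top, this⟩
  intro h
  rw [ENNReal.coe_eq_zero] at h
  rw [h, zero_smul] at this
  exact NeZero.ne ν this

theorem exists_lintegral_entriesEquiv : ∃ K : ℝ≥0∞, K ≠ 0 ∧ K ≠ ∞ ∧
    ∀ G : CSpace 3 → ℝ≥0∞, Measurable G →
      ∫⁻ w, G w = K * ∫⁻ z, ∫⁻ x, ∫⁻ y, G (entriesEquiv (z, x, y)) := by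
  have h2 : ((volume : Measure ℂ).prod (volume : Measure ℂ)).IsAddHaarMeasure := inferInstance
  obtain ⟨c, hc0, hct, hc⟩ := exists_eq_smul_map_addHaar
    ((volume : Measure ℂ).prod ((volume : Measure ℂ).prod (volume : Measure ℂ)))
    (volume : Measure (CSpace 3)) (entriesEquivReal)
  refine ⟨c, hc0, hct, fun G hG => ?_⟩
  have hGm : Measurable fun p => G (entriesEquiv p) := hG.comp entriesEquiv.continuous.measurable
  have e : ∫⁻ w, G w = c * ∫⁻ p, G (entriesEquiv p)
      ∂(volume : Measure ℂ).prod ((volume : Measure ℂ).prod (volume : Measure ℂ)) := by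
    rw [hc, lintegral_smul_measure, smul_eq_mul,
      lintegral_map hG (entriesEquivReal).continuous.measurable]
    rfl
  rw [e, lintegral_prod _ hGm.aemeasurable]
  congr 1
  refine lintegral_congr fun z => ?_
  have hz : Measurable fun p : ℂ × ℂ => G (entriesEquiv (z, p)) :=
    hGm.comp (measurable_prodMk_left (x := z))
  exact lintegral_prod (fun p => G (entriesEquiv (z, p))) hz.aemeasurable

/-- Minus the determinant of the traceless matrix with the given coordinates: the square of its
eigenvalues. -/
def sqEigenvalue (w : CSpace 3) : ℂ := w 0 ^ 2 / 2 + w 1 * w 2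

theorem continuous_sqEigenvalue : Continuous sqEigenvalue := by
  unfold sqEigenvalue; fun_prop

theorem sqEigenvalue_entriesEquiv (z x y : ℂ) :
    sqEigenvalue (entriesEquiv (z, x, y)) = x ^ 2 + y * z := by
  rw [sqEigenvalue, entriesEquiv_zero, entriesEquiv_one, entriesEquiv_two, mul_pow]
  have := MatTuple.sqrt_two_mul_self
  linear_combination x ^ 2 / 2 * this

/-- In the coordinates by entries, once `z ≠ 0` and `x` are fixed, nilpotency excludes the single
value `y = -x ^ 2 / z`. -/
theorem ae_sqEigenvalue_ne_zero : ∀ᵐ w : CSpace 3, sqEigenvalue w ≠ 0 := by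
  obtain ⟨K, -, -, hK⟩ := exists_lintegral_entriesEquiv
  have hms : MeasurableSet {w : CSpace 3 | sqEigenvalue w = 0} :=
    (isClosed_eq continuous_sqEigenvalue continuous_const).measurableSet
  have h := hK ({w : CSpace 3 | sqEigenvalue w = 0}.indicator fun _ => 1)
    (measurable_const.indicator hms)
  rw [lintegral_indicator_const hms, one_mul] at h
  have h0 : ∫⁻ z, ∫⁻ x, ∫⁻ y, {w : CSpace 3 | sqEigenvalue w = 0}.indicator (fun _ => (1 : ℝ≥0∞))
      (entriesEquiv (z, x, y)) = 0 := by
    refine (lintegral_congr_ae (g := fun _ => 0) ?_).trans (by simp)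
    filter_upwards [Measure.ae_ne volume (0 : ℂ)] with z hz
    refine (lintegral_congr (g := fun _ => 0) fun x => ?_).trans (by simp)
    refine (lintegral_congr_ae (g := fun _ => 0) ?_).trans (by simp)
    filter_upwards [Measure.ae_ne volume (-x ^ 2 / z)] with y hy
    refine Set.indicator_of_notMem ?_ _
    rw [Set.mem_ofPred_eq, sqEigenvalue_entriesEquiv]
    intro h1
    apply hy
    rw [eq_div_iff hz]
    linear_combination h1
  rw [h0, mul_zero] at h
  rw [ae_iff]
  simpa using h

/-- The squared ratio of the Frobenius norm to the modulus of the eigenvalues. -/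
def eigenvalueRatio (w : CSpace 3) : ℝ := ‖w‖ ^ 2 / ‖sqEigenvalue w‖

theorem measurable_eigenvalueRatio : Measurable eigenvalueRatio := by
  have := continuous_sqEigenvalue.measurable
  unfold eigenvalueRatio
  fun_prop

/-- Factors `z` out of the matrix with lower left entry `z`, then replaces the upper right entry by
the squared eigenvalue `k`. Each of the two variables contributes a Jacobian `‖z‖ ^ 2`. -/
theorem lintegral_pencil_substitution (g : ℂ → ℂ → ℝ≥0∞) {z : ℂ} (hz : z ≠ 0) :
    ∫⁻ x, ∫⁻ y, g x y =
      ENNReal.ofReal (‖z‖ ^ 4) * ∫⁻ x, ∫⁻ k, g (z * x) (z * (k - x ^ 2)) := by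
  have hz' := norm_pos_iff.2 hz
  have hsc : ∀ f : ℂ → ℝ≥0∞, ∫⁻ x, f x = ENNReal.ofReal (‖z‖ ^ 2) * ∫⁻ x, f (z * x) := by
    intro f
    have h := lintegral_comp_complex_smul (volume : Measure ℂ) hz f
    rw [Module.finrank_self, mul_one] at h
    have h1 : ∫⁻ x, f (z * x) = ENNReal.ofReal ((‖z‖ ^ 2)⁻¹) * ∫⁻ x, f x := h
    rw [h1, ← mul_assoc, ← ENNReal.ofReal_mul (by positivity), mul_inv_cancel₀ (by positivity)]
    simp
  rw [hsc fun x => ∫⁻ y, g x y]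
  have h1 : ∀ x, ∫⁻ y, g (z * x) y =
      ENNReal.ofReal (‖z‖ ^ 2) * ∫⁻ k, g (z * x) (z * (k - x ^ 2)) := by
    intro x
    rw [hsc fun y => g (z * x) y]
    congr 1
    exact (lintegral_comp_sub_right (g := fun y => g (z * x) (z * y)) (x ^ 2)).symm
  simp_rw [h1]
  rw [lintegral_const_mul' _ _ ENNReal.ofReal_ne_top, ← mul_assoc,
    ← ENNReal.ofReal_mul (by positivity), ← pow_add]

/-- The ratio is invariant under scaling the matrix, so after factoring out `z` it depends only on
`(x, k)`, which reduces the claim to `exists_lintegral_pencilNorm`. -/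
theorem exists_lintegral_eigenvalueRatio : ∃ K : ℝ≥0∞, K ≠ 0 ∧ K ≠ ∞ ∧
    ∀ ψ : ℝ → ℝ≥0∞, Measurable ψ →
    ∫⁻ w : CSpace 3, ENNReal.ofReal (Real.exp (-‖w‖ ^ 2)) * ψ (eigenvalueRatio w) =
    K * ∫⁻ β : ℂ, ENNReal.ofReal (((2 + ‖β‖ ^ 2) ^ 3)⁻¹) * ψ (2 + ‖β‖ ^ 2) := by
  obtain ⟨K₁, h₁0, h₁t, hK₁⟩ := exists_lintegral_entriesEquiv
  obtain ⟨K₂, h₂0, h₂t, hK₂⟩ := exists_lintegral_pencilNorm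
  refine ⟨K₁ * K₂, mul_ne_zero h₁0 h₂0, ENNReal.mul_ne_top h₁t h₂t, fun ψ hψ => ?_⟩
  have hG : Measurable fun w : CSpace 3 =>
      ENNReal.ofReal (Real.exp (-‖w‖ ^ 2)) * ψ (eigenvalueRatio w) :=
    Measurable.mul (by fun_prop) (hψ.comp measurable_eigenvalueRatio)
  rw [hK₁ _ hG, mul_assoc, ← hK₂ ψ hψ]
  congr 1
  refine lintegral_congr_ae ?_
  filter_upwards [Measure.ae_ne volume (0 : ℂ)] with z hz
  rw [lintegral_pencil_substitution (fun x y =>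
    ENNReal.ofReal (Real.exp (-‖entriesEquiv (z, x, y)‖ ^ 2)) *
      ψ (eigenvalueRatio (entriesEquiv (z, x, y)))) hz]
  congr 1
  have hn : ∀ x k : ℂ, ‖entriesEquiv (z, z * x, z * (k - x ^ 2))‖ ^ 2 =
      ‖z‖ ^ 2 * pencilNorm x k := by
    intro x k
    rw [norm_sq_entriesEquiv, pencilNorm]
    simp only [norm_mul, mul_pow]
    ring
  refine lintegral_congr fun x => lintegral_congr fun k => ?_
  have hr : eigenvalueRatio (entriesEquiv (z, z * x, z * (k - x ^ 2))) =
      pencilNorm x k / ‖k‖ := by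
    rw [eigenvalueRatio, hn, sqEigenvalue_entriesEquiv,
      show (z * x) ^ 2 + z * (k - x ^ 2) * z = z ^ 2 * k by ring, norm_mul, norm_pow,
      mul_div_mul_left _ _ (by positivity)]
  rw [hr, hn]

/-! ### The model integral in terms of midpoint and half difference. -/

namespace MatTuple

variable {d : ℕ}

/-- The density of half the difference of the eigenvalues, as an integral over the off-diagonal
entry of the Schur form. -/
def schurIntegral (d : ℕ) (s : ℝ) : ℝ≥0∞ :=
  ∫⁻ β : ℂ, ENNReal.ofReal ((2 + ‖β‖ ^ 2) ^ (d - 1) * Real.exp (-(s * (2 + ‖β‖ ^ 2))))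

/-- The substitution `u = τ • v`. The powers of `‖τ‖` from the Jacobian and from `‖v‖ ^ 4` combine
with `‖w‖ ^ (2 * d + 4)` into `eigenvalueRatio w ^ (d + 2)`; the power in `matrixWeight` is chosen
for this. -/
theorem lintegral_comp_eigenvalue_smul {γ : ℝ} {H : CSpace d → ℝ≥0∞} {a : CSpace d}
    {w : CSpace 3} {τ : ℂ} (hτ : τ ^ 2 = sqEigenvalue w) (hτ0 : τ ≠ 0) :
    ∫⁻ v : CSpace d, ENNReal.ofReal (‖v‖ ^ 4) * (ENNReal.ofReal (matrixWeight d w) *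
        (H (τ • v) * ENNReal.ofReal (Real.exp (-γ * ‖rankOne a v w‖ ^ 2)))) =
      ∫⁻ u : CSpace d, (ENNReal.ofReal (Real.exp (-(2 * γ) * ‖a‖ ^ 2)) *
        (ENNReal.ofReal (‖u‖ ^ 4) * H u)) * (ENNReal.ofReal (Real.exp (-‖w‖ ^ 2)) *
        ENNReal.ofReal (eigenvalueRatio w ^ (d + 2) *
          Real.exp (-(γ * ‖u‖ ^ 2 * eigenvalueRatio w)))) := by
  have hτn := norm_pos_iff.2 hτ0
  have hr : eigenvalueRatio w = ‖w‖ ^ 2 / ‖τ‖ ^ 2 := by rw [eigenvalueRatio, ← hτ, norm_pow]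
  have hr0 : 0 ≤ eigenvalueRatio w := by rw [hr]; positivity
  set Φ : CSpace d → ℝ≥0∞ := fun u => (ENNReal.ofReal (Real.exp (-(2 * γ) * ‖a‖ ^ 2)) *
        (ENNReal.ofReal (‖u‖ ^ 4) * H u)) * (ENNReal.ofReal (Real.exp (-‖w‖ ^ 2)) *
        ENNReal.ofReal (eigenvalueRatio w ^ (d + 2) *
          Real.exp (-(γ * ‖u‖ ^ 2 * eigenvalueRatio w)))) with hΦ
  have h := lintegral_comp_complex_smul (volume : Measure (CSpace d)) hτ0 Φ
  rw [finrank_euclideanSpace_fin] at h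
  have h2 : ∫⁻ u, Φ u = ENNReal.ofReal (‖τ‖ ^ (2 * d)) * ∫⁻ v, Φ (τ • v) := by
    rw [h, ← mul_assoc, ← ENNReal.ofReal_mul (by positivity), mul_inv_cancel₀ (by positivity)]
    simp
  rw [h2, ← lintegral_const_mul' _ _ ENNReal.ofReal_ne_top]
  refine lintegral_congr fun v => ?_
  have e1 : ENNReal.ofReal (‖v‖ ^ 4) * (ENNReal.ofReal (matrixWeight d w) *
        (H (τ • v) * ENNReal.ofReal (Real.exp (-γ * ‖rankOne a v w‖ ^ 2)))) =
      ENNReal.ofReal (‖v‖ ^ 4 * matrixWeight d w * Real.exp (-γ * ‖rankOne a v w‖ ^ 2)) *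
        H (τ • v) := by
    rw [ENNReal.ofReal_mul (by unfold matrixWeight; positivity),
      ENNReal.ofReal_mul (by positivity)]
    ring
  have e2 : ENNReal.ofReal (‖τ‖ ^ (2 * d)) * Φ (τ • v) =
      ENNReal.ofReal (‖τ‖ ^ (2 * d) * Real.exp (-(2 * γ) * ‖a‖ ^ 2) * ‖τ • v‖ ^ 4 *
        Real.exp (-‖w‖ ^ 2) * (eigenvalueRatio w ^ (d + 2) *
          Real.exp (-(γ * ‖τ • v‖ ^ 2 * eigenvalueRatio w)))) * H (τ • v) := by
    rw [ENNReal.ofReal_mul (by positivity), ENNReal.ofReal_mul (by positivity),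
      ENNReal.ofReal_mul (by positivity), ENNReal.ofReal_mul (by positivity), hΦ]
    ring
  rw [e1, e2]
  congr 2
  have h4 : γ * ‖τ • v‖ ^ 2 * eigenvalueRatio w = γ * (‖v‖ ^ 2 * ‖w‖ ^ 2) := by
    rw [hr, norm_smul]; field_simp
  have h5 : ‖τ‖ ^ (2 * d) * ‖τ • v‖ ^ 4 * eigenvalueRatio w ^ (d + 2) =
      ‖v‖ ^ 4 * ‖w‖ ^ (2 * d + 4) := by
    rw [hr, norm_smul, div_pow, ← pow_mul, ← pow_mul, show 2 * (d + 2) = 2 * d + 4 by ring,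
      mul_pow]
    field_simp
    ring
  rw [h4, norm_sq_rankOne, matrixWeight, mul_add, Real.exp_add]
  calc _ = (‖v‖ ^ 4 * ‖w‖ ^ (2 * d + 4)) * (Real.exp (-‖w‖ ^ 2) *
        (Real.exp (-γ * (2 * ‖a‖ ^ 2)) * Real.exp (-γ * (‖v‖ ^ 2 * ‖w‖ ^ 2)))) := by ring
    _ = _ := by
      rw [← h5, show -γ * (2 * ‖a‖ ^ 2) = -(2 * γ) * ‖a‖ ^ 2 by ring, neg_mul]
      ring_nf

/-- The choice of the square root `τ` depends on `w`, so `w` is moved outside for the substitution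
and inside again to integrate over the ratio. -/
theorem exists_lintegral_modelMeasure (hd : 1 ≤ d) : ∃ K : ℝ≥0∞, K ≠ 0 ∧ K ≠ ∞ ∧
    ∀ (γ : ℝ) (F : MatTuple d 2 → ℝ≥0∞) (H : CSpace d → CSpace d → ℝ≥0∞), Measurable F →
    (Measurable fun p : CSpace d × CSpace d => H p.1 p.2) →
    (∀ a v w τ, τ ^ 2 = sqEigenvalue w → F (rankOne a v w) = H a (τ • v)) →
    ∫⁻ X, F X * ENNReal.ofReal (Real.exp (-γ * ‖X‖ ^ 2)) ∂modelMeasure d =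
      K * ∫⁻ a, ∫⁻ u, ENNReal.ofReal (Real.exp (-(2 * γ) * ‖a‖ ^ 2)) *
        (ENNReal.ofReal (‖u‖ ^ 4) * H a u) * schurIntegral d (γ * ‖u‖ ^ 2) := by
  obtain ⟨K, hK0, hKt, hK⟩ := exists_lintegral_eigenvalueRatio
  refine ⟨K, hK0, hKt, fun γ F H hF hH hFH => ?_⟩
  have hFe : Measurable fun X : MatTuple d 2 => F X * ENNReal.ofReal (Real.exp (-γ * ‖X‖ ^ 2)) := by
    fun_prop
  rw [lintegral_modelMeasure hFe, ← lintegral_const_mul' _ _ hKt]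
  refine lintegral_congr fun a => ?_
  have hHa : Measurable fun u => H a u := by
    have := hH.comp (measurable_prodMk_left (x := a))
    simpa only [Function.comp_def] using this
  have hR : Measurable fun p : CSpace d × CSpace 3 => rankOne a p.1 p.2 := by
    have := continuous_rankOne.measurable.comp (measurable_prodMk_left (x := a))
    simpa only [Function.comp_def] using this
  have hW : Measurable fun p : CSpace d × CSpace 3 => matrixWeight d p.2 :=
    measurable_matrixWeight.comp measurable_snd
  have hFR := hF.comp hR
  simp only [Function.comp_def] at hFR
  have hFRv : ∀ v, Measurable fun w => F (rankOne a v w) := fun v => by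
    have := hFR.comp (measurable_prodMk_left (x := v))
    simpa only [Function.comp_def] using this
  have hq := measurable_eigenvalueRatio
  calc _ = ∫⁻ v : CSpace d, ∫⁻ w : CSpace 3, ENNReal.ofReal (‖v‖ ^ 4) *
        (ENNReal.ofReal (matrixWeight d w) *
        (F (rankOne a v w) * ENNReal.ofReal (Real.exp (-γ * ‖rankOne a v w‖ ^ 2)))) :=
        lintegral_congr fun v => (lintegral_const_mul' _ _ ENNReal.ofReal_ne_top).symm
    _ = ∫⁻ w : CSpace 3, ∫⁻ v : CSpace d, ENNReal.ofReal (‖v‖ ^ 4) *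
        (ENNReal.ofReal (matrixWeight d w) *
        (F (rankOne a v w) * ENNReal.ofReal (Real.exp (-γ * ‖rankOne a v w‖ ^ 2)))) :=
        lintegral_lintegral_swap (by fun_prop)
    _ = ∫⁻ w : CSpace 3, ∫⁻ u : CSpace d, (ENNReal.ofReal (Real.exp (-(2 * γ) * ‖a‖ ^ 2)) *
        (ENNReal.ofReal (‖u‖ ^ 4) * H a u)) * (ENNReal.ofReal (Real.exp (-‖w‖ ^ 2)) *
        ENNReal.ofReal (eigenvalueRatio w ^ (d + 2) *
          Real.exp (-(γ * ‖u‖ ^ 2 * eigenvalueRatio w)))) := by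
        refine lintegral_congr_ae ?_
        filter_upwards [ae_sqEigenvalue_ne_zero] with w hw
        obtain ⟨τ, hτ⟩ := IsAlgClosed.exists_pow_nat_eq (sqEigenvalue w) (n := 2) (by norm_num)
        have hτ0 : τ ≠ 0 := by rintro rfl; apply hw; rw [← hτ]; simp
        rw [← lintegral_comp_eigenvalue_smul hτ hτ0]
        refine lintegral_congr fun v => ?_
        rw [hFH a v w τ hτ]
    _ = ∫⁻ u : CSpace d, ∫⁻ w : CSpace 3, (ENNReal.ofReal (Real.exp (-(2 * γ) * ‖a‖ ^ 2)) *
        (ENNReal.ofReal (‖u‖ ^ 4) * H a u)) * (ENNReal.ofReal (Real.exp (-‖w‖ ^ 2)) *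
        ENNReal.ofReal (eigenvalueRatio w ^ (d + 2) *
          Real.exp (-(γ * ‖u‖ ^ 2 * eigenvalueRatio w)))) :=
        lintegral_lintegral_swap (by fun_prop)
    _ = ∫⁻ u : CSpace d, K * (ENNReal.ofReal (Real.exp (-(2 * γ) * ‖a‖ ^ 2)) *
        (ENNReal.ofReal (‖u‖ ^ 4) * H a u) * schurIntegral d (γ * ‖u‖ ^ 2)) := by
        refine lintegral_congr fun u => ?_
        rw [lintegral_const_mul _ (by fun_prop), hK (fun q => ENNReal.ofReal (q ^ (d + 2) *
          Real.exp (-(γ * ‖u‖ ^ 2 * q)))) (by fun_prop), schurIntegral]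
        -- The power `d + 2` meets the density exponent `-3` and leaves `d - 1`.
        have h3 : ∀ β : ℂ, ENNReal.ofReal (((2 + ‖β‖ ^ 2) ^ 3)⁻¹) *
            ENNReal.ofReal ((2 + ‖β‖ ^ 2) ^ (d + 2) *
              Real.exp (-(γ * ‖u‖ ^ 2 * (2 + ‖β‖ ^ 2)))) =
            ENNReal.ofReal ((2 + ‖β‖ ^ 2) ^ (d - 1) *
              Real.exp (-(γ * ‖u‖ ^ 2 * (2 + ‖β‖ ^ 2)))) := by
          intro β
          rw [← ENNReal.ofReal_mul (by positivity), show d + 2 = 3 + (d - 1) by omega, pow_add]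
          congr 1
          have : (0 : ℝ) < 2 + ‖β‖ ^ 2 := by positivity
          field_simp
        simp_rw [h3]
        ring
    _ = _ := lintegral_const_mul' _ _ hKt

end MatTuple

theorem lintegral_norm_pow_mul_exp (j : ℕ) {s : ℝ} (hs : 0 < s) :
    ∫⁻ β : ℂ, ENNReal.ofReal (‖β‖ ^ (2 * j) * Real.exp (-(s * ‖β‖ ^ 2))) =
      ENNReal.ofReal (Real.pi * (j ! : ℝ) / s ^ (j + 1)) := by
  have h := Complex.integral_rpow_mul_exp_neg_mul_rpow (p := 2) (q := (2 * j : ℕ)) (b := s)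
    (by norm_num) (lt_of_lt_of_le (by norm_num) (Nat.cast_nonneg _)) hs
  have e1 : ∀ β : ℂ, ‖β‖ ^ ((2 * j : ℕ) : ℝ) * Real.exp (-s * ‖β‖ ^ (2 : ℝ)) =
      ‖β‖ ^ (2 * j) * Real.exp (-(s * ‖β‖ ^ 2)) := by
    intro β
    rw [Real.rpow_natCast, show (2 : ℝ) = (2 : ℕ) by norm_num, Real.rpow_natCast, neg_mul]
  have e2 : (((2 * j : ℕ) : ℝ) + 2) / 2 = j + 1 := by push_cast; ring
  have e3 : 2 * Real.pi / 2 * s ^ (-(((2 * j : ℕ) : ℝ) + 2) / 2) *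
      Real.Gamma ((((2 * j : ℕ) : ℝ) + 2) / 2) = Real.pi * (j ! : ℝ) / s ^ (j + 1) := by
    rw [neg_div, e2, Real.Gamma_nat_eq_factorial, Real.rpow_neg hs.le,
      show (j : ℝ) + 1 = ((j + 1 : ℕ) : ℝ) by push_cast; ring, Real.rpow_natCast]
    field_simp
  simp_rw [e1] at h
  rw [e3] at h
  have hpos : 0 < Real.pi * (j ! : ℝ) / s ^ (j + 1) := by positivity
  rw [← h, ofReal_integral_eq_lintegral_ofReal]
  -- An undefined integral would be zero, whereas the closed form is positive; integrability
  -- therefore comes for free.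
  · by_contra hc
    rw [integral_undef hc] at h
    exact hpos.ne h
  · exact Eventually.of_forall fun β => by positivity

namespace MatTuple

variable {d : ℕ}

/-- The binomial expansion of `(‖β‖ ^ 2 + 2) ^ (d - 1)`, integrated term by term against the
Gaussian; this is the source of the sum in the density. -/
theorem schurIntegral_eq (d : ℕ) {s : ℝ} (hs : 0 < s) :
    schurIntegral d s = ENNReal.ofReal (∑ j ∈ Finset.range (d - 1 + 1),
      Real.exp (-(2 * s)) * 2 ^ (d - 1 - j) * ((d - 1).choose j : ℝ) *
        (Real.pi * (j ! : ℝ) / s ^ (j + 1))) := by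
  have h1 : ∀ β : ℂ, ENNReal.ofReal ((2 + ‖β‖ ^ 2) ^ (d - 1) *
      Real.exp (-(s * (2 + ‖β‖ ^ 2)))) = ∑ j ∈ Finset.range (d - 1 + 1),
      ENNReal.ofReal (Real.exp (-(2 * s)) * 2 ^ (d - 1 - j) * ((d - 1).choose j : ℝ)) *
        ENNReal.ofReal (‖β‖ ^ (2 * j) * Real.exp (-(s * ‖β‖ ^ 2))) := by
    intro β
    have e : ∀ j, ENNReal.ofReal (Real.exp (-(2 * s)) * 2 ^ (d - 1 - j) *
        ((d - 1).choose j : ℝ)) * ENNReal.ofReal (‖β‖ ^ (2 * j) * Real.exp (-(s * ‖β‖ ^ 2))) =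
        ENNReal.ofReal (Real.exp (-(2 * s)) * 2 ^ (d - 1 - j) * ((d - 1).choose j : ℝ) *
        (‖β‖ ^ (2 * j) * Real.exp (-(s * ‖β‖ ^ 2)))) := fun j =>
      (ENNReal.ofReal_mul (by positivity)).symm
    simp_rw [e]
    rw [← ENNReal.ofReal_sum_of_nonneg (fun j _ => by positivity), add_comm (2 : ℝ) (‖β‖ ^ 2),
      add_pow, Finset.sum_mul]
    congr 1
    refine Finset.sum_congr rfl fun j _ => ?_
    rw [mul_add, neg_add, Real.exp_add, ← pow_mul, mul_comm s 2]
    ring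
  unfold schurIntegral
  simp_rw [h1]
  rw [lintegral_finsetSum _ (fun j _ => by fun_prop),
    ENNReal.ofReal_sum_of_nonneg (fun j _ => by positivity)]
  refine Finset.sum_congr rfl fun j _ => ?_
  rw [lintegral_const_mul _ (by fun_prop), lintegral_norm_pow_mul_exp j hs,
    ← ENNReal.ofReal_mul (by positivity)]

/-- The pair of points with given midpoint and half difference. -/
def pairOfMidpoint (p : CSpace d × CSpace d) : Points d 2 := ![p.1 + p.2, p.1 - p.2]

@[simp] theorem pairOfMidpoint_zero (p : CSpace d × CSpace d) :
    pairOfMidpoint p 0 = p.1 + p.2 := rfl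

@[simp] theorem pairOfMidpoint_one (p : CSpace d × CSpace d) :
    pairOfMidpoint p 1 = p.1 - p.2 := rfl

/-- `pairOfMidpoint` as a linear equivalence. -/
def pairEquiv (d : ℕ) : (CSpace d × CSpace d) ≃L[ℝ] Points d 2 :=
  LinearEquiv.toContinuousLinearEquiv
  { toFun := pairOfMidpoint
    invFun := fun l => ((2 : ℝ)⁻¹ • (l 0 + l 1), (2 : ℝ)⁻¹ • (l 0 - l 1))
    map_add' := fun p q => by
      ext k : 1
      fin_cases k
      · exact add_add_add_comm _ _ _ _
      · exact add_sub_add_comm _ _ _ _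
    map_smul' := fun c p => by
      ext k : 1
      fin_cases k
      · exact (smul_add _ _ _).symm
      · exact (smul_sub _ _ _).symm
    left_inv := fun p => by
      refine Prod.ext ?_ ?_
      · simp only [pairOfMidpoint_zero, pairOfMidpoint_one]; module
      · simp only [pairOfMidpoint_zero, pairOfMidpoint_one]; module
    right_inv := fun l => by
      ext k : 1
      fin_cases k
      · simp only [Fin.zero_eta, pairOfMidpoint_zero]; module
      · simp only [Fin.mk_one, pairOfMidpoint_one]; module }

theorem exists_lintegral_pairOfMidpoint (d : ℕ) : ∃ K : ℝ≥0∞, K ≠ 0 ∧ K ≠ ∞ ∧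
    ∀ G : Points d 2 → ℝ≥0∞, Measurable G →
      ∫⁻ l, G l = K * ∫⁻ a, ∫⁻ u, G (pairOfMidpoint (a, u)) := by
  have h1 : ((volume : Measure (CSpace d)).prod
      (volume : Measure (CSpace d))).IsAddHaarMeasure := Measure.prod.instIsAddHaarMeasure _ _
  have h2 : (Measure.pi fun _ : Fin 2 => (volume : Measure (CSpace d))).IsAddHaarMeasure :=
    Measure.pi.isAddHaarMeasure _
  obtain ⟨c, hc0, hct, hc⟩ := exists_eq_smul_map_addHaar
    ((volume : Measure (CSpace d)).prod (volume : Measure (CSpace d)))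
    (Measure.pi fun _ : Fin 2 => (volume : Measure (CSpace d))) (pairEquiv d)
  refine ⟨c, hc0, hct, fun G hG => ?_⟩
  have hm := hG.comp (pairEquiv d).continuous.measurable
  rw [volume_pi, hc, lintegral_smul_measure, smul_eq_mul,
    lintegral_map hG (pairEquiv d).continuous.measurable]
  congr 1
  exact lintegral_prod (fun p => G (pairOfMidpoint p)) hm.aemeasurable

theorem norm_sq_add_norm_sq_pairOfMidpoint (a u : CSpace d) :
    ‖pairOfMidpoint (a, u) 0‖ ^ 2 + ‖pairOfMidpoint (a, u) 1‖ ^ 2 = 2 * ‖a‖ ^ 2 + 2 * ‖u‖ ^ 2 := by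
  have := parallelogram_law_with_norm ℝ a u
  simp only [pairOfMidpoint_zero, pairOfMidpoint_one]
  linarith

theorem norm_sub_pairOfMidpoint (a u : CSpace d) :
    ‖pairOfMidpoint (a, u) 1 - pairOfMidpoint (a, u) 0‖ ^ 2 = 4 * ‖u‖ ^ 2 := by
  have : pairOfMidpoint (a, u) 1 - pairOfMidpoint (a, u) 0 = (-2 : ℝ) • u := by
    simp only [pairOfMidpoint_zero, pairOfMidpoint_one]; module
  rw [this, norm_smul, mul_pow]
  norm_num

theorem measurable_eigDensity (γ c : ℝ) : Measurable (eigDensity d γ c) := by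
  unfold eigDensity
  have h : ∀ j : ℕ, Measurable fun l : Points d 2 =>
      1 / ((d - 1 - j)! : ℝ) * (2 ^ j / γ ^ (j + 1)) * (1 / ‖l 1 - l 0‖ ^ (2 * j)) := fun j => by
    fun_prop
  exact Measurable.mul (by fun_prop) (Finset.measurable_fun_sum _ fun j _ => h j)

/-- The difference of the points is `-2 u`, whence the powers of `4`. The binomial coefficient times
`j !` leaves `1 / (d - 1 - j)!`, with `(d - 1)!` in the constant. -/
theorem ofReal_mul_schurIntegral_eq (hd : 1 ≤ d) {γ : ℝ} (hγ : 0 < γ) (a : CSpace d)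
    {u : CSpace d} (hu : u ≠ 0) :
    ENNReal.ofReal (Real.exp (-(2 * γ) * ‖a‖ ^ 2)) *
        (ENNReal.ofReal (‖u‖ ^ 4) * schurIntegral d (γ * ‖u‖ ^ 2)) =
      ENNReal.ofReal (Real.pi * ((d - 1)! : ℝ) * 2 ^ (d - 1) / 4) *
        ENNReal.ofReal (eigDensity d γ 1 (pairOfMidpoint (a, u))) := by
  have hu' := norm_pos_iff.2 hu
  rw [schurIntegral_eq d (by positivity), ← ENNReal.ofReal_mul (by positivity),
    ← ENNReal.ofReal_mul (by positivity), ← ENNReal.ofReal_mul (by positivity)]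
  congr 1
  rw [eigDensity, norm_sq_add_norm_sq_pairOfMidpoint, norm_sub_pairOfMidpoint,
    show d - 1 + 1 = d by omega, Finset.mul_sum, Finset.mul_sum, Finset.mul_sum, Finset.mul_sum]
  refine Finset.sum_congr rfl fun j hj => ?_
  have hj' : j ≤ d - 1 := by have := Finset.mem_range.1 hj; omega
  rw [pow_mul, norm_sub_pairOfMidpoint, mul_add, Real.exp_add,
    show -(2 * γ) * ‖a‖ ^ 2 = -γ * (2 * ‖a‖ ^ 2) by ring,
    show -(2 * (γ * ‖u‖ ^ 2)) = -γ * (2 * ‖u‖ ^ 2) by ring]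
  have hch : ((d - 1).choose j : ℝ) * (j ! : ℝ) * ((d - 1 - j)! : ℝ) = ((d - 1)! : ℝ) := by
    exact_mod_cast Nat.choose_mul_factorial_mul_factorial hj'
  have h2 : (2 : ℝ) ^ (d - 1) = 2 ^ (d - 1 - j) * 2 ^ j := by
    rw [← pow_add]; congr 1; omega
  have h4 : (4 : ℝ) ^ j = 2 ^ j * 2 ^ j := by rw [← mul_pow]; norm_num
  have hf : ((d - 1 - j)! : ℝ) ≠ 0 := by positivity
  rw [← hch, h2, mul_pow 4, h4, mul_pow γ, ← pow_mul]
  field_simp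
  ring

theorem exists_lintegral_eigDensity (hd : 1 ≤ d) {γ : ℝ} (hγ : 0 < γ) :
    ∃ K : ℝ≥0∞, K ≠ 0 ∧ K ≠ ∞ ∧
    ∀ (F : MatTuple d 2 → ℝ≥0∞) (f : Points d 2 → ℝ≥0∞), Measurable F → Measurable f →
    (∀ a v w τ, τ ^ 2 = sqEigenvalue w →
      F (rankOne a v w) = f (pairOfMidpoint (a, τ • v))) →
    ∫⁻ X, F X * ENNReal.ofReal (Real.exp (-γ * ‖X‖ ^ 2)) ∂modelMeasure d =
      K * ∫⁻ l, f l * ENNReal.ofReal (eigDensity d γ 1 l) := by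
  have : Nonempty (Fin d) := ⟨⟨0, hd⟩⟩
  obtain ⟨K₁, h₁0, h₁t, hK₁⟩ := exists_lintegral_modelMeasure hd
  obtain ⟨K₂, h₂0, h₂t, hK₂⟩ := exists_lintegral_pairOfMidpoint d
  set k := ENNReal.ofReal (Real.pi * ((d - 1)! : ℝ) * 2 ^ (d - 1) / 4) with hk
  have hk0 : k ≠ 0 := by
    rw [hk, Ne, ENNReal.ofReal_eq_zero, not_le]; positivity
  have hkt : k ≠ ∞ := ENNReal.ofReal_ne_top
  refine ⟨K₁ * k * K₂⁻¹, mul_ne_zero (mul_ne_zero h₁0 hk0) (ENNReal.inv_ne_zero.2 h₂t),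
    ENNReal.mul_ne_top (ENNReal.mul_ne_top h₁t hkt) (ENNReal.inv_ne_top.2 h₂0),
    fun F f hF hf hFf => ?_⟩
  have hpm : Measurable (pairOfMidpoint : CSpace d × CSpace d → Points d 2) :=
    (pairEquiv d).continuous.measurable
  have hff : Measurable fun p : CSpace d × CSpace d => f (pairOfMidpoint (p.1, p.2)) := hf.comp hpm
  have hmd := measurable_eigDensity (d := d) γ 1
  have hfe : Measurable fun l => f l * ENNReal.ofReal (eigDensity d γ 1 l) :=
    hf.mul hmd.ennreal_ofReal
  rw [hK₁ γ F (fun a u => f (pairOfMidpoint (a, u))) hF hff hFf, hK₂ _ hfe]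
  have h1 : ∀ a : CSpace d, ∫⁻ u, ENNReal.ofReal (Real.exp (-(2 * γ) * ‖a‖ ^ 2)) *
        (ENNReal.ofReal (‖u‖ ^ 4) * f (pairOfMidpoint (a, u))) * schurIntegral d (γ * ‖u‖ ^ 2) =
      k * ∫⁻ u, f (pairOfMidpoint (a, u)) *
        ENNReal.ofReal (eigDensity d γ 1 (pairOfMidpoint (a, u))) := by
    intro a
    rw [← lintegral_const_mul' _ _ hkt]
    refine lintegral_congr_ae ?_
    filter_upwards [Measure.ae_ne volume (0 : CSpace d)] with u hu
    have h2 := ofReal_mul_schurIntegral_eq hd hγ a hu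
    rw [← hk] at h2
    calc _ = f (pairOfMidpoint (a, u)) * (ENNReal.ofReal (Real.exp (-(2 * γ) * ‖a‖ ^ 2)) *
        (ENNReal.ofReal (‖u‖ ^ 4) * schurIntegral d (γ * ‖u‖ ^ 2))) := by ring
      _ = _ := by rw [h2]; ring
  simp_rw [h1]
  rw [lintegral_const_mul' _ _ hkt, mul_assoc (K₁ * k), ← mul_assoc K₂⁻¹,
    ENNReal.inv_mul_cancel h₂0 h₂t, one_mul, mul_assoc]

end MatTuple

/-! ### Symmetric functions of the joint eigenvalues. -/

/-- A vector is determined up to sign by the products of its coordinates. -/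
theorem eq_or_eq_neg_of_mul_eq_mul {ι K : Type*} [Field K] {u v : ι → K}
    (h : ∀ r s, u r * u s = v r * v s) : v = u ∨ v = -u := by
  by_cases h0 : ∃ r, u r ≠ 0
  · obtain ⟨r, hr⟩ := h0
    have hsq : v r * v r = u r * u r := (h r r).symm
    rcases mul_self_eq_mul_self_iff.1 hsq with h1 | h1
    · left
      funext s
      have := h r s
      rw [h1] at this
      exact (mul_left_cancel₀ hr this).symm
    · right
      funext s
      have h2 := h r s
      rw [h1] at h2
      exact mul_left_cancel₀ hr (by rw [Pi.neg_apply]; linear_combination h2)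
  · push Not at h0
    left
    funext r
    have h1 := h r r
    rw [h0 r, mul_zero] at h1
    rw [h0 r]
    exact mul_self_eq_zero.1 h1.symm

/-- Vectors with prescribed products of coordinates can be chosen measurably. -/
theorem exists_measurable_mul_eq {α ι : Type*} [MeasurableSpace α] [Fintype ι]
    {Q : α → ι → ι → ℂ} (hQ : ∀ r s, Measurable fun x => Q x r s) :
    ∃ ω : α → ι → ℂ, Measurable ω ∧ ∀ x (u : ι → ℂ), (∀ r s, u r * u s = Q x r s) →
      ∀ r s, ω x r * ω x s = Q x r s := by
  classical
  -- Induction on a finite set supporting the unknown vector `u`.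
  suffices H : ∀ S : Finset ι, ∃ ω : α → ι → ℂ, Measurable ω ∧ ∀ x (u : ι → ℂ),
      (∀ r ∉ S, u r = 0) → (∀ r s, u r * u s = Q x r s) → ∀ r s, ω x r * ω x s = Q x r s by
    obtain ⟨ω, hω, h⟩ := H Finset.univ
    exact ⟨ω, hω, fun x u hu => h x u (fun r hr => absurd (Finset.mem_univ r) hr) hu⟩
  intro S
  induction S using Finset.induction_on with
  | empty =>
    refine ⟨0, measurable_const, fun x u h0 hu r s => ?_⟩
    rw [← hu r s, h0 r (Finset.notMem_empty r)]
    simp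
  | insert k S hk ih =>
    obtain ⟨ω, hω, h⟩ := ih
    -- A nonzero `Q x k k` is the square of the `k`-th coordinate, so the principal square root
    -- fixes that coordinate and division gives the others. If it vanishes, `u k = 0` and the
    -- support shrinks.
    refine ⟨fun x r => if Q x k k = 0 then ω x r else Q x r k / Q x k k ^ ((2 : ℕ) : ℂ)⁻¹,
      ?_, fun x u h0 hu r s => ?_⟩
    · refine measurable_pi_iff.2 fun r => Measurable.ite
        (measurableSet_eq_fun (hQ k k) measurable_const) (measurable_pi_iff.1 hω r) ?_
      exact (hQ r k).div ((hQ k k).pow_const _)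
    · by_cases hz : Q x k k = 0
      · have huk : u k = 0 := mul_self_eq_zero.1 ((hu k k).trans hz)
        simp only [hz, if_true]
        refine h x u (fun t ht => ?_) hu r s
        by_cases htk : t = k
        · rw [htk, huk]
        · exact h0 t (by simp [htk, ht])
      · have hroot := Complex.cpow_nat_inv_pow (Q x k k) two_ne_zero
        have hne : Q x k k ^ ((2 : ℕ) : ℂ)⁻¹ ≠ 0 := fun hc => hz (by
          rw [← hroot, hc]; norm_num)
        simp only [hz, if_false]
        rw [div_mul_div_comm, ← pow_two (Q x k k ^ ((2 : ℕ) : ℂ)⁻¹), hroot, div_eq_iff hz,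
          ← hu, ← hu, ← hu, ← hu]
        ring

namespace MatTuple

variable {d : ℕ}

/-- The products of the coordinates of the half difference of the two joint eigenvalues. -/
def gapProduct (X : MatTuple d 2) (r s : Fin d) : ℂ :=
  (X.comp r * X.comp s).trace / 2 - center X r * center X s

theorem gapProduct_eq (X : MatTuple d 2) (r s : Fin d) : gapProduct X r s =
    (X (r, 0, 0) * X (s, 0, 0) + X (r, 0, 1) * X (s, 1, 0) +
      (X (r, 1, 0) * X (s, 0, 1) + X (r, 1, 1) * X (s, 1, 1))) / 2 -
        center X r * center X s := by
  simp [gapProduct, Matrix.trace_fin_two, Matrix.mul_apply, Fin.sum_univ_two, MatTuple.comp]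

theorem measurable_gapProduct (r s : Fin d) : Measurable fun X => gapProduct X r s := by
  simp_rw [gapProduct_eq, center_apply]
  fun_prop

theorem gapProduct_eq_coords (X : MatTuple d 2) (r s : Fin d) : gapProduct X r s =
    (coords r X 0 * coords s X 0 + coords r X 1 * coords s X 2 +
      coords r X 2 * coords s X 1) / 2 := by
  rw [gapProduct_eq, coords_zero, coords_zero, div_mul_div_comm, sqrt_two_mul_self]
  simp only [center_apply, coords_one, coords_two]
  ring

/-- For `τ² = sqEigenvalue w` these are the products of the coordinates of `τ • v`, whichever root
is taken. -/
theorem gapProduct_rankOne (a v : CSpace d) (w : CSpace 3) (r s : Fin d) :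
    gapProduct (rankOne a v w) r s = v r * v s * sqEigenvalue w := by
  rw [gapProduct_eq_coords, coords_rankOne, coords_rankOne, sqEigenvalue]
  simp only [PiLp.smul_apply, smul_eq_mul]
  ring

end MatTuple

open MatTuple

variable {d : ℕ}

theorem Matrix.trace_mul_fin_two_of_upper {A B : Matrix (Fin 2) (Fin 2) ℂ} (hA : A 1 0 = 0)
    (hB : B 1 0 = 0) : (A * B).trace = A 0 0 * B 0 0 + A 1 1 * B 1 1 := by
  simp [Matrix.trace_fin_two, Matrix.mul_apply, Fin.sum_univ_two, hA, hB]

theorem IsEigenvalueListing.center_eq {X : MatTuple d 2} {l : Points d 2}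
    (h : IsEigenvalueListing X l) (r : Fin d) : center X r = (l 0 r + l 1 r) / 2 := by
  obtain ⟨U, hU, h⟩ := h
  have hU' : U * Uᴴ = 1 := Matrix.mem_unitaryGroup_iff.1 hU
  have ht : (Uᴴ * X.comp r * U).trace = (X.comp r).trace := by
    rw [Matrix.trace_mul_comm, ← Matrix.mul_assoc, hU', Matrix.one_mul]
  rw [Matrix.trace_fin_two, Matrix.trace_fin_two, (h r).2, (h r).2] at ht
  rw [center_apply, ht]
  rfl

/-- Traces of products are unitarily invariant, and for upper triangular matrices they involve only
the diagonals. -/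
theorem IsEigenvalueListing.gapProduct_eq {X : MatTuple d 2} {l : Points d 2}
    (h : IsEigenvalueListing X l) (r s : Fin d) :
    gapProduct X r s = (l 0 r - l 1 r) / 2 * ((l 0 s - l 1 s) / 2) := by
  have hc := h.center_eq
  obtain ⟨U, hU, h⟩ := h
  have hU' : U * Uᴴ = 1 := Matrix.mem_unitaryGroup_iff.1 hU
  have ht : ((Uᴴ * X.comp r * U) * (Uᴴ * X.comp s * U)).trace = (X.comp r * X.comp s).trace := by
    have : (Uᴴ * X.comp r * U) * (Uᴴ * X.comp s * U) = Uᴴ * (X.comp r * X.comp s * U) := by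
      calc _ = Uᴴ * X.comp r * (U * Uᴴ) * X.comp s * U := by simp only [Matrix.mul_assoc]
        _ = _ := by rw [hU', Matrix.mul_one]; simp only [Matrix.mul_assoc]
    rw [this, Matrix.trace_mul_comm, Matrix.mul_assoc, hU', Matrix.mul_one]
  rw [Matrix.trace_mul_fin_two_of_upper ((h r).1 1 0 Fin.zero_lt_one)
    ((h s).1 1 0 Fin.zero_lt_one), (h r).2, (h r).2, (h s).2, (h s).2] at ht
  rw [gapProduct, ← ht, hc, hc]
  ring

theorem pairOfMidpoint_neg (a u : CSpace d) :
    pairOfMidpoint (a, -u) = pairOfMidpoint (a, u) ∘ Equiv.swap 0 1 := by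
  funext k
  fin_cases k
  · simp [sub_eq_add_neg]
  · simp [sub_eq_add_neg]

/-- Symmetric functions of the joint eigenvalues are measurable functions of the tuple. -/
theorem exists_measurable_eq_of_isEigenvalueListing {f : Points d 2 → ℝ≥0∞} (hf : Measurable f)
    (hsym : ∀ (σ : Equiv.Perm (Fin 2)) l, f (l ∘ σ) = f l) :
    ∃ F : MatTuple d 2 → ℝ≥0∞, Measurable F ∧
      (∀ a v w τ, τ ^ 2 = sqEigenvalue w →
        F (rankOne a v w) = f (pairOfMidpoint (a, τ • v))) ∧
      ∀ X l, IsEigenvalueListing X l → F X = f l := by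
  obtain ⟨ω, hω, h⟩ := exists_measurable_mul_eq (measurable_gapProduct (d := d))
  -- Two half differences with the same products agree up to sign, and changing the sign exchanges
  -- the two eigenvalues.
  have key : ∀ X (u : CSpace d), (∀ r s, u r * u s = gapProduct X r s) →
      f (pairOfMidpoint (center X, WithLp.toLp 2 (ω X))) = f (pairOfMidpoint (center X, u)) := by
    intro X u hu
    have h1 := h X u hu
    rcases eq_or_eq_neg_of_mul_eq_mul (u := fun r => u r) (v := ω X)
      (fun r s => (hu r s).trans (h1 r s).symm) with h2 | h2
    · rw [h2]
    · have : WithLp.toLp 2 (ω X) = -u := by rw [h2]; rfl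
      rw [this, pairOfMidpoint_neg, hsym]
  refine ⟨fun X => f (pairOfMidpoint (center X, WithLp.toLp 2 (ω X))), ?_, ?_, ?_⟩
  · have hc : Measurable (center : MatTuple d 2 → CSpace d) :=
      center.continuous_of_finiteDimensional.measurable
    exact hf.comp ((pairEquiv d).continuous.measurable.comp
      (hc.prodMk ((WithLp.measurable_toLp 2 _).comp hω)))
  · intro a v w τ hτ
    have := key (rankOne a v w) (τ • v) fun r s => by
      rw [gapProduct_rankOne, ← hτ]
      simp only [PiLp.smul_apply, smul_eq_mul]
      ring
    rw [center_rankOne] at this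
    simpa only [center_rankOne] using this
  · intro X l hl
    have h1 := key X ((2 : ℂ)⁻¹ • (l 0 - l 1)) fun r s => by
      rw [hl.gapProduct_eq]
      simp only [PiLp.smul_apply, PiLp.sub_apply, smul_eq_mul]
      ring
    have hc : center X = (2 : ℂ)⁻¹ • (l 0 + l 1) := by
      ext r
      rw [hl.center_eq]
      simp only [PiLp.smul_apply, PiLp.add_apply, smul_eq_mul]
      ring
    refine h1.trans (congrArg f ?_)
    funext k
    fin_cases k
    · simp only [Fin.zero_eta, pairOfMidpoint_zero, hc]; module
    · simp only [Fin.mk_one, pairOfMidpoint_one, hc]; module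

/-! ### Normalization and the law of the eigenvalues. -/

theorem gaussianCommuting_eq (hd : 1 ≤ d) (γ C : ℝ) : gaussianCommuting d 2 γ C =
    (hausdorffCommuting d).withDensity
      fun X => ENNReal.ofReal (C * Real.exp (-γ * ‖X‖ ^ 2)) := by
  rw [gaussianCommuting, dimH_commutingTuples hd, ENNReal.toReal_natCast, hausdorffCommuting]

theorem lintegral_gaussianCommuting (hd : 1 ≤ d) (γ : ℝ) {C : ℝ} (hC : 0 ≤ C)
    {F : MatTuple d 2 → ℝ≥0∞} (hF : Measurable F) :
    ∫⁻ X, F X ∂gaussianCommuting d 2 γ C = ENNReal.ofReal C *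
      ∫⁻ X, F X * ENNReal.ofReal (Real.exp (-γ * ‖X‖ ^ 2)) ∂hausdorffCommuting d := by
  rw [gaussianCommuting_eq hd, lintegral_withDensity_eq_lintegral_mul _ (by fun_prop) hF,
    ← lintegral_const_mul' _ _ ENNReal.ofReal_ne_top]
  refine lintegral_congr fun X => ?_
  rw [Pi.mul_apply, ENNReal.ofReal_mul hC]
  ring

theorem eigDensity_eq_mul (γ c : ℝ) (l : Points d 2) :
    eigDensity d γ c l = c * eigDensity d γ 1 l := by
  simp only [eigDensity]; ring

theorem eigDensity_comp_perm (γ c : ℝ) (σ : Equiv.Perm (Fin 2)) (l : Points d 2) :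
    eigDensity d γ c (l ∘ σ) = eigDensity d γ c l := by
  have h : ∀ σ : Equiv.Perm (Fin 2), (σ 0 = 0 ∧ σ 1 = 1) ∨ (σ 0 = 1 ∧ σ 1 = 0) := by decide
  rcases h σ with ⟨h0, h1⟩ | ⟨h0, h1⟩
  · simp only [eigDensity, Function.comp_apply, h0, h1]
  · simp only [eigDensity, Function.comp_apply, h0, h1, norm_sub_rev (l 0) (l 1),
      add_comm (‖l 1‖ ^ 2)]

/-- The normalizing constants, and the integrals of symmetric functions of the eigenvalues. -/
theorem exists_lintegral_gaussianCommuting (hd : 1 ≤ d) {γ : ℝ} (hγ : 0 < γ) :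
    ∃ K D : ℝ≥0∞, K ≠ 0 ∧ K ≠ ∞ ∧ D ≠ 0 ∧ D ≠ ∞ ∧
      D = ∫⁻ l : Points d 2, ENNReal.ofReal (eigDensity d γ 1 l) ∧
      ∀ C : ℝ, 0 < C → ∀ (F : MatTuple d 2 → ℝ≥0∞) (f : Points d 2 → ℝ≥0∞),
        Measurable F → Measurable f →
        (∀ a v w τ, τ ^ 2 = sqEigenvalue w →
          F (rankOne a v w) = f (pairOfMidpoint (a, τ • v))) →
        ∫⁻ X, F X ∂gaussianCommuting d 2 γ C =
          ENNReal.ofReal C * K * ∫⁻ l, f l * ENNReal.ofReal (eigDensity d γ 1 l) := by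
  obtain ⟨c, hc0, hct, hc⟩ := exists_modelMeasure_eq_smul hd
  obtain ⟨K, hK0, hKt, hK⟩ := exists_lintegral_eigDensity hd hγ
  have h1 := hK (fun _ => 1) (fun _ => 1) measurable_const measurable_const
    (fun _ _ _ _ _ => rfl)
  simp only [one_mul] at h1
  have hpos : ∫⁻ X, ENNReal.ofReal (Real.exp (-γ * ‖X‖ ^ 2)) ∂modelMeasure d ≠ 0 :=
    lintegral_ofReal_pos (isHomogeneousMeasure_modelMeasure hd).ne_zero (by fun_prop)
      (Eventually.of_forall fun X => Real.exp_pos _)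
  have hfin := (lintegral_gaussian_modelMeasure (d := d) hγ).ne
  rw [h1] at hpos hfin
  have hD0 := right_ne_zero_of_mul hpos
  refine ⟨c * K, _, mul_ne_zero hc0 hK0, ENNReal.mul_ne_top hct hKt, hD0, fun hD => ?_, rfl,
    fun C hC F f hF hf hFf => ?_⟩
  · rw [hD, ENNReal.mul_top hK0] at hfin
    exact hfin rfl
  · rw [lintegral_gaussianCommuting hd γ hC.le hF, hc, lintegral_smul_measure, smul_eq_mul,
      hK F f hF hf hFf]
    ring

theorem exists_isProbabilityMeasure_gaussianCommuting (hd : 1 ≤ d) {γ : ℝ} (hγ : 0 < γ) :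
    ∃ C : ℝ, 0 < C ∧ IsProbabilityMeasure (gaussianCommuting d 2 γ C) := by
  obtain ⟨K, D, hK0, hKt, hD0, hDt, hD, h⟩ := exists_lintegral_gaussianCommuting hd hγ
  have h0 : K * D ≠ 0 := mul_ne_zero hK0 hD0
  have ht : K * D ≠ ∞ := ENNReal.mul_ne_top hKt hDt
  have hC : 0 < ((K * D)⁻¹).toReal :=
    ENNReal.toReal_pos (ENNReal.inv_ne_zero.2 ht) (ENNReal.inv_ne_top.2 h0)
  refine ⟨_, hC, ⟨?_⟩⟩
  have h1 := h _ hC (fun _ => 1) (fun _ => 1) measurable_const measurable_const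
    (fun _ _ _ _ _ => rfl)
  simp only [one_mul, lintegral_one] at h1
  rw [h1, ← hD, ENNReal.ofReal_toReal (ENNReal.inv_ne_top.2 h0), mul_assoc,
    ENNReal.inv_mul_cancel h0 ht]

/-- Testing with the constant `1` forces `C * K * D = 1`, so the normalized density has constant
`D⁻¹`, the inverse of the total mass of `eigDensity d γ 1`, whatever `C` and `K` are. -/
theorem exists_lintegral_symmetric (hd : 1 ≤ d) {γ : ℝ} (hγ : 0 < γ) :
    ∃ c : ℝ, 0 < c ∧ ∀ C : ℝ, 0 < C → IsProbabilityMeasure (gaussianCommuting d 2 γ C) →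
      ∀ (F : MatTuple d 2 → ℝ≥0∞) (f : Points d 2 → ℝ≥0∞), Measurable F → Measurable f →
        (∀ a v w τ, τ ^ 2 = sqEigenvalue w →
          F (rankOne a v w) = f (pairOfMidpoint (a, τ • v))) →
        ∫⁻ X, F X ∂gaussianCommuting d 2 γ C =
          ∫⁻ l, f l * ENNReal.ofReal (eigDensity d γ c l) := by
  obtain ⟨K, D, hK0, hKt, hD0, hDt, hD, h⟩ := exists_lintegral_gaussianCommuting hd hγ
  have hc : 0 < (D⁻¹).toReal :=
    ENNReal.toReal_pos (ENNReal.inv_ne_zero.2 hDt) (ENNReal.inv_ne_top.2 hD0)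
  refine ⟨_, hc, fun C hC hP F f hF hf hFf => ?_⟩
  have h1 := h C hC (fun _ => 1) (fun _ => 1) measurable_const measurable_const
    (fun _ _ _ _ _ => rfl)
  simp only [one_mul, lintegral_one, measure_univ] at h1
  rw [← hD] at h1
  have h2 : ENNReal.ofReal C * K = D⁻¹ := ENNReal.eq_inv_of_mul_eq_one_left h1.symm
  rw [h C hC F f hF hf hFf, h2, ← lintegral_const_mul' _ _ (ENNReal.inv_ne_top.2 hD0)]
  refine lintegral_congr fun l => ?_
  rw [eigDensity_eq_mul γ (D⁻¹).toReal, ENNReal.ofReal_mul hc.le,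
    ENNReal.ofReal_toReal (ENNReal.inv_ne_top.2 hD0)]
  ring

theorem measurePreserving_comp_perm {n : ℕ} (σ : Equiv.Perm (Fin n)) :
    MeasurePreserving (fun l : Points d n => l ∘ σ) volume volume := by
  have h := volume_measurePreserving_piCongrLeft (fun _ : Fin n => CSpace d) σ.symm
  convert h using 1
  funext l k
  have := MeasurableEquiv.piCongrLeft_apply_apply (β := fun _ : Fin n => CSpace d) σ.symm l (σ k)
  rw [Equiv.symm_apply_apply] at this
  exact this.symm

/-- Summing an indicator over all permutations gives a symmetric test function. Exchangeability
makes the terms on one side equal, symmetry of `ρ` those on the other, and the common factor `n!`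
cancels. -/
theorem hasEigenvalueDensity_of_symmetric {n : ℕ} {Ω : Type*} [MeasurableSpace Ω] {P : Measure Ω}
    {X : Ω → MatTuple d n} {ρ : Points d n → ℝ} (hρ : Measurable ρ)
    (hρs : ∀ (σ : Equiv.Perm (Fin n)) l, ρ (l ∘ σ) = ρ l)
    (h : ∀ f : Points d n → ℝ≥0∞, Measurable f →
      (∀ (σ : Equiv.Perm (Fin n)) l, f (l ∘ σ) = f l) →
      ∀ L : Ω → Points d n, (∀ᵐ ω ∂P, IsEigenvalueListing (X ω) (L ω)) →
        ∫⁻ ω, f (L ω) ∂P = ∫⁻ l, f l * ENNReal.ofReal (ρ l)) :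
    HasEigenvalueDensity P X ρ := by
  classical
  refine ⟨h, fun L hL hLX hexch => ?_⟩
  ext s hs
  have hmc : ∀ σ : Equiv.Perm (Fin n), Measurable fun l : Points d n => l ∘ σ := fun σ =>
    (measurePreserving_comp_perm σ).measurable
  set g : Points d n → ℝ≥0∞ := s.indicator fun _ => 1 with hg
  have hgm : Measurable g := measurable_const.indicator hs
  have hN0 : ((Fintype.card (Equiv.Perm (Fin n)) : ℕ) : ℝ≥0∞) ≠ 0 := by
    exact_mod_cast Fintype.card_ne_zero
  have hsum := h (fun l => ∑ σ : Equiv.Perm (Fin n), g (l ∘ σ))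
    (Finset.measurable_fun_sum _ fun σ _ => hgm.comp (hmc σ))
    (fun τ l => Fintype.sum_equiv (Equiv.mulLeft τ) _ _ fun σ => rfl) L hLX
  have hleft : ∀ σ : Equiv.Perm (Fin n), ∫⁻ ω, g (L ω ∘ σ) ∂P = P.map L s := by
    intro σ
    have hLσ : AEMeasurable (fun ω => L ω ∘ σ) P := (hmc σ).comp_aemeasurable hL
    rw [← hexch σ, ← lintegral_map' hgm.aemeasurable hLσ, hg, lintegral_indicator_const hs, one_mul]
  have hright : ∀ σ : Equiv.Perm (Fin n),
      ∫⁻ l, g (l ∘ σ) * ENNReal.ofReal (ρ l) =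
        (volume : Measure (Points d n)).withDensity (fun l => ENNReal.ofReal (ρ l)) s := by
    intro σ
    rw [withDensity_apply _ hs, ← lintegral_indicator hs]
    have := (measurePreserving_comp_perm (d := d) σ).lintegral_comp
      (f := fun l => g l * ENNReal.ofReal (ρ l)) (hgm.mul hρ.ennreal_ofReal)
    simp only [hρs] at this
    rw [this]
    refine lintegral_congr fun l => ?_
    by_cases hl : l ∈ s <;> simp [hg, hl]
  simp only [Finset.sum_mul] at hsum
  have hcomp : ∀ σ : Equiv.Perm (Fin n), AEMeasurable (fun ω => g (L ω ∘ σ)) P := fun σ =>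
    (hgm.comp (hmc σ)).comp_aemeasurable hL
  have hprod : ∀ σ : Equiv.Perm (Fin n),
      Measurable fun l : Points d n => g (l ∘ σ) * ENNReal.ofReal (ρ l) := fun σ =>
    (hgm.comp (hmc σ)).mul hρ.ennreal_ofReal
  rw [lintegral_finsetSum' _ fun σ _ => hcomp σ,
    lintegral_finsetSum _ fun σ _ => hprod σ] at hsum
  simp only [hleft, hright, Finset.sum_const, Finset.card_univ, nsmul_eq_mul] at hsum
  exact (ENNReal.mul_right_inj hN0 (ENNReal.natCast_ne_top _)).1 hsum

/-- The last term `j = d - 1` alone gives a lower bound of order `‖l 1 - l 0‖ ^ (-2(d - 2))`, whose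
exponent is negative as soon as `d ≥ 3`. -/
theorem tendsto_eigDensity_atTop (hd : 3 ≤ d) {γ c : ℝ} (hγ : 0 < γ) (hc : 0 < c) (a : CSpace d) :
    Tendsto (eigDensity d γ c) (𝓝[{l : Points d 2 | l 0 ≠ l 1}] (fun _ => a)) atTop := by
  set k : ℝ := c * (2 ^ (d - 1) / γ ^ d) with hk
  have hk0 : 0 < k := by positivity
  have hlow : ∀ᶠ l in 𝓝[{l : Points d 2 | l 0 ≠ l 1}] (fun _ => a),
      (k * Real.exp (-γ * (‖l 0‖ ^ 2 + ‖l 1‖ ^ 2))) * (‖l 1 - l 0‖ ^ (2 * (d - 2)))⁻¹ ≤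
        eigDensity d γ c l := by
    filter_upwards [self_mem_nhdsWithin] with l hl
    have hδ : 0 < ‖l 1 - l 0‖ := norm_pos_iff.2 (sub_ne_zero.2 (Ne.symm hl))
    have hterm := Finset.single_le_sum (f := fun j : ℕ =>
      1 / ((d - 1 - j)! : ℝ) * (2 ^ j / γ ^ (j + 1)) * (1 / ‖l 1 - l 0‖ ^ (2 * j)))
      (fun j _ => by positivity) (Finset.mem_range.2 (show d - 1 < d by omega))
    have hm := mul_le_mul_of_nonneg_left hterm (show 0 ≤ c *
      Real.exp (-γ * (‖l 0‖ ^ 2 + ‖l 1‖ ^ 2)) * ‖l 1 - l 0‖ ^ 2 by positivity)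
    refine le_trans (le_of_eq ?_) hm
    have e : ‖l 1 - l 0‖ ^ (2 * (d - 1)) = ‖l 1 - l 0‖ ^ (2 * (d - 2)) * ‖l 1 - l 0‖ ^ 2 := by
      rw [← pow_add]; congr 1; omega
    simp only [Nat.sub_self, Nat.factorial_zero, Nat.cast_one, show d - 1 + 1 = d by omega, e, hk]
    field_simp
  refine tendsto_atTop_mono' _ hlow ?_
  have hexp : Tendsto (fun l : Points d 2 => k * Real.exp (-γ * (‖l 0‖ ^ 2 + ‖l 1‖ ^ 2)))
      (𝓝[{l : Points d 2 | l 0 ≠ l 1}] (fun _ => a))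
      (𝓝 (k * Real.exp (-γ * (‖a‖ ^ 2 + ‖a‖ ^ 2)))) := by
    have hcont : Continuous fun l : Points d 2 =>
      k * Real.exp (-γ * (‖l 0‖ ^ 2 + ‖l 1‖ ^ 2)) := by fun_prop
    exact (hcont.tendsto (fun _ => a)).mono_left nhdsWithin_le_nhds
  refine hexp.pos_mul_atTop (by positivity) (Tendsto.inv_tendsto_nhdsGT_zero ?_)
  refine tendsto_nhdsWithin_iff.2 ⟨?_, ?_⟩
  · have hcont : Continuous fun l : Points d 2 => ‖l 1 - l 0‖ ^ (2 * (d - 2)) := by fun_prop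
    have := (hcont.tendsto (fun _ => a)).mono_left
      (nhdsWithin_le_nhds (s := {l : Points d 2 | l 0 ≠ l 1}))
    rwa [sub_self, norm_zero, zero_pow (by omega)] at this
  · filter_upwards [self_mem_nhdsWithin] with l hl
    have hδ : 0 < ‖l 1 - l 0‖ := norm_pos_iff.2 (sub_ne_zero.2 (Ne.symm hl))
    exact pow_pos hδ _

end

theorem theorem4p6 (d : ℕ) (hd : 1 ≤ d) (γ : ℝ) (hγ : 0 < γ) :
    -- the Gaussian weight can be normalized
    (∃ C : ℝ, 0 < C ∧ IsProbabilityMeasure (gaussianCommuting d 2 γ C)) ∧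
    ∃ c : ℝ, 0 < c ∧
      -- the eigenvalues of every Gaussian random commuting tuple have density `eigDensity d γ c`
      (∀ C : ℝ, 0 < C → IsProbabilityMeasure (gaussianCommuting d 2 γ C) →
        ∀ (Ω : Type*) [MeasurableSpace Ω] (P : Measure Ω) [IsProbabilityMeasure P]
          (X : Ω → MatTuple d 2), AEMeasurable X P → P.map X = gaussianCommuting d 2 γ C →
          HasEigenvalueDensity P X (eigDensity d γ c)) ∧
      -- the explicit formulas for `d = 1, 2, 3`
      (d = 1 → ∀ l : Points d 2, l 0 ≠ l 1 → eigDensity d γ c l =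
        c * Real.exp (-γ * (‖l 0‖ ^ 2 + ‖l 1‖ ^ 2)) * (1 / γ * ‖l 1 - l 0‖ ^ 2)) ∧
      (d = 2 → ∀ l : Points d 2, l 0 ≠ l 1 → eigDensity d γ c l =
        c * Real.exp (-γ * (‖l 0‖ ^ 2 + ‖l 1‖ ^ 2)) *
          (1 / γ * ‖l 1 - l 0‖ ^ 2 + 2 / γ ^ 2)) ∧
      (d = 3 → ∀ l : Points d 2, l 0 ≠ l 1 → eigDensity d γ c l =
        c * Real.exp (-γ * (‖l 0‖ ^ 2 + ‖l 1‖ ^ 2)) *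
          (1 / (2 * γ) * ‖l 1 - l 0‖ ^ 2 + 2 / γ ^ 2 + 4 / γ ^ 3 * (‖l 1 - l 0‖ ^ 2)⁻¹)) ∧
      -- attraction for `d ≥ 3`: the density blows up where the two eigenvalues collide
      (3 ≤ d → ∀ a : EuclideanSpace ℂ (Fin d),
        Tendsto (eigDensity d γ c) (𝓝[{l : Points d 2 | l 0 ≠ l 1}] (fun _ => a)) atTop) := by
  obtain ⟨c, hc, h⟩ := exists_lintegral_symmetric hd hγ
  refine ⟨exists_isProbabilityMeasure_gaussianCommuting hd hγ, c, hc, ?_, ?_, ?_, ?_,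
    fun hd3 a => tendsto_eigDensity_atTop hd3 hγ hc a⟩
  · intro C hC hprob Ω _ P _ X hX hPX
    refine hasEigenvalueDensity_of_symmetric (MatTuple.measurable_eigDensity γ c)
      (eigDensity_comp_perm γ c) fun f hf hsym L hL => ?_
    obtain ⟨F, hF, hFr, hFl⟩ := exists_measurable_eq_of_isEigenvalueListing hf hsym
    rw [← h C hC hprob F f hF hf hFr, ← hPX, lintegral_map' hF.aemeasurable hX]
    refine lintegral_congr_ae ?_
    filter_upwards [hL] with ω hω
    exact (hFl _ _ hω).symm
  · rintro rfl l -
    simp [eigDensity, mul_assoc, mul_comm]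
  · rintro rfl l hl
    have hδ : ‖l 1 - l 0‖ ≠ 0 := norm_ne_zero_iff.2 (sub_ne_zero.2 hl.symm)
    simp [eigDensity, Finset.sum_range_succ]
    field_simp
  · rintro rfl l hl
    have hδ : ‖l 1 - l 0‖ ≠ 0 := norm_ne_zero_iff.2 (sub_ne_zero.2 hl.symm)
    simp [eigDensity, Finset.sum_range_succ]
    field_simp
    ring
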